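/- **Setting.** Let $n>2$, $I=\{1,\dots,n-1\}$, and let $\mathbb K$ be a field of characteristic $0$ containing elements $r^{1/2},s^{1/2}$ whose squares $r,s$ are algebraically independent over $\mathbb Q$ (e.g. $\mathbb K=\mathbb Q(r^{1/2},s^{1/2})$). Let $(a_{ij})$ be the Cartan matrix of type $A_{n-1}$, $\alpha_i=\varepsilon_i-\varepsilon_{i+1}$ with $\varepsilon_1,\dots,\varepsilon_n$ orthonormal, and $\langle i,j\rangle=r^{(\varepsilon_j,\alpha_i)}s^{(\varepsilon_{j+1},\alpha_i)}$, extended to a bicharacter $\langle\omega'_\alpha,\omega_\beta\rangle$ of the root lattice; half-integral powers of $\langle i,j\rangle$ and $rs$ are formed with $r^{1/2},s^{1/2}$. Write $[a,b]_q=ab-q\,ba$ and $[a,b]=[a,b]_1$. Let $\mathcal U=\mathcal U_{r,s}(\widehat{\mathfrak{sl}_n})$ be the unital associative $\mathbb K$-algebra (Drinfeld realization) generated by $x_i^\pm(k)$, $a_i(\ell)$, $\omega_i^{\pm1}$, $\omega_i'^{\pm1}$, $\gamma^{\pm1/2}$, $\gamma'^{\pm1/2}$, $D^{\pm1}$, $D'^{\pm1}$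 ($i\in I$, $k\in\mathbb Z$, $\ell\in\mathbb Z\setminus\{0\}$) with the following relations, for all indices, where $c_{ij}(\ell)=(rs)^{|\ell|/2}\big(\langle i,i\rangle^{\ell a_{ij}/2}-\langle i,i\rangle^{-\ell a_{ij}/2}\big)$: - $\gamma^{\pm1/2},\gamma'^{\pm1/2}$ are central, $\gamma\gamma'=rs$; $\omega_i,\omega'_i,\gamma^{1/2},\gamma'^{1/2},D,D'$ commute with each other and are invertible with the indicated inverses; - $[a_i(\ell),a_j(\ell')]=\delta_{\ell+\ell',0}\dfrac{c_{ij}(\ell)}{|\ell|(r-s)}\cdot\dfrac{\gamma^{|\ell|}-\gamma'^{|\ell|}}{r-s}$, $\;[a_i(\ell),\omega_j^{\pm1}]=[a_i(\ell),\omega_j'^{\pm1}]=0$; - $Dx_i^\pm(k)D^{-1}=r^kx_i^\pm(k)$, $D'x_i^\pm(k)D'^{-1}=s^kx_i^\pm(k)$, $Da_i(\ell)D^{-1}=r^\ell a_i(\ell)$, $D'a_i(\ell)D'^{-1}=s^\ell a_i(\ell)$; - $\omega_ix_j^\pm(k)\omega_i^{-1}=\langle j,i\rangle^{\pm1}x_j^\pm(k)$,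 $\;\omega'_ix_j^\pm(k)\omega_i'^{-1}=\langle i,j\rangle^{\mp1}x_j^\pm(k)$; - $[a_i(\ell),x_j^\pm(k)]=\pm\dfrac{c_{ij}(\ell)}{\ell(r-s)}\,g^{\pm\ell/2}x_j^\pm(\ell+k)$, with $g=\gamma$ if $\ell<0$ and $g=\gamma'$ if $\ell>0$; - $x_i^\pm(k+1)x_j^\pm(k')-\langle j,i\rangle^{\pm1}x_j^\pm(k')x_i^\pm(k+1)=-\big(\langle j,i\rangle\langle i,j\rangle^{-1}\big)^{\pm1/2}\big(x_j^\pm(k'+1)x_i^\pm(k)-\langle i,j\rangle^{\pm1}x_i^\pm(k)x_j^\pm(k'+1)\big)$; - $[x_i^+(k),x_j^-(k')]=\dfrac{\delta_{ij}}{r-s}\Big(\gamma'^{-k}\gamma^{-\frac{k+k'}2}\omega_i(k+k')-\gamma^{k'}\gamma'^{\frac{k+k'}2}\omega'_i(k+k')\Big)$, where $\sum_{m\ge0}\omega_i(m)z^{-m}=\omega_i\exp\big((r-s)\sum_{\ell\ge1}a_i(\ell)z^{-\ell}\big)$, $\sum_{m\ge0}\omega'_i(-m)z^{m}=\omega'_i\exp\big(-(r-s)\sum_{\ell\ge1}a_i(-\ell)z^{\ell}\big)$,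 and $\omega_i(-m)=\omega'_i(m)=0$ for $m>0$; - $x_i^\pm(m)x_j^\pm(k)=x_j^\pm(k)x_i^\pm(m)$ if $a_{ij}=0$; - if $a_{ij}=-1$, put $\eta=\pm1$ for $i<j$ and $\eta=\mp1$ for $i>j$; then $x_i^\pm(m_1)x_i^\pm(m_2)x_j^\pm(k)-(r^{\eta}+s^{\eta})x_i^\pm(m_1)x_j^\pm(k)x_i^\pm(m_2)+(rs)^{\eta}x_j^\pm(k)x_i^\pm(m_1)x_i^\pm(m_2)$, symmetrized in $(m_1,m_2)$, is $0$. Let $\mathcal U_{r,s}(\mathfrak n)$ and $\mathcal U_{r,s}(\mathfrak n^-)$ be the subalgebras of $\mathcal U$ generated by the $x_i^+(0)$, respectively the $x_i^-(0)$, $i\in I$. For $1\le i<j\le n$ put $$x^+_{\alpha_{ij}}(0)=[\cdots[x_i^+(0),x_{i+1}^+(0)]_r,\cdots,x_{j-1}^+(0)]_r,\qquad x^-_{\alpha_{ij}}(0)=[x_{j-1}^-(0),\cdots,[x_{i+1}^-(0),x_i^-(0)]_s\cdots]_s .$$ **Lyndon bases.** A nonempty word in the alphabet $I$ (with its natural order)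 is Lyndon if it is lexicographically smaller than all its proper right factors. Let $J$ be the ideal of the free algebra on $x_1,\dots,x_{n-1}$ generated by the $(r,s)$-Serre elements $(\mathrm{ad}\,x_i)^{1-a_{ij}}(x_j)$, $i\ne j$, where $\mathrm{ad}\,x_i(y)=x_iy-\langle\omega'_\beta,\omega_i\rangle yx_i$ for $y$ of degree $\beta$. A word is good if modulo $J$ it is not a linear combination of words that are shorter, or of the same length and lexicographically greater. The quantum bracketing of a Lyndon word is the letter $x_i^+(0)$ for the one-letter word $i$, and otherwise $[w]=\big[[u],[v]\big]_{\langle\omega'_{\deg u},\omega_{\deg v}\rangle^{-1}}$, where $w=uv$ and $u$ is the longest proper left factor of $w$ that is Lyndon (the same rule being applied to $v$). A family is a Lyndon basis of $\mathcal U_{r,s}(\mathfrak n)$ if it is a $\mathbb K$-basis of it and consists of the products $[l_1][l_2]\cdots[l_k]$, one for each finite sequence of good Lyndon words $l_1\ge l_2\ge\cdots\ge l_k$ in lexicographic order. A Lyndon basis of $\mathcal U_{r,s}(\mathfrak n^-)$ is defined in the mirrored way: a $\mathbb K$-basis that satisfies the same condition with all products in the opposite order, $r$ and $s$ exchanged,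 and $x_i^-(0)$ in place of $x_i^+(0)$. **Theorem.** (i) The monomials $$x_{\alpha_{n-1,n}}^+(0)^{\ell_{n-1,n}}\cdots x_{\alpha_{23}}^+(0)^{\ell_{23}}\,x_{\alpha_{1n}}^+(0)^{\ell_{1n}}\cdots x_{\alpha_{13}}^+(0)^{\ell_{13}}\,x_{\alpha_{12}}^+(0)^{\ell_{12}},\qquad \ell_{ij}\ge0,$$ form a Lyndon basis of $\mathcal U_{r,s}(\mathfrak n)$. (ii) The monomials $$x_{\alpha_{12}}^-(0)^{\ell_{12}}\,x_{\alpha_{13}}^-(0)^{\ell_{13}}\cdots x_{\alpha_{1n}}^-(0)^{\ell_{1n}}\,x_{\alpha_{23}}^-(0)^{\ell_{23}}\cdots x_{\alpha_{n-1,n}}^-(0)^{\ell_{n-1,n}},\qquad \ell_{ij}\ge0,$$ form a Lyndon basis of $\mathcal U_{r,s}(\mathfrak n^-)$. In both cases the roots are taken along the convex order $\alpha_{12},\alpha_{13},\dots,\alpha_{1n},\alpha_{23},\dots,\alpha_{2n},\dots,\alpha_{n-1,n}$ (reversed in (i)), and distinct exponent vectors $(\ell_{ij})$ give distinct basis elements.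 -/

import Mathlib

noncomputable section

namespace QAff

/-! ### Root data of type `A_{n-1}` and the pairing

Simple roots are indexed by `Fin (n - 1)`, counted from `0`, so that the index `i` stands for the
simple root `ε_i - ε_{i+1}` with `ε_0, …, ε_{n-1}` orthonormal. -/

/-- The integer `(ε_k, α_i)`, where `α_i = ε_i - ε_{i+1}`. -/
def epsAlpha (k i : ℕ) : ℤ := (if k = i then 1 else 0) - (if k = i + 1 then 1 else 0)

/-- The pairing `⟨i, j⟩ = ⟨ω'_i, ω_j⟩ = r ^ (ε_j, α_i) * s ^ (ε_{j+1}, α_i)`. -/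
def pairing {K : Type*} [Field K] {m : ℕ} (r s : K) (i j : Fin m) : K :=
  r ^ epsAlpha j i * s ^ epsAlpha (j + 1) i

/-- The two signs `+` and `-`. -/
inductive PM : Type
  | pos
  | neg

/-- A sign as an integer. -/
def PM.sgn : PM → ℤ
  | PM.pos => 1
  | PM.neg => -1

/-- The quantum Lie bracket `[a, b]_q = a b - q b a`. -/
def qbr {K A : Type*} [Field K] [Ring A] [Algebra K A] (q : K) (a b : A) : A :=
  a * b - q • (b * a)

/-! ### The two-parameter quantum affine algebra in its Drinfeld realization -/

/-- Names of the invertible toral generators. Here `gam` and `gam'` stand for `γ^{1/2}` and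
`γ'^{1/2}`. -/
inductive Tor (n : ℕ) : Type
  | om (i : Fin (n - 1))
  | om' (i : Fin (n - 1))
  | gam
  | gam'
  | d
  | d'

/-- The generators: `x_i^±(k)`, `a_i(l)` with `l ≠ 0`, and the toral generators together with
their inverses (`tor t PM.neg` is the inverse of `tor t PM.pos`). -/
inductive Gen (n : ℕ) : Type
  | x (e : PM) (i : Fin (n - 1)) (k : ℤ)
  | a (i : Fin (n - 1)) (l : ℤ) (hl : l ≠ 0)
  | tor (t : Tor n) (e : PM)

section Free

variable (K : Type*) [Field K] (n : ℕ)

/-- The free algebra on the generators. -/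
abbrev FreeGen := FreeAlgebra K (Gen n)

variable {n}

/-- `x_i^±(k)` in the free algebra. -/
def fx (e : PM) (i : Fin (n - 1)) (k : ℤ) : FreeGen K n := FreeAlgebra.ι K (Gen.x e i k)

/-- `a_i(l)` in the free algebra for `l ≠ 0` (the value `0` at `l = 0` is never used). -/
def fa (i : Fin (n - 1)) (l : ℤ) : FreeGen K n :=
  if hl : l ≠ 0 then FreeAlgebra.ι K (Gen.a i l hl) else 0

/-- A toral generator or its inverse in the free algebra. -/
def ft (t : Tor n) (e : PM) : FreeGen K n := FreeAlgebra.ι K (Gen.tor t e)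

/-- Integral powers of a toral generator. -/
def tpow (t : Tor n) (k : ℤ) : FreeGen K n :=
  if 0 ≤ k then ft K t PM.pos ^ k.toNat else ft K t PM.neg ^ (-k).toNat

/-- The coefficient of `u ^ m` in the formal exponential `exp (c * ∑_{l ≥ 1} b l * u ^ l)`. The
part of order `p` of the exponential contributes, for all `(l_1, …, l_p)` with `l_1 + … + l_p = m`
and `l_i ≥ 1`, the term `c ^ p / p! * b l_1 * … * b l_p`. -/
def expCoeff {A : Type*} [Ring A] [Algebra K A] (c : K) (b : ℕ → A) (m : ℕ) : A :=
  ∑ p : Composition m, (c ^ p.length / (p.length.factorial : K)) • (p.blocks.map b).prod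

/-- `ω_i(m)`: the coefficient of `z ^ (-m)` in `ω_i exp ((r-s) ∑_{l ≥ 1} a_i(l) z ^ (-l))`. -/
def omSeries (r s : K) (i : Fin (n - 1)) (m : ℤ) : FreeGen K n :=
  if 0 ≤ m then
    ft K (Tor.om i) PM.pos * expCoeff K (r - s) (fun l => fa K i (l : ℤ)) m.toNat
  else 0

/-- `ω'_i(m)`: the coefficient of `z ^ (-m)` in `ω'_i exp (-(r-s) ∑_{l ≥ 1} a_i(-l) z ^ l)`. -/
def omSeries' (r s : K) (i : Fin (n - 1)) (m : ℤ) : FreeGen K n :=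
  if m ≤ 0 then
    ft K (Tor.om' i) PM.pos * expCoeff K (-(r - s)) (fun l => fa K i (-(l : ℤ))) (-m).toNat
  else 0

/-- The scalar `(rs)^{|l|/2} (⟨i,i⟩^{l a_ij / 2} - ⟨i,i⟩^{- l a_ij / 2})`. Half-integral powers are
taken through `rh = r^{1/2}` and `sh = s^{1/2}`; so `⟨i,i⟩^{1/2}` is `pairing rh sh i i`. -/
def heis (rh sh : K) (i j : Fin (n - 1)) (l : ℤ) : K :=
  (rh * sh) ^ l.natAbs *
    (pairing rh sh i i ^ (l * CartanMatrix.A (n - 1) i j)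
      - pairing rh sh i i ^ (-(l * CartanMatrix.A (n - 1) i j)))

/-- The left-hand side of the `(r,s)`-Serre relation before symmetrization, where the parameters
`(r, s)` are replaced by `(r ^ f, s ^ f)`. -/
def serreTerm (r s : K) (e : PM) (f : ℤ) (i j : Fin (n - 1)) (m₁ m₂ k : ℤ) : FreeGen K n :=
  fx K e i m₁ * fx K e i m₂ * fx K e j k
    - (r ^ f + s ^ f) • (fx K e i m₁ * fx K e j k * fx K e i m₂)
    + ((r * s) ^ f) • (fx K e j k * fx K e i m₁ * fx K e i m₂)

/-- The defining relations of the Drinfeld realization, with `rh = r^{1/2}`, `sh = s^{1/2}`. -/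
inductive DrinfeldRel (r s rh sh : K) : FreeGen K n → FreeGen K n → Prop
  -- inverses, commutativity of the toral part, `γ^{1/2}` and `γ'^{1/2}` central, `γ γ' = r s`
  | inv_right (t : Tor n) : DrinfeldRel r s rh sh (ft K t PM.pos * ft K t PM.neg) 1
  | inv_left (t : Tor n) : DrinfeldRel r s rh sh (ft K t PM.neg * ft K t PM.pos) 1
  | tor_comm (t t' : Tor n) (e e' : PM) :
      DrinfeldRel r s rh sh (ft K t e * ft K t' e') (ft K t' e' * ft K t e)
  | gam_central (e : PM) (g : Gen n) :
      DrinfeldRel r s rh sh (ft K Tor.gam e * FreeAlgebra.ι K g) (FreeAlgebra.ι K g * ft K Tor.gam e)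
  | gam_central' (e : PM) (g : Gen n) :
      DrinfeldRel r s rh sh (ft K Tor.gam' e * FreeAlgebra.ι K g)
        (FreeAlgebra.ι K g * ft K Tor.gam' e)
  | gam_gam' :
      DrinfeldRel r s rh sh (tpow K Tor.gam 2 * tpow K Tor.gam' 2)
        (algebraMap K (FreeGen K n) (r * s))
  -- the relations among the `a_i(l)`
  | a_a (i j : Fin (n - 1)) (l l' : ℤ) (hl : l ≠ 0) (hl' : l' ≠ 0) :
      DrinfeldRel r s rh sh (fa K i l * fa K j l' - fa K j l' * fa K i l)
        (if l + l' = 0 then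
          (heis K rh sh i j l / ((l.natAbs : K) * (r - s)) / (r - s)) •
            (tpow K Tor.gam (2 * (l.natAbs : ℤ)) - tpow K Tor.gam' (2 * (l.natAbs : ℤ)))
        else 0)
  | a_om (i j : Fin (n - 1)) (l : ℤ) (hl : l ≠ 0) (e : PM) :
      DrinfeldRel r s rh sh (fa K i l * ft K (Tor.om j) e) (ft K (Tor.om j) e * fa K i l)
  | a_om' (i j : Fin (n - 1)) (l : ℤ) (hl : l ≠ 0) (e : PM) :
      DrinfeldRel r s rh sh (fa K i l * ft K (Tor.om' j) e) (ft K (Tor.om' j) e * fa K i l)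
  -- conjugation by `D` and `D'`
  | d_x (e : PM) (i : Fin (n - 1)) (k : ℤ) :
      DrinfeldRel r s rh sh (ft K Tor.d PM.pos * fx K e i k * ft K Tor.d PM.neg)
        (r ^ k • fx K e i k)
  | d_x' (e : PM) (i : Fin (n - 1)) (k : ℤ) :
      DrinfeldRel r s rh sh (ft K Tor.d' PM.pos * fx K e i k * ft K Tor.d' PM.neg)
        (s ^ k • fx K e i k)
  | d_a (i : Fin (n - 1)) (l : ℤ) (hl : l ≠ 0) :
      DrinfeldRel r s rh sh (ft K Tor.d PM.pos * fa K i l * ft K Tor.d PM.neg) (r ^ l • fa K i l)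
  | d_a' (i : Fin (n - 1)) (l : ℤ) (hl : l ≠ 0) :
      DrinfeldRel r s rh sh (ft K Tor.d' PM.pos * fa K i l * ft K Tor.d' PM.neg)
        (s ^ l • fa K i l)
  -- conjugation by `ω_i` and `ω'_i`
  | om_x (e : PM) (i j : Fin (n - 1)) (k : ℤ) :
      DrinfeldRel r s rh sh (ft K (Tor.om i) PM.pos * fx K e j k * ft K (Tor.om i) PM.neg)
        (pairing r s j i ^ e.sgn • fx K e j k)
  | om_x' (e : PM) (i j : Fin (n - 1)) (k : ℤ) :
      DrinfeldRel r s rh sh (ft K (Tor.om' i) PM.pos * fx K e j k * ft K (Tor.om' i) PM.neg)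
        (pairing r s i j ^ (-e.sgn) • fx K e j k)
  -- the commutator of `a_i(l)` with `x_j^±(k)`
  | a_x_neg (e : PM) (i j : Fin (n - 1)) (l k : ℤ) (hl : l < 0) :
      DrinfeldRel r s rh sh (fa K i l * fx K e j k - fx K e j k * fa K i l)
        (((e.sgn : K) * heis K rh sh i j l / ((l : K) * (r - s))) •
          (tpow K Tor.gam (e.sgn * l) * fx K e j (l + k)))
  | a_x_pos (e : PM) (i j : Fin (n - 1)) (l k : ℤ) (hl : 0 < l) :
      DrinfeldRel r s rh sh (fa K i l * fx K e j k - fx K e j k * fa K i l)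
        (((e.sgn : K) * heis K rh sh i j l / ((l : K) * (r - s))) •
          (tpow K Tor.gam' (e.sgn * l) * fx K e j (l + k)))
  -- the quadratic relations; `(⟨j,i⟩ ⟨i,j⟩⁻¹)^{1/2} = pairing rh sh j i * (pairing rh sh i j)⁻¹`
  | x_x (e : PM) (i j : Fin (n - 1)) (k k' : ℤ) :
      DrinfeldRel r s rh sh
        (fx K e i (k + 1) * fx K e j k' - pairing r s j i ^ e.sgn • (fx K e j k' * fx K e i (k + 1)))
        (-((pairing rh sh j i * (pairing rh sh i j)⁻¹) ^ e.sgn •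
          (fx K e j (k' + 1) * fx K e i k
            - pairing r s i j ^ e.sgn • (fx K e i k * fx K e j (k' + 1)))))
  -- the commutator of `x_i^+(k)` and `x_j^-(k')`
  | x_y (i j : Fin (n - 1)) (k k' : ℤ) :
      DrinfeldRel r s rh sh
        (fx K PM.pos i k * fx K PM.neg j k' - fx K PM.neg j k' * fx K PM.pos i k)
        (if i = j then
          (1 / (r - s)) •
            (tpow K Tor.gam' (-2 * k) * tpow K Tor.gam (-(k + k')) * omSeries K r s i (k + k')
              - tpow K Tor.gam (2 * k') * tpow K Tor.gam' (k + k') * omSeries' K r s i (k + k'))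
        else 0)
  -- the Serre relations
  | serre_comm (e : PM) (i j : Fin (n - 1)) (m k : ℤ) (h : CartanMatrix.A (n - 1) i j = 0) :
      DrinfeldRel r s rh sh (fx K e i m * fx K e j k) (fx K e j k * fx K e i m)
  | serre_lt (e : PM) (i j : Fin (n - 1)) (m₁ m₂ k : ℤ) (h : CartanMatrix.A (n - 1) i j = -1)
      (hij : i < j) :
      DrinfeldRel r s rh sh
        (serreTerm K r s e e.sgn i j m₁ m₂ k + serreTerm K r s e e.sgn i j m₂ m₁ k) 0
  | serre_gt (e : PM) (i j : Fin (n - 1)) (m₁ m₂ k : ℤ) (h : CartanMatrix.A (n - 1) i j = -1)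
      (hij : j < i) :
      DrinfeldRel r s rh sh
        (serreTerm K r s e (-e.sgn) i j m₁ m₂ k + serreTerm K r s e (-e.sgn) i j m₂ m₁ k) 0

end Free

section Algebra

variable {K : Type*} [Field K] (n : ℕ) (r s rh sh : K)

/-- The Drinfeld realization `𝒰_{r,s}(ŝl_n)`. -/
abbrev Uaff : Type _ := RingQuot (DrinfeldRel K (n := n) r s rh sh)

/-- The element `x_i^±(k)` of `𝒰_{r,s}(ŝl_n)`. -/
def xgen (e : PM) (k : ℤ) (i : Fin (n - 1)) : Uaff n r s rh sh :=
  RingQuot.mkAlgHom K (DrinfeldRel K (n := n) r s rh sh) (fx K e i k)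

/-- The subalgebras `𝒰_{r,s}(𝔫)` (sign `+`) and `𝒰_{r,s}(𝔫⁻)` (sign `-`), generated by the
`x_i^±(0)`. -/
def Ufin (e : PM) : Subalgebra K (Uaff n r s rh sh) :=
  Algebra.adjoin K (Set.range (xgen n r s rh sh e 0))

end Algebra

/-! ### Quantum root vectors and ordered monomials -/

/-- The positive roots `α_{ij} = ε_i - ε_j`, `i < j`. -/
def PosRoot (n : ℕ) : Type := {p : Fin n × Fin n // p.1 < p.2}

/-- The positive roots in the convex order
`α_{12}, α_{13}, …, α_{1n}, α_{23}, …, α_{2n}, …, α_{n-1,n}`. -/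
def posRootList (n : ℕ) : List (PosRoot n) :=
  (List.finRange n).flatMap fun i =>
    (List.finRange n).filterMap fun j => if h : i < j then some ⟨(i, j), h⟩ else none

/-- The indices `i, i+1, …, j-1` of the simple roots whose sum is `α_{ij}`. -/
def support {n : ℕ} (α : PosRoot n) : List (Fin (n - 1)) :=
  (List.finRange (n - 1)).filter fun k => decide (α.1.1.val ≤ k.val ∧ k.val < α.1.2.val)

section Roots

variable {K : Type*} [Field K] (n : ℕ) (r s rh sh : K)

/-- `[⋯[[a_1, a_2]_q, a_3]_q, ⋯, a_k]_q`. -/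
def leftBracket {A : Type*} [Ring A] [Algebra K A] (q : K) : List A → A
  | [] => 1
  | a :: l => l.foldl (fun b c => qbr q b c) a

/-- `[a_k, ⋯, [a_3, [a_2, a_1]_q]_q ⋯]_q`. -/
def rightBracket {A : Type*} [Ring A] [Algebra K A] (q : K) : List A → A
  | [] => 1
  | a :: l => l.foldl (fun b c => qbr q c b) a

/-- `x_{α_ij}^+(0) = [⋯[x_i^+(0), x_{i+1}^+(0)]_r, ⋯, x_{j-1}^+(0)]_r`. -/
def rootVecPos (α : PosRoot n) : Uaff n r s rh sh :=
  leftBracket r ((support α).map (xgen n r s rh sh PM.pos 0))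

/-- `x_{α_ij}^-(0) = [x_{j-1}^-(0), ⋯, [x_{i+1}^-(0), x_i^-(0)]_s ⋯]_s`. -/
def rootVecNeg (α : PosRoot n) : Uaff n r s rh sh :=
  rightBracket s ((support α).map (xgen n r s rh sh PM.neg 0))

/-- `x_{α_{n-1,n}}^+(0)^{ℓ_{n-1,n}} ⋯ x_{α_{13}}^+(0)^{ℓ_{13}} x_{α_{12}}^+(0)^{ℓ_{12}}`. -/
def monomialPos (ℓ : PosRoot n → ℕ) : Uaff n r s rh sh :=
  ((posRootList n).reverse.map fun α => rootVecPos n r s rh sh α ^ ℓ α).prod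

/-- `x_{α_{12}}^-(0)^{ℓ_{12}} x_{α_{13}}^-(0)^{ℓ_{13}} ⋯ x_{α_{n-1,n}}^-(0)^{ℓ_{n-1,n}}`. -/
def monomialNeg (ℓ : PosRoot n → ℕ) : Uaff n r s rh sh :=
  ((posRootList n).map fun α => rootVecNeg n r s rh sh α ^ ℓ α).prod

end Roots

/-! ### Lyndon words and Lyndon bases -/

/-- A Lyndon word: a nonempty word lexicographically smaller than all its proper right factors. -/
def IsLyndon {I : Type*} [LinearOrder I] (w : List I) : Prop :=
  w ≠ [] ∧ ∀ u v : List I, w = u ++ v → u ≠ [] → v ≠ [] → w < v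

/-- The strict order `v ≺ w` on words: `v` is shorter than `w`, or has the same length and is
lexicographically greater. -/
def WordPrec {I : Type*} [LinearOrder I] (v w : List I) : Prop :=
  v.length < w.length ∨ (v.length = w.length ∧ w < v)

section Lyndon

variable {K : Type*} [Field K]

/-- A word as an element of the free algebra. -/
def wordElt (K : Type*) [Field K] {I : Type*} (w : List I) : FreeAlgebra K I :=
  (w.map (FreeAlgebra.ι K)).prod

/-- A word is good with respect to `J` if it is not a linear combination of strictly smaller words
modulo `J`. -/
def IsGood {I : Type*} [LinearOrder I] (J : TwoSidedIdeal (FreeAlgebra K I)) (w : List I) : Prop :=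
  ¬ ∃ f ∈ Submodule.span K (wordElt K '' {v : List I | WordPrec v w}), wordElt K w - f ∈ J

/-- The value of the bicharacter `χ` on the degrees of two words. -/
def wordChar {I : Type*} (χ : I → I → K) (u v : List I) : K :=
  (u.map fun i => (v.map fun j => χ i j).prod).prod

/-- `IsBracketing χ x w a`: the element `a` is the quantum bracketing of the word `w` in the
letters `x i`. The bracketing of a letter is the letter. That of a longer word `w` is
`[u]·[v] - χ(u,v) [v]·[u]`, where `w = u v` and `u` is the longest proper left factor of `w` that is
a Lyndon word. -/
inductive IsBracketing {A I : Type*} [LinearOrder I] [Ring A] [Algebra K A]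
    (χ : I → I → K) (x : I → A) : List I → A → Prop
  | letter (i : I) : IsBracketing χ x [i] (x i)
  | bracket (u v : List I) (a b : A) (hu : IsLyndon u) (hv : v ≠ [])
      (hmax : ∀ u' v' : List I, u' ++ v' = u ++ v → v' ≠ [] → IsLyndon u' → u'.length ≤ u.length)
      (ha : IsBracketing χ x u a) (hb : IsBracketing χ x v b) :
      IsBracketing χ x (u ++ v) (qbr (wordChar χ u v) a b)

/-- `(ad x_i)^k (x_j)` in the free algebra, where `ad x_i (y) = x_i y - ⟨ω'_β, ω_i⟩ y x_i` for `y` of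
degree `β`, as given by the left adjoint action. -/
def adPow {m : ℕ} (r s : K) (i j : Fin m) : ℕ → FreeAlgebra K (Fin m)
  | 0 => FreeAlgebra.ι K j
  | k + 1 => qbr (pairing r s j i * pairing r s i i ^ k) (FreeAlgebra.ι K i) (adPow r s i j k)

/-- The `(r,s)`-Serre ideal, generated by `(ad x_i)^{1 - a_ij} (x_j)` for `i ≠ j`. -/
def serreIdeal (m : ℕ) (r s : K) : TwoSidedIdeal (FreeAlgebra K (Fin m)) :=
  TwoSidedIdeal.span
    {y | ∃ i j : Fin m, i ≠ j ∧ y = adPow r s i j (1 - CartanMatrix.A m i j).toNat}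

/-- The family `b` is a Lyndon family: it runs, without repetition of indices, through all products
`[l_1] [l_2] ⋯ [l_k]` of quantum bracketings of good Lyndon words `l_1 ≥ l_2 ≥ ⋯ ≥ l_k`. The words
are in the letters `x_0 < … < x_{m-1}`, goodness is with respect to the `(r,s)`-Serre ideal, and the
bracketing is by `[y, z]_{⟨ω'_α, ω_β⟩⁻¹}` for `y`, `z` of degrees `α`, `β`. -/
def IsLyndonFamily {A : Type*} [Ring A] [Algebra K A] {m : ℕ} (r s : K) (x : Fin m → A)
    {L : Type*} (b : L → A) : Prop :=
  ∃ β : List (Fin m) → A,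
    (∀ w, IsLyndon w → IsGood (serreIdeal m r s) w →
      IsBracketing (fun i j => (pairing r s i j)⁻¹) x w (β w)) ∧
    ∃ e : L ≃ {l : List (List (Fin m)) //
        l.Pairwise (fun u v => v ≤ u) ∧
          ∀ w ∈ l, IsLyndon w ∧ IsGood (serreIdeal m r s) w},
      ∀ i, b i = ((e i).1.map β).prod

/-- The family `b` is a basis over `K` of the subalgebra `S`. -/
def IsBasisOf {A : Type*} [Ring A] [Algebra K A] {L : Type*} (b : L → A) (S : Subalgebra K A) :
    Prop :=
  LinearIndependent K b ∧ Submodule.span K (Set.range b) = Subalgebra.toSubmodule S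

/-- The family `b` is a Lyndon basis of the subalgebra `S` in the letters `x i`. -/
def IsLyndonBasis {A : Type*} [Ring A] [Algebra K A] {m : ℕ} (r s : K) (x : Fin m → A)
    (S : Subalgebra K A) {L : Type*} (b : L → A) : Prop :=
  IsBasisOf b S ∧ IsLyndonFamily r s x b

/-- The mirror image of the notion of a Lyndon basis under an antiautomorphism that exchanges `r`
and `s`: products are read in the opposite order and `r`, `s` trade places. -/
def IsLyndonBasisOp {A : Type*} [Ring A] [Algebra K A] {m : ℕ} (r s : K) (x : Fin m → A)
    (S : Subalgebra K A) {L : Type*} (b : L → A) : Prop :=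
  IsBasisOf b S ∧
    IsLyndonFamily s r (fun i => MulOpposite.op (x i)) (fun i => MulOpposite.op (b i))

end Lyndon

end QAff

end

/-!
The theorem has two halves: the Serre relations show that the ordered monomials span and that they
are built on the good Lyndon words, and representations of the affine algebra show that they are
linearly independent.

*Spanning and combinatorics.* Attach to an interval `a ≤ k < b` of letters the root vector
`E_{a,b} = [⋯[x_a, x_{a+1}]_r, ⋯, x_{b-1}]_r`. The Serre relations give the commutation of root
vectors of distant or nested intervals, the relation `E_{a,c} = [E_{a,b}, E_{b,c}]_r`, the
`s`-commutation of root vectors with a common end point, and one correction term for overlapping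
intervals (`SerreSeq.comm_far`, `SerreSeq.split`, `SerreSeq.same_left`, `SerreSeq.same_right`,
`SerreSeq.overlap`). These rewrite a product of two root vectors in the wrong order into products
with greater words, or with the same word and fewer factors. Since there are finitely many words of
each length, every word is a combination of decreasing products of root vectors whose words are at
least as great (`SerreSeq.straighten`, `SerreSeq.wordProd_mem_span`), and such a product has the
concatenation of its intervals as leading word. Hence the ordered monomials span, and a good word is
a decreasing concatenation of intervals (`exists_concatWord_of_isGood`); it is a Lyndon word only if
there is a single interval. Conversely the matrix units `E_{i,i+1}` satisfy the Serre relations and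
detect the intervals, which are thus good (`isGood_of_map_val`). The bracketing of an interval is its
root vector (`isBracketing_interval`), so that the ordered monomials form a Lyndon family
(`isLyndonFamily_rootProd`).

*Independence.* It has to be excluded that the finite part collapses inside the affine algebra, so
representations of the full Drinfeld realization are needed. They are Drinfeld tensor products of
vector representations with spectral parameters `z_p`, one for each site `p`: on functions of a
configuration of sites, `x_i^+` moves one site from state `i` to `i + 1` and `x_i^-` moves it back,
with the weight `∏ (r z_p - s z_o) / (z_p - z_o)` (with `r` and `s` exchanged for `x_i^-`) over the
other sites `o` in the same state; a loop variable carries the grading by `D` and `D'`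
(`genOp`, `freeRep_rel`, `exists_rep`). Most relations are checked site by site. The commutator of
`x_i^+(k)` and `x_i^-(k')` is a sum of residues of a rational function, of which `ω_i(z)` and
`ω'_i(z)` are the expansions at infinity and at zero (`coeff_prod_fraction`, `sum_resid`,
`freeRep_pos_neg`).

Given a monomial, take one site for each factor, which has to travel through the interval of that
factor. The matrix coefficient of a word is then a sum over paths of configurations (`pathSum`). It
vanishes on all words greater than the leading word of the monomial
(`le_siteWord_of_pathSum_ne_zero`). The spectral parameters are resonant, `r z_p = s z_o`, exactly
for consecutive sites with equal intervals (`siteParam`); the zeros of the weights then leave a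
single path for the leading word, on which no weight vanishes because `r` and `s` are
multiplicatively independent (`pathSum_pos_ne_zero`, `pathSum_neg_ne_zero`). This triangularity
gives the linear independence (`exists_detecting_forms`, `linearIndependent_rootProd`).

*The negative part.* In the opposite algebra the elements `x_i^-(0)` satisfy the same Serre relations
with `r` and `s` exchanged (`satisfiesSerre_neg`), and the monomials turn into those of the positive
part (`op_rightBracket`, `isBasisOf_of_op`).
-/

noncomputable section

namespace QAff

set_option linter.unusedSectionVars false
set_option linter.unnecessarySeqFocus false

/-! ### Quantum root vectors and their commutation relations -/

section RootVectors

variable {K A : Type*} [Field K] [Ring A] [Algebra K A]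

theorem qbr_mul_of_qcomm {c₁ c₂ : K} (q : K) {u y z : A} (hy : y * u = c₁ • (u * y))
    (hz : z * u = c₂ • (u * z)) : qbr q y z * u = (c₁ * c₂) • (u * qbr q y z) := by
  have h1 : y * z * u = (c₁ * c₂) • (u * (y * z)) := by
    rw [mul_assoc, hz, mul_smul_comm, ← mul_assoc, hy, smul_mul_assoc, smul_smul, mul_assoc,
      mul_comm c₁]
  have h2 : z * y * u = (c₁ * c₂) • (u * (z * y)) := by
    rw [mul_assoc, hy, mul_smul_comm, ← mul_assoc, hz, smul_mul_assoc, smul_smul, mul_assoc]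
  simp only [qbr, sub_mul, mul_sub, smul_mul_assoc, mul_smul_comm, h1, h2, smul_sub]
  module

theorem mul_qbr_of_qcomm {c₁ c₂ : K} (q : K) {u y z : A} (hy : u * y = c₁ • (y * u))
    (hz : u * z = c₂ • (z * u)) : u * qbr q y z = (c₁ * c₂) • (qbr q y z * u) := by
  have h1 : u * (y * z) = (c₁ * c₂) • (y * z * u) := by
    rw [← mul_assoc, hy, smul_mul_assoc, mul_assoc, hz, mul_smul_comm, smul_smul, mul_assoc]
  have h2 : u * (z * y) = (c₁ * c₂) • (z * y * u) := by
    rw [← mul_assoc, hz, smul_mul_assoc, mul_assoc, hy, mul_smul_comm, smul_smul, mul_assoc,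
      mul_comm c₁]
  simp only [qbr, sub_mul, mul_sub, smul_mul_assoc, mul_smul_comm, h1, h2, smul_sub]
  module

theorem qbr_assoc (q : K) {x y z : A} (h : x * z = z * x) :
    qbr q (qbr q x y) z = qbr q x (qbr q y z) := by
  have h1 : y * x * z = y * z * x := by rw [mul_assoc, h, mul_assoc]
  have h2 : z * (x * y) = x * (z * y) := by rw [← mul_assoc, ← h, mul_assoc]
  simp only [qbr, sub_mul, mul_sub, smul_mul_assoc, mul_smul_comm, h1, h2, smul_sub, mul_assoc]
  rw [← mul_assoc z, ← h1, mul_assoc] at *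
  module

/-- Straightening of two overlapping root vectors: comparing the two ways of expanding
`[x, y]_r [y, z]_r` shows first that `y` commutes with `[[x, y]_r, z]_r`. -/
theorem qbr_overlap {r s : K} (hrs : r + s ≠ 0) {x y z : A} (hxz : x * z = z * x)
    (hl : qbr r x y * y = s • (y * qbr r x y)) (hr : y * qbr r y z = s • (qbr r y z * y)) :
    y * qbr r (qbr r x y) z = qbr r (qbr r x y) z * y ∧
      qbr r x y * qbr r y z =
        (r * s) • (qbr r y z * qbr r x y) + (s - r) • (y * qbr r (qbr r x y) z) := by
  set a := qbr r x y with ha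
  set b := qbr r y z with hb
  have ht : qbr r a z = qbr r x b := qbr_assoc r hxz
  set t := qbr r a z with htt
  have haz : a * z = t + r • (z * a) := by rw [htt, qbr]; abel
  have hxb : x * b = t + r • (b * x) := by rw [ht, qbr]; abel
  -- Expanding `b = [y, z]_r` on the one hand, and `a = [x, y]_r` on the other.
  have e1 : a * b = s • (y * t) - r • (t * y) + (r * s) • (b * a) := by
    have : a * b = a * y * z - r • (a * z * y) := by
      rw [hb, qbr, mul_sub, mul_smul_comm, mul_assoc, mul_assoc]
    rw [this, hl, haz, smul_mul_assoc, mul_assoc, haz, add_mul, smul_mul_assoc, mul_assoc, hl, hb,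
      qbr]
    simp only [mul_add, sub_mul, smul_mul_assoc, mul_smul_comm, mul_assoc]
    module
  have e2 : a * b = s • (t * y) - r • (y * t) + (r * s) • (b * a) := by
    have : a * b = x * (y * b) - r • (y * (x * b)) := by
      rw [ha, qbr, sub_mul, smul_mul_assoc, mul_assoc, mul_assoc]
    have h3 : y * (b * x) = s • (b * (y * x)) := by
      rw [← mul_assoc, hr, smul_mul_assoc, mul_assoc]
    rw [this, hr, hxb, mul_smul_comm, ← mul_assoc, hxb, mul_add, mul_smul_comm, h3, ha, qbr]
    simp only [mul_sub, add_mul, smul_mul_assoc, mul_smul_comm, mul_assoc]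
    module
  have h : y * t = t * y := by
    have h0 : (r + s) • (y * t - t * y) = 0 := by
      have := e1.symm.trans e2
      have h' := sub_eq_zero.mpr this
      rw [← h']
      module
    exact sub_eq_zero.mp ((smul_eq_zero.mp h0).resolve_left hrs)
  refine ⟨h, ?_⟩
  rw [e1, ← h]
  module

/-- The `(r,s)`-Serre relations of type `A` for a sequence of elements, the cubic ones being
written as `q`-commutations of a letter with the bracket of two consecutive letters. -/
structure SerreSeq (r s : K) (x : ℕ → A) : Prop where
  comm : ∀ i j, i + 2 ≤ j → x i * x j = x j * x i
  left : ∀ i, x i * qbr r (x i) (x (i + 1)) = s • (qbr r (x i) (x (i + 1)) * x i)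
  right : ∀ i, qbr r (x i) (x (i + 1)) * x (i + 1) = s • (x (i + 1) * qbr r (x i) (x (i + 1)))

/-- The root vector `[⋯[x_a, x_{a+1}]_r, ⋯, x_{b-1}]_r` attached to the interval `a ≤ k < b`. -/
def rootElt (r : K) (x : ℕ → A) (a b : ℕ) : A :=
  leftBracket r ((List.range' a (b - a)).map x)

variable {r s : K} {x : ℕ → A}

theorem leftBracket_concat (q : K) {l : List A} (hl : l ≠ []) (y : A) :
    leftBracket q (l ++ [y]) = qbr q (leftBracket q l) y := by
  cases l with
  | nil => exact absurd rfl hl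
  | cons a l => simp [leftBracket, List.foldl_append]

theorem rootElt_self_succ (r : K) (x : ℕ → A) (a : ℕ) : rootElt r x a (a + 1) = x a := by
  simp [rootElt, leftBracket]

theorem rootElt_succ (r : K) (x : ℕ → A) {a b : ℕ} (h : a < b) :
    rootElt r x a (b + 1) = qbr r (rootElt r x a b) (x b) := by
  have h1 : b + 1 - a = (b - a) + 1 := by omega
  have h2 : a + 1 * (b - a) = b := by omega
  rw [rootElt, h1, List.range'_concat, h2, List.map_append, List.map_singleton,
    leftBracket_concat, rootElt]
  simp; omega

theorem SerreSeq.comm_rootElt_right (h : SerreSeq r s x) {i a b : ℕ} (hab : a < b)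
    (hi : i + 2 ≤ a) : x i * rootElt r x a b = rootElt r x a b * x i := by
  induction b, hab using Nat.le_induction with
  | base => rw [rootElt_self_succ]; exact h.comm _ _ hi
  | succ b hb ih =>
    rw [rootElt_succ r x hb]
    have := mul_qbr_of_qcomm (c₁ := 1) (c₂ := 1) r (u := x i) (y := rootElt r x a b) (z := x b)
      (by simpa using ih) (by simpa using h.comm i b (by omega))
    simpa using this

theorem SerreSeq.comm_rootElt_left (h : SerreSeq r s x) {i a b : ℕ} (hab : a < b)
    (hi : b + 1 ≤ i) : rootElt r x a b * x i = x i * rootElt r x a b := by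
  induction b, hab using Nat.le_induction with
  | base => rw [rootElt_self_succ]; exact h.comm _ _ (by omega)
  | succ b hb ih =>
    rw [rootElt_succ r x hb]
    have := qbr_mul_of_qcomm (c₁ := 1) (c₂ := 1) r (u := x i) (y := rootElt r x a b) (z := x b)
      (by simpa using ih (by omega)) (by simpa using h.comm b i (by omega))
    simpa using this

theorem SerreSeq.comm_far (h : SerreSeq r s x) {a b c d : ℕ} (hab : a < b) (hbc : b < c)
    (hcd : c < d) : rootElt r x a b * rootElt r x c d = rootElt r x c d * rootElt r x a b := by
  induction b, hab using Nat.le_induction with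
  | base => rw [rootElt_self_succ]; exact h.comm_rootElt_right hcd (by omega)
  | succ b hb ih =>
    rw [rootElt_succ r x hb]
    have := qbr_mul_of_qcomm (c₁ := 1) (c₂ := 1) r (u := rootElt r x c d)
      (y := rootElt r x a b) (z := x b)
      (by simpa using ih (by omega)) (by simpa using h.comm_rootElt_right hcd (by omega))
    simpa using this

/-- A root vector is the bracket of the root vectors of the two parts of its interval, wherever the
interval is cut. -/
theorem SerreSeq.split (h : SerreSeq r s x) {a b c : ℕ} (hab : a < b) (hbc : b < c) :
    rootElt r x a c = qbr r (rootElt r x a b) (rootElt r x b c) := by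
  induction c, hbc using Nat.le_induction with
  | base => rw [rootElt_succ r x hab, rootElt_self_succ]
  | succ c hc ih =>
    rw [rootElt_succ r x (by omega), ih, rootElt_succ r x hc]
    exact qbr_assoc r (h.comm_rootElt_left hab hc)

/-- `E_{a,b+1} x_b = s x_b E_{a,b+1}`. -/
theorem SerreSeq.rootElt_mul_last (h : SerreSeq r s x) {a b : ℕ} (hab : a < b) :
    rootElt r x a (b + 1) * x b = s • (x b * rootElt r x a (b + 1)) := by
  rcases Nat.lt_or_ge (a + 1) b with h1 | h1
  · obtain ⟨b, rfl⟩ : ∃ c, b = c + 1 := ⟨b - 1, by omega⟩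
    rw [h.split (a := a) (b := b) (by omega) (by omega)]
    have e : rootElt r x b (b + 1 + 1) = qbr r (x b) (x (b + 1)) := by
      rw [rootElt_succ r x (by omega), rootElt_self_succ]
    have := qbr_mul_of_qcomm (c₁ := 1) (c₂ := s) r (u := x (b + 1))
      (y := rootElt r x a b) (z := rootElt r x b (b + 1 + 1))
      (by simpa using h.comm_rootElt_left (by omega) (by omega)) (by rw [e]; exact h.right b)
    simpa using this
  · obtain rfl : b = a + 1 := by omega
    rw [rootElt_succ r x (by omega), rootElt_self_succ]
    exact h.right a

variable (hne : r + s ≠ 0)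
include hne

/-- `E_{a,b} E_{a,b+1} = s E_{a,b+1} E_{a,b}`. -/
theorem SerreSeq.same_left_succ (h : SerreSeq r s x) {a b : ℕ} (hab : a < b) :
    rootElt r x a b * rootElt r x a (b + 1) = s • (rootElt r x a (b + 1) * rootElt r x a b) := by
  induction b, hab using Nat.le_induction with
  | base =>
    rw [Nat.succ_eq_add_one, rootElt_succ r x (a := a) (b := a + 1) (by omega), rootElt_self_succ]
    exact h.left a
  | succ b hb ih =>
    have e : rootElt r x b (b + 1 + 1) = qbr r (x b) (x (b + 1)) := by
      rw [rootElt_succ r x (by omega), rootElt_self_succ]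
    have e' : rootElt r x a (b + 1 + 1) = qbr r (qbr r (rootElt r x a b) (x b)) (x (b + 1)) := by
      rw [rootElt_succ r x (by omega), rootElt_succ r x hb]
    have hcomm : x b * rootElt r x a (b + 1 + 1) = rootElt r x a (b + 1 + 1) * x b := by
      rw [e']
      refine (qbr_overlap (s := s) hne ?_ ?_ (h.left b)).1
      · exact h.comm_rootElt_left hb (by omega)
      · rw [← rootElt_succ r x hb]; exact h.rootElt_mul_last hb
    have hy : rootElt r x a b * rootElt r x a (b + 1 + 1)
        = s • (rootElt r x a (b + 1 + 1) * rootElt r x a b) := by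
      have e2 : rootElt r x a (b + 1 + 1) = qbr r (rootElt r x a (b + 1)) (x (b + 1)) :=
        rootElt_succ r x (by omega)
      rw [e2]
      have := mul_qbr_of_qcomm (c₁ := s) (c₂ := 1) r (u := rootElt r x a b)
        (y := rootElt r x a (b + 1)) (z := x (b + 1)) ih
        (by simpa using h.comm_rootElt_left hb (by omega))
      simpa using this
    conv_lhs => rw [rootElt_succ r x hb]
    conv_rhs => rw [rootElt_succ r x hb]
    have := qbr_mul_of_qcomm (c₁ := s) (c₂ := 1) r (u := rootElt r x a (b + 1 + 1))
      (y := rootElt r x a b) (z := x b) hy (by simpa using hcomm)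
    simpa using this

theorem SerreSeq.same_left (h : SerreSeq r s x) {a b c : ℕ} (hab : a < b) (hbc : b < c) :
    rootElt r x a b * rootElt r x a c = s • (rootElt r x a c * rootElt r x a b) := by
  induction c, hbc using Nat.le_induction with
  | base => exact h.same_left_succ hne hab
  | succ c hc ih =>
    rw [rootElt_succ r x (by omega : a < c)]
    have := mul_qbr_of_qcomm (c₁ := s) (c₂ := 1) r (u := rootElt r x a b)
      (y := rootElt r x a c) (z := x c) ih (by simpa using h.comm_rootElt_left hab hc)
    simpa using this

/-- `E_{b,c} E_{b+1,c} = s E_{b+1,c} E_{b,c}`. -/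
theorem SerreSeq.same_right_succ (h : SerreSeq r s x) {b c : ℕ} (hbc : b + 1 < c) :
    rootElt r x b c * rootElt r x (b + 1) c = s • (rootElt r x (b + 1) c * rootElt r x b c) := by
  obtain ⟨k, rfl⟩ : ∃ k, c = b + 2 + k := ⟨c - b - 2, by omega⟩
  clear hbc
  induction k generalizing b with
  | zero => simpa [rootElt_self_succ] using h.rootElt_mul_last (Nat.lt_succ_self b)
  | succ k ih =>
    have e0 : b + 2 + (k + 1) = b + 1 + 2 + k := by ring
    rw [e0]
    set c := b + 1 + 2 + k with hc
    have hs : rootElt r x (b + 1) c = qbr r (x (b + 1)) (rootElt r x (b + 2) c) := by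
      rw [h.split (a := b + 1) (b := b + 2) (by omega) (by omega), rootElt_self_succ]
    have hs2 : rootElt r x b c = qbr r (x b) (rootElt r x (b + 1) c) := by
      rw [h.split (a := b) (b := b + 1) (by omega) (by omega), rootElt_self_succ]
    have h1 : rootElt r x b c * rootElt r x (b + 2) c
        = s • (rootElt r x (b + 2) c * rootElt r x b c) := by
      rw [hs2]
      have := qbr_mul_of_qcomm (c₁ := 1) (c₂ := s) r (u := rootElt r x (b + 2) c)
        (y := x b) (z := rootElt r x (b + 1) c)
        (by simpa using h.comm_rootElt_right (by omega) (by omega)) ih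
      simpa using this
    have h2 : rootElt r x b c * x (b + 1) = x (b + 1) * rootElt r x b c := by
      have hsp : rootElt r x b c = qbr r (qbr r (x b) (x (b + 1))) (rootElt r x (b + 2) c) := by
        rw [hs2, hs, qbr_assoc]
        exact h.comm_rootElt_right (by omega) (by omega)
      rw [hsp]
      refine (qbr_overlap (s := s) hne ?_ (h.right b) ?_).1.symm
      · exact h.comm_rootElt_right (by omega) (by omega)
      · rw [← hs]
        have := h.same_left hne (a := b + 1) (b := b + 2) (c := c) (by omega) (by omega)
        rwa [rootElt_self_succ] at this
    conv_lhs => rw [hs]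
    conv_rhs => rw [hs]
    have := mul_qbr_of_qcomm (c₁ := 1) (c₂ := s) r (u := rootElt r x b c)
      (y := x (b + 1)) (z := rootElt r x (b + 2) c) (by simpa using h2) h1
    simpa using this

theorem SerreSeq.same_right (h : SerreSeq r s x) {a b c : ℕ} (hab : a < b) (hbc : b < c) :
    rootElt r x a c * rootElt r x b c = s • (rootElt r x b c * rootElt r x a c) := by
  obtain ⟨b, rfl⟩ : ∃ k, b = k + 1 := ⟨b - 1, by omega⟩
  rcases Nat.lt_or_ge a b with h1 | h1
  · rw [h.split (a := a) (b := b) h1 (by omega)]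
    have := qbr_mul_of_qcomm (c₁ := 1) (c₂ := s) r (u := rootElt r x (b + 1) c)
      (y := rootElt r x a b) (z := rootElt r x b c)
      (by simpa using h.comm_far h1 (by omega) hbc) (h.same_right_succ hne hbc)
    simpa using this
  · obtain rfl : a = b := by omega
    exact h.same_right_succ hne hbc

/-- The two intervals `[a, c)` and `[b, d)` overlap in `[b, c)` and have the union `[a, d)`; the
root vectors of these two commute and give the correction term. -/
theorem SerreSeq.overlap (h : SerreSeq r s x) {a b c d : ℕ} (hab : a < b) (hbc : b < c)
    (hcd : c < d) :
    rootElt r x b c * rootElt r x a d = rootElt r x a d * rootElt r x b c ∧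
      rootElt r x a c * rootElt r x b d =
        (r * s) • (rootElt r x b d * rootElt r x a c)
          + (s - r) • (rootElt r x b c * rootElt r x a d) := by
  have h1 := h.split hab hbc
  have h2 := h.split hbc hcd
  have h3 := h.split (hab.trans hbc) hcd
  have := qbr_overlap (s := s) hne (h.comm_far hab hbc hcd)
    (by rw [← h1]; exact h.same_right hne hab hbc) (by rw [← h2]; exact h.same_left hne hbc hcd)
  rwa [← h1, ← h2, ← h3] at this

end RootVectors

/-! ### Straightening products of root vectors -/

section Words

theorem append_lt_append_of_length_eq {I : Type*} [LinearOrder I] {u v : List I} (u' v' : List I)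
    (h : u < v) (hl : u.length = v.length) : u ++ u' < v ++ v' := by
  induction u generalizing v with
  | nil => cases v with
    | nil => exact absurd h (lt_irrefl _)
    | cons b v => simp at hl
  | cons a u ih => cases v with
    | nil => simp at hl
    | cons b v =>
      rw [List.cons_append, List.cons_append, List.cons_lt_cons_iff]
      rcases List.cons_lt_cons_iff.mp h with h | ⟨h, h'⟩
      · exact Or.inl h
      · exact Or.inr ⟨h, ih h' (by simpa using hl)⟩

theorem append_lt_append_left_iff {I : Type*} [LinearOrder I] (w : List I) {u v : List I} :
    w ++ u < w ++ v ↔ u < v := by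
  induction w with
  | nil => rfl
  | cons a w ih => rw [List.cons_append, List.cons_append, List.cons_lt_cons_iff, ih]; simp

/-- An interval `(a, b)` stands for the letters `a ≤ k < b`, that is, for a positive root. -/
def segWord (u : ℕ × ℕ) : List ℕ := List.range' u.1 (u.2 - u.1)

/-- The lexicographic order `u ≥ v` on intervals. -/
def SegGE (u v : ℕ × ℕ) : Prop := v.1 < u.1 ∨ (v.1 = u.1 ∧ v.2 ≤ u.2)

/-- A nonempty interval of letters smaller than `m`. -/
def IsSeg (m : ℕ) (u : ℕ × ℕ) : Prop := u.1 < u.2 ∧ u.2 ≤ m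

/-- The concatenation of a list of intervals. -/
def concatWord (S : List (ℕ × ℕ)) : List ℕ := S.flatMap segWord

theorem SegGE.trans {u v w : ℕ × ℕ} (h : SegGE u v) (h' : SegGE v w) : SegGE u w := by
  unfold SegGE at *; omega

theorem concatWord_cons (u : ℕ × ℕ) (S : List (ℕ × ℕ)) :
    concatWord (u :: S) = segWord u ++ concatWord S := by simp [concatWord]

theorem concatWord_append (S T : List (ℕ × ℕ)) :
    concatWord (S ++ T) = concatWord S ++ concatWord T := by simp [concatWord]

theorem segWord_eq_cons {u : ℕ × ℕ} (h : u.1 < u.2) :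
    segWord u = u.1 :: segWord (u.1 + 1, u.2) := by
  obtain ⟨k, hk⟩ : ∃ k, u.2 - u.1 = k + 1 := ⟨u.2 - u.1 - 1, by omega⟩
  have : u.2 - (u.1 + 1) = k := by omega
  simp [segWord, hk, this, List.range'_succ]

theorem segWord_append {a b c : ℕ} (hab : a ≤ b) (hbc : b ≤ c) :
    segWord (a, c) = segWord (a, b) ++ segWord (b, c) := by
  have h1 : a + 1 * (b - a) = b := by omega
  have h2 : b - a + (c - b) = c - a := by omega
  have := List.range'_append (s := a) (m := b - a) (n := c - b) (step := 1)
  rw [h1, h2] at this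
  simp [segWord, ← this]

theorem mem_concatWord_lt {m : ℕ} {S : List (ℕ × ℕ)} (hS : ∀ u ∈ S, IsSeg m u) :
    ∀ i ∈ concatWord S, i < m := by
  intro i hi
  simp only [concatWord, List.mem_flatMap, segWord, List.mem_range'_1] at hi
  obtain ⟨u, hu, h1, h2⟩ := hi
  have := hS u hu
  unfold IsSeg at this
  omega

/-- A list that is not sorted has two adjacent entries in the wrong order. -/
theorem exists_descent {α : Type*} {R : α → α → Prop} (hR : ∀ a b c, R a b → R b c → R a c)
    (S : List α) (h : ¬ S.Pairwise R) : ∃ l₁ u v l₂, S = l₁ ++ u :: v :: l₂ ∧ ¬ R u v := by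
  induction S with
  | nil => simp at h
  | cons a S ih =>
    by_cases hS : S.Pairwise R
    · cases S with
      | nil => simp at h
      | cons b S =>
        refine ⟨[], a, b, S, rfl, fun hab => h ?_⟩
        rw [List.pairwise_cons] at hS
        refine List.pairwise_cons.mpr ⟨?_, List.pairwise_cons.mpr hS⟩
        rintro c hc
        rcases List.mem_cons.mp hc with rfl | hc
        · exact hab
        · exact hR _ _ _ hab (hS.1 c hc)
    · obtain ⟨l₁, u, v, l₂, rfl, hn⟩ := ih hS
      exact ⟨a :: l₁, u, v, l₂, rfl, hn⟩

theorem finite_bounded_words (m N : ℕ) :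
    {w : List ℕ | w.length = N ∧ ∀ i ∈ w, i < m}.Finite := by
  refine ((List.finite_length_eq (Fin m) N).image (List.map Fin.val)).subset ?_
  rintro w ⟨hw, hb⟩
  refine ⟨w.pmap (fun i hi => (⟨i, hi⟩ : Fin m)) hb, by simpa using hw, ?_⟩
  simp [List.map_pmap]

end Words

section Straightening

variable {K A : Type*} [Field K] [Ring A] [Algebra K A] {r s : K} {x : ℕ → A}

/-- The product of the root vectors of a list of intervals. -/
def rootProd (r : K) (x : ℕ → A) (S : List (ℕ × ℕ)) : A :=
  (S.map fun u => rootElt r x u.1 u.2).prod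

theorem rootProd_append (S T : List (ℕ × ℕ)) :
    rootProd r x (S ++ T) = rootProd r x S * rootProd r x T := by simp [rootProd]

theorem rootProd_cons (u : ℕ × ℕ) (T : List (ℕ × ℕ)) :
    rootProd r x (u :: T) = rootElt r x u.1 u.2 * rootProd r x T := by simp [rootProd]

/-- Two root vectors in increasing order are straightened: only products of root vectors occur
whose words are greater, or equal but with fewer factors. -/
theorem SerreSeq.straighten_pair (h : SerreSeq r s x) (hne : r + s ≠ 0) {m : ℕ} {u v : ℕ × ℕ}
    (hu : IsSeg m u) (hv : IsSeg m v) (huv : ¬ SegGE u v) :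
    rootElt r x u.1 u.2 * rootElt r x v.1 v.2 ∈
      Submodule.span K {p : A | ∃ T : List (ℕ × ℕ), (∀ w ∈ T, IsSeg m w) ∧
        (concatWord T).length = (concatWord [u, v]).length ∧
        (concatWord [u, v] < concatWord T ∨ (concatWord [u, v] = concatWord T ∧ T.length < 2)) ∧
        p = rootProd r x T} := by
  set M := Submodule.span K {p : A | ∃ T : List (ℕ × ℕ), (∀ w ∈ T, IsSeg m w) ∧
        (concatWord T).length = (concatWord [u, v]).length ∧
        (concatWord [u, v] < concatWord T ∨ (concatWord [u, v] = concatWord T ∧ T.length < 2)) ∧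
        p = rootProd r x T} with hM
  obtain ⟨a, b⟩ := u
  obtain ⟨c, d⟩ := v
  simp only [IsSeg, SegGE] at hu hv huv
  obtain ⟨hab, hbm⟩ := hu
  obtain ⟨hcd, hdm⟩ := hv
  have hlt : ∀ e f g k : ℕ, e < f → a < e → concatWord [(a, b), (c, d)] <
      concatWord [(e, f), (g, k)] := by
    intro e f g k hef hae
    rw [concatWord_cons (a, b), concatWord_cons (e, f), segWord_eq_cons hab,
      segWord_eq_cons (u := (e, f)) hef]
    exact List.cons_lt_cons_iff.mpr (Or.inl hae)
  have hswap : concatWord [(a, b), (c, d)] < concatWord [(c, d), (a, b)] →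
      rootElt r x c d * rootElt r x a b ∈ M := by
    intro h'
    refine Submodule.subset_span ⟨[(c, d), (a, b)], ?_, ?_, Or.inl h', ?_⟩
    · simp [IsSeg, *]
    · simp [concatWord, add_comm]
    · simp [rootProd]
  -- Disjoint, adjacent, overlapping and nested intervals; then intervals with the same start.
  rcases Nat.lt_or_ge a c with hac | hac
  · have hsw := hswap (hlt c d a b hcd hac)
    rcases lt_trichotomy b c with hbc | rfl | hcb
    · rw [show rootElt r x (a, b).1 (a, b).2 * rootElt r x (c, d).1 (c, d).2 = _ from
        h.comm_far hab hbc hcd]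
      exact hsw
    · have hs := h.split hab hcd
      have : rootElt r x a b * rootElt r x b d
          = rootElt r x a d + r • (rootElt r x b d * rootElt r x a b) := by
        rw [hs, qbr]; abel
      change rootElt r x a b * rootElt r x b d ∈ M
      rw [this]
      refine M.add_mem (Submodule.subset_span ⟨[(a, d)], ?_, ?_, Or.inr ⟨?_, by simp⟩, ?_⟩)
        (M.smul_mem _ hsw)
      · simp [IsSeg]; omega
      · simp [concatWord, segWord]; omega
      · simp [concatWord, segWord_append hab.le hcd.le]
      · simp [rootProd]
    · rcases lt_trichotomy b d with hbd | rfl | hdb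
      · change rootElt r x a b * rootElt r x c d ∈ M
        rw [(h.overlap hne hac hcb hbd).2]
        refine M.add_mem (M.smul_mem _ hsw) (M.smul_mem _ (Submodule.subset_span
          ⟨[(c, b), (a, d)], ?_, ?_, Or.inl (hlt c b a d hcb hac), ?_⟩))
        · simp [IsSeg]; omega
        · simp [concatWord, segWord]; omega
        · simp [rootProd]
      · change rootElt r x a b * rootElt r x c b ∈ M
        rw [h.same_right hne hac hcb]
        exact M.smul_mem _ hsw
      · change rootElt r x a b * rootElt r x c d ∈ M
        rw [← (h.overlap hne hac hcd hdb).1]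
        exact hsw
  · obtain rfl : a = c := by omega
    have hbd : b < d := by omega
    change rootElt r x a b * rootElt r x a d ∈ M
    rw [h.same_left hne hab hbd]
    refine M.smul_mem _ (hswap ?_)
    simp only [concatWord, List.flatMap_cons, List.flatMap_nil, List.append_nil]
    rw [segWord_append hab.le hbd.le, List.append_assoc, append_lt_append_left_iff,
      ← segWord_append hab.le hbd.le, segWord_eq_cons (u := (a, d)) hcd,
      segWord_eq_cons (u := (b, d)) hbd]
    exact List.cons_lt_cons_iff.mpr (Or.inl hab)

/-- Every product of root vectors is a combination of products in decreasing order, whose words are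
at least as great as the given one. -/
theorem SerreSeq.straighten (h : SerreSeq r s x) (hne : r + s ≠ 0) {m : ℕ} (S : List (ℕ × ℕ))
    (hS : ∀ u ∈ S, IsSeg m u) :
    rootProd r x S ∈ Submodule.span K {p : A | ∃ L : List (ℕ × ℕ), (∀ u ∈ L, IsSeg m u) ∧
      L.Pairwise SegGE ∧ (concatWord L).length = (concatWord S).length ∧
      concatWord S ≤ concatWord L ∧ p = rootProd r x L} := by
  set N := (concatWord S).length with hN
  -- There are finitely many words of a given length in the letters `< m`, so one can argue by
  -- induction along the reversed lexicographic order, and for equal words by the number of factors.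
  have hwf := (finite_bounded_words m N).wellFoundedOn (r := fun v w : List ℕ => w < v)
  have key : ∀ w ∈ {w : List ℕ | w.length = N ∧ ∀ i ∈ w, i < m}, ∀ k, ∀ S : List (ℕ × ℕ),
      (∀ u ∈ S, IsSeg m u) → concatWord S = w → S.length = k →
      rootProd r x S ∈ Submodule.span K {p : A | ∃ L : List (ℕ × ℕ), (∀ u ∈ L, IsSeg m u) ∧
        L.Pairwise SegGE ∧ (concatWord L).length = N ∧ w ≤ concatWord L ∧
          p = rootProd r x L} := by
    intro w hw
    refine hwf.induction hw (P := fun w => ∀ k, ∀ S : List (ℕ × ℕ),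
      (∀ u ∈ S, IsSeg m u) → concatWord S = w → S.length = k →
      rootProd r x S ∈ Submodule.span K {p : A | ∃ L : List (ℕ × ℕ), (∀ u ∈ L, IsSeg m u) ∧
        L.Pairwise SegGE ∧ (concatWord L).length = N ∧ w ≤ concatWord L ∧
          p = rootProd r x L}) ?_
    intro w hw ih k
    induction k using Nat.strong_induction_on with
    | _ k ihk =>
    intro S hS hSw hSk
    by_cases hs : S.Pairwise SegGE
    · exact Submodule.subset_span ⟨S, hS, hs, hSw ▸ hw.1, hSw.ge, rfl⟩
    obtain ⟨l₁, u, v, l₂, rfl, huv⟩ := exists_descent (R := SegGE) (fun _ _ _ => SegGE.trans) S hs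
    have hp := h.straighten_pair hne (hS u (by simp)) (hS v (by simp)) huv
    have e : rootProd r x (l₁ ++ u :: v :: l₂)
        = rootProd r x l₁ * (rootElt r x u.1 u.2 * rootElt r x v.1 v.2) * rootProd r x l₂ := by
      simp [rootProd, mul_assoc]
    have e2 : l₁ ++ u :: v :: l₂ = l₁ ++ [u, v] ++ l₂ := by simp
    rw [e]
    clear e
    generalize rootElt r x u.1 u.2 * rootElt r x v.1 v.2 = q at hp ⊢
    induction hp using Submodule.span_induction with
    | zero => simp
    | add a b _ _ ha hb => rw [mul_add, add_mul]; exact Submodule.add_mem _ ha hb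
    | smul c a _ ha =>
      rw [mul_smul_comm, smul_mul_assoc]; exact Submodule.smul_mem _ _ ha
    | mem p hp =>
      obtain ⟨T, hT, hTl, hTw, rfl⟩ := hp
      have hST : ∀ z ∈ l₁ ++ T ++ l₂, IsSeg m z := by
        intro z hz
        simp only [List.mem_append] at hz
        rcases hz with (hz | hz) | hz
        · exact hS z (by simp [hz])
        · exact hT z hz
        · exact hS z (by simp [hz])
      rw [← rootProd_append, ← rootProd_append]
      have hlen : (concatWord (l₁ ++ T ++ l₂)).length = N := by
        rw [← hw.1, ← hSw, e2]
        simp only [concatWord_append, List.length_append, hTl]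
      rcases hTw with hlt | ⟨heq, hlt⟩
      · have hlt' : w < concatWord (l₁ ++ T ++ l₂) := by
          rw [← hSw, e2]
          simp only [concatWord_append, List.append_assoc]
          rw [append_lt_append_left_iff]
          exact append_lt_append_of_length_eq _ _ hlt hTl.symm
        have := ih _ ⟨hlen, mem_concatWord_lt hST⟩ hlt' _ _ hST rfl rfl
        refine Submodule.span_mono ?_ this
        rintro p ⟨L, h1, h2, h3, h4, h5⟩
        exact ⟨L, h1, h2, h3, hlt'.le.trans h4, h5⟩
      · refine ihk _ ?_ _ hST ?_ rfl
        · rw [← hSk]; simp; omega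
        · rw [← hSw, e2]; simp only [concatWord_append, heq]
  exact key _ ⟨rfl, mem_concatWord_lt hS⟩ _ S hS rfl rfl

/-- The product of the letters of a word. -/
def wordProd (x : ℕ → A) (w : List ℕ) : A := (w.map x).prod

/-- The span of the words of the same length as `w` that are lexicographically greater. -/
def spanAbove (K : Type*) {A : Type*} [Field K] [Ring A] [Algebra K A] (x : ℕ → A) (w : List ℕ) :
    Submodule K A :=
  Submodule.span K {y | ∃ v : List ℕ, w < v ∧ v.length = w.length ∧ y = wordProd x v}

theorem wordProd_append (v w : List ℕ) :
    wordProd x (v ++ w) = wordProd x v * wordProd x w := by simp [wordProd]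

theorem mul_sub_wordProd_mem {p p' : A} {w w' : List ℕ} (h : p - wordProd x w ∈ spanAbove K x w)
    (h' : p' - wordProd x w' ∈ spanAbove K x w') :
    p * p' - wordProd x (w ++ w') ∈ spanAbove K x (w ++ w') := by
  have h1 : ∀ y ∈ spanAbove K x w, y * wordProd x w' ∈ spanAbove K x (w ++ w') := by
    intro y hy
    induction hy using Submodule.span_induction with
    | zero => simp
    | add a b _ _ ha hb => rw [add_mul]; exact Submodule.add_mem _ ha hb
    | smul c a _ ha => rw [smul_mul_assoc]; exact Submodule.smul_mem _ _ ha
    | mem y hy =>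
      obtain ⟨v, hv, hl, rfl⟩ := hy
      exact Submodule.subset_span ⟨v ++ w', append_lt_append_of_length_eq _ _ hv hl.symm,
        by simp [hl], (wordProd_append _ _).symm⟩
  have h2 : ∀ y ∈ spanAbove K x w', ∀ v : List ℕ, w ≤ v → v.length = w.length →
      wordProd x v * y ∈ spanAbove K x (w ++ w') := by
    intro y hy v hv hl
    induction hy using Submodule.span_induction with
    | zero => simp
    | add a b _ _ ha hb => rw [mul_add]; exact Submodule.add_mem _ ha hb
    | smul c a _ ha => rw [mul_smul_comm]; exact Submodule.smul_mem _ _ ha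
    | mem y hy =>
      obtain ⟨v', hv', hl', rfl⟩ := hy
      refine Submodule.subset_span ⟨v ++ v', ?_, by simp [hl, hl'], (wordProd_append _ _).symm⟩
      rcases hv.lt_or_eq with hv | rfl
      · exact append_lt_append_of_length_eq _ _ hv hl.symm
      · exact (append_lt_append_left_iff _).mpr hv'
  have h3 : ∀ y ∈ spanAbove K x w, y * (p' - wordProd x w') ∈ spanAbove K x (w ++ w') := by
    intro y hy
    induction hy using Submodule.span_induction with
    | zero => simp
    | add a b _ _ ha hb => rw [add_mul]; exact Submodule.add_mem _ ha hb
    | smul c a _ ha => rw [smul_mul_assoc]; exact Submodule.smul_mem _ _ ha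
    | mem y hy =>
      obtain ⟨v, hv, hl, rfl⟩ := hy
      exact h2 _ h' v hv.le hl
  have e : p * p' - wordProd x (w ++ w') = (p - wordProd x w) * wordProd x w'
      + wordProd x w * (p' - wordProd x w')
      + (p - wordProd x w) * (p' - wordProd x w') := by
    rw [wordProd_append]; noncomm_ring
  rw [e]
  exact Submodule.add_mem _ (Submodule.add_mem _ (h1 _ h) (h2 _ h' _ le_rfl rfl)) (h3 _ h)

/-- The leading term of a root vector is the word of its interval: all other words of the expanded
bracket begin with a greater letter. -/
theorem rootElt_sub_wordProd_mem (r : K) (x : ℕ → A) {a b : ℕ} (h : a < b) :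
    rootElt r x a b - wordProd x (segWord (a, b)) ∈ spanAbove K x (segWord (a, b)) := by
  induction b, h using Nat.le_induction with
  | base =>
    have : wordProd x (segWord (a, a.succ)) = x a := by simp [wordProd, segWord]
    rw [this, Nat.succ_eq_add_one, rootElt_self_succ, sub_self]
    exact Submodule.zero_mem _
  | succ b hb ih =>
    have hab : a < b := hb
    have hw : segWord (a, b + 1) = segWord (a, b) ++ [b] := by
      rw [segWord_append hab.le (Nat.le_succ b)]; simp [segWord]
    have hx : x b - wordProd x [b] ∈ spanAbove K x [b] := by simp [wordProd]
    have h1 := mul_sub_wordProd_mem ih hx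
    have h2 : ∀ y ∈ spanAbove K x (segWord (a, b)),
        x b * y ∈ spanAbove K x (segWord (a, b + 1)) := by
      intro y hy
      induction hy using Submodule.span_induction with
      | zero => simp
      | add a b _ _ ha hb => rw [mul_add]; exact Submodule.add_mem _ ha hb
      | smul c a _ ha => rw [mul_smul_comm]; exact Submodule.smul_mem _ _ ha
      | mem y hy =>
        obtain ⟨v, hv, hl, rfl⟩ := hy
        refine Submodule.subset_span ⟨b :: v, ?_, ?_, by simp [wordProd]⟩
        · rw [segWord_eq_cons (Nat.lt_succ_of_lt hab)]
          exact List.cons_lt_cons_iff.mpr (Or.inl hab)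
        · rw [hw]; simp [hl]
    have h3 : x b * wordProd x (segWord (a, b)) ∈ spanAbove K x (segWord (a, b + 1)) := by
      refine Submodule.subset_span ⟨b :: segWord (a, b), ?_, ?_, by simp [wordProd]⟩
      · rw [segWord_eq_cons (Nat.lt_succ_of_lt hab)]
        exact List.cons_lt_cons_iff.mpr (Or.inl hab)
      · rw [hw]; simp
    rw [rootElt_succ r x hab, qbr]
    rw [← hw] at h1
    have e : rootElt r x a b * x b - r • (x b * rootElt r x a b) - wordProd x (segWord (a, b + 1))
        = rootElt r x a b * x b - wordProd x (segWord (a, b + 1))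
          - r • (x b * (rootElt r x a b - wordProd x (segWord (a, b)))
            + x b * wordProd x (segWord (a, b))) := by
      rw [← mul_add, sub_add_cancel]; abel
    rw [e]
    exact Submodule.sub_mem _ h1 (Submodule.smul_mem _ _ (Submodule.add_mem _ (h2 _ ih) h3))

/-- A product of root vectors has its concatenated word as leading term. -/
theorem rootProd_sub_wordProd_mem (r : K) (x : ℕ → A) (S : List (ℕ × ℕ))
    (hS : ∀ u ∈ S, u.1 < u.2) :
    rootProd r x S - wordProd x (concatWord S) ∈ spanAbove K x (concatWord S) := by
  induction S with
  | nil => simp [rootProd, concatWord, wordProd]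
  | cons u S ih =>
    rw [rootProd_cons, concatWord_cons]
    exact mul_sub_wordProd_mem (rootElt_sub_wordProd_mem r x (hS u (by simp)))
      (ih fun v hv => hS v (by simp [hv]))

/-- Words are products of root vectors of intervals of length one. -/
theorem wordProd_eq_rootProd (r : K) (x : ℕ → A) (w : List ℕ) :
    wordProd x w = rootProd r x (w.map fun i => (i, i + 1)) ∧
      concatWord (w.map fun i => (i, i + 1)) = w := by
  induction w with
  | nil => simp [wordProd, rootProd, concatWord]
  | cons i w ih =>
    constructor
    · rw [List.map_cons, rootProd_cons, ← ih.1, rootElt_self_succ]; simp [wordProd]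
    · rw [List.map_cons, concatWord_cons, ih.2]; simp [segWord]

/-- Every word is a combination of decreasing products of root vectors whose words are at least
as great. -/
theorem SerreSeq.wordProd_mem_span (h : SerreSeq r s x) (hne : r + s ≠ 0) {m : ℕ} (w : List ℕ)
    (hw : ∀ i ∈ w, i < m) :
    wordProd x w ∈ Submodule.span K {p : A | ∃ L : List (ℕ × ℕ), (∀ u ∈ L, IsSeg m u) ∧
      L.Pairwise SegGE ∧ (concatWord L).length = w.length ∧
      w ≤ concatWord L ∧ p = rootProd r x L} := by
  obtain ⟨h1, h2⟩ := wordProd_eq_rootProd r x w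
  have := h.straighten hne (m := m) (w.map fun i => (i, i + 1)) (by
    intro u hu
    obtain ⟨i, hi, rfl⟩ := List.mem_map.mp hu
    exact ⟨Nat.lt_succ_self i, hw i hi⟩)
  rwa [← h1, h2] at this

/-- A word that is not a concatenation of intervals in decreasing order is a combination of greater
words of the same length. -/
theorem SerreSeq.wordProd_mem_spanAbove (h : SerreSeq r s x) (hne : r + s ≠ 0) {m : ℕ}
    (w : List ℕ) (hw : ∀ i ∈ w, i < m)
    (hL : ∀ L : List (ℕ × ℕ), (∀ u ∈ L, IsSeg m u) → L.Pairwise SegGE → concatWord L ≠ w) :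
    wordProd x w ∈ spanAbove K x w := by
  refine Submodule.span_le.mpr ?_ (h.wordProd_mem_span hne w hw)
  rintro p ⟨L, h1, h2, h3, h4, rfl⟩
  have hlt : w < concatWord L := lt_of_le_of_ne h4 (hL L h1 h2).symm
  have hle : spanAbove K x (concatWord L) ≤ spanAbove K x w := by
    refine Submodule.span_mono ?_
    rintro y ⟨v, hv, hl, rfl⟩
    exact ⟨v, hlt.trans hv, hl.trans h3, rfl⟩
  have := Submodule.add_mem _ (hle (rootProd_sub_wordProd_mem r x L fun u hu => (h1 u hu).1))
    (Submodule.subset_span ⟨concatWord L, hlt, h3, rfl⟩)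
  simpa using this

end Straightening

/-! ### Moving operators on configurations of sites -/

section Moves

/-- The interaction factor `(u z_p - v z_o) / (z_p - z_o)` of two sites with parameters `z_p`,
`z_o`. -/
def kap {L P : Type*} [Field L] (z : P → L) (u v : L) (p o : P) : L :=
  (u * z p - v * z o) / (z p - z o)

theorem kap_swap {L P : Type*} [Field L] (z : P → L) {u v : L} (p o : P) :
    kap z v u o p = kap z u v p o := by
  rw [kap, kap, ← neg_div_neg_eq]; congr 1 <;> ring

/-- The scalar identity behind the Serre relations: symmetrized over two sites, the interaction
factors add up to the middle coefficient. -/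
theorem kap_add_kap {L P : Type*} [Field L] {z : P → L} {u v : L} {p o : P}
    (hz : Function.Injective z) (h : p ≠ o) :
    kap z u v p o + kap z u v o p = u + v := by
  have h1 : z p - z o ≠ 0 := sub_ne_zero.mpr (hz.ne h)
  have h2 : z o - z p ≠ 0 := sub_ne_zero.mpr (hz.ne h.symm)
  rw [kap, kap, ← neg_div_neg_eq (u * z o - v * z p), neg_sub (z o), ← add_div, div_eq_iff h1]
  ring

variable {L P : Type*} [Field L] [Fintype P] [DecidableEq P]

/-- The product of the interaction factors of the site `p` with the other sites in state `a`. -/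
def coef (z : P → L) (u v : L) (a : ℕ) (m : P → ℕ) (p : P) : L :=
  ∏ o ∈ Finset.univ.erase p, if m o = a then kap z u v p o else 1

/-- The same product with a further site `o` left out. -/
def coefErase (z : P → L) (u v : L) (a : ℕ) (m : P → ℕ) (p o : P) : L :=
  ∏ o' ∈ (Finset.univ.erase p).erase o, if m o' = a then kap z u v p o' else 1

/-- The operator on functions of the configuration `m` that moves the site `p` from state `a` to
state `b`. Its coefficient is `coef z u v a`, so it only sees the sites in the source state. -/
def move (z : P → L) (u v : L) (a b : ℕ) (p : P) : Module.End L ((P → ℕ) → L) where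
  toFun f := fun m => if m p = a then coef z u v a m p * f (Function.update m p b) else 0
  map_add' f g := by ext m; by_cases h : m p = a <;> simp [h, mul_add]
  map_smul' c f := by ext m; by_cases h : m p = a <;> simp [h, mul_left_comm]

/-- The joint move of two different sites, from `a` to `b` and from `c` to `d`, with the mutual
interaction of the two sites removed. -/
def movePair (z : P → L) (u v : L) (a b : ℕ) (p : P) (u' v' : L) (c d : ℕ) (o : P) :
    Module.End L ((P → ℕ) → L) where
  toFun f := fun m => if m p = a ∧ m o = c then
    coefErase z u v a m p o * coefErase z u' v' c m o p
      * f (Function.update (Function.update m p b) o d) else 0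
  map_add' f g := by ext m; by_cases h : m p = a ∧ m o = c <;> simp [h, mul_add]
  map_smul' r f := by ext m; by_cases h : m p = a ∧ m o = c <;> simp [h, mul_left_comm]

variable (z : P → L) {u v u' v' : L} {a b c d : ℕ} {p o : P}

theorem move_apply (f : (P → ℕ) → L) (m : P → ℕ) :
    move z u v a b p f m = if m p = a then coef z u v a m p * f (Function.update m p b) else 0 :=
  rfl

theorem coef_eq (h : p ≠ o) (m : P → ℕ) :
    coef z u v a m p = (if m o = a then kap z u v p o else 1) * coefErase z u v a m p o := by
  exact (Finset.mul_prod_erase _ (fun o => if m o = a then kap z u v p o else 1)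
    (by simpa using h.symm)).symm

theorem coef_update_self (m : P → ℕ) (x : ℕ) :
    coef z u v a (Function.update m p x) p = coef z u v a m p := by
  refine Finset.prod_congr rfl fun o ho => ?_
  rw [Function.update_of_ne (Finset.ne_of_mem_erase ho)]

theorem coefErase_update_left (m : P → ℕ) (x : ℕ) :
    coefErase z u v a (Function.update m p x) p o = coefErase z u v a m p o := by
  refine Finset.prod_congr rfl fun o' ho => ?_
  rw [Function.update_of_ne (Finset.ne_of_mem_erase (Finset.mem_of_mem_erase ho))]

theorem coefErase_update_right (m : P → ℕ) (x : ℕ) :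
    coefErase z u v a (Function.update m o x) p o = coefErase z u v a m p o := by
  refine Finset.prod_congr rfl fun o' ho => ?_
  rw [Function.update_of_ne (Finset.ne_of_mem_erase ho)]

theorem movePair_comm (h : p ≠ o) :
    movePair z u v a b p u' v' c d o = movePair z u' v' c d o u v a b p := by
  ext f m
  simp only [movePair, LinearMap.coe_mk, AddHom.coe_mk]
  by_cases hp : m p = a <;> by_cases ho : m o = c <;>
    simp [hp, ho, Function.update_comm h, mul_comm (coefErase z u v a m p o)]

/-- Both orders of moving two different sites are multiples of one joint move. The factor is the
interaction of the two sites, as seen by whichever of them moves while the other one is in its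
source state. -/
theorem move_mul_move (h : p ≠ o) :
    move z u v a b p * move z u' v' c d o =
      ((if c = a then kap z u v p o else 1) * (if b = c then kap z u' v' o p else 1)) •
        movePair z u v a b p u' v' c d o := by
  ext f m
  simp only [movePair, Module.End.mul_apply, move_apply, LinearMap.smul_apply, LinearMap.coe_mk,
    AddHom.coe_mk, Pi.smul_apply, smul_eq_mul, Function.update_of_ne h.symm]
  by_cases hp : m p = a
  · by_cases ho : m o = c
    · rw [coef_eq z h, coef_eq z h.symm]
      simp only [hp, ho, Function.update_self, coefErase_update_right, and_self, if_true]
      ring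
    · simp [hp, ho]
  · simp [hp]

theorem move_mul_move_self (h : b ≠ c) : move z u v a b p * move z u' v' c d p = 0 := by
  ext f m
  simp [Module.End.mul_apply, move_apply, h]

theorem move_mul_move_swap_self :
    move z u v a b p * move z u' v' b a p =
      LinearMap.pi fun m => (if m p = a then coef z u v a m p * coef z u' v' b m p else 0) •
        LinearMap.proj m := by
  ext f m
  by_cases hp : m p = a
  · have : Function.update m p (m p) = m := Function.update_eq_self p m
    subst hp
    simp [Module.End.mul_apply, move_apply, coef_update_self, mul_assoc]
  · simp [Module.End.mul_apply, move_apply, hp]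

/-- Moves with disjoint states commute. -/
theorem move_comm_of_disjoint (hac : a ≠ c) (hbc : b ≠ c) (had : a ≠ d) (p o : P) :
    move z u v a b p * move z u' v' c d o = move z u' v' c d o * move z u v a b p := by
  by_cases h : p = o
  · subst h
    rw [move_mul_move_self z hbc, move_mul_move_self z had.symm]
  · rw [move_mul_move z h, move_mul_move z (Ne.symm h), movePair_comm z h]
    simp [hac, hbc, had.symm, hac.symm]

/-- Opposite moves of different sites commute. -/
theorem move_comm_opposite (hab : a ≠ b) (h : p ≠ o) :
    move z u v a b p * move z v u b a o = move z v u b a o * move z u v a b p := by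
  rw [move_mul_move z h, move_mul_move z h.symm, movePair_comm z h, kap_swap]
  simp [hab, hab.symm]

/-- Moves out of the same state with exchanged parameters commute. -/
theorem move_comm_of_same_source (hab : a ≠ b) (hac : a ≠ c) (p o : P) :
    move z u v a b p * move z v u a c o = move z v u a c o * move z u v a b p := by
  by_cases h : p = o
  · subst h
    rw [move_mul_move_self z hab.symm, move_mul_move_self z hac.symm]
  · rw [move_mul_move z h, move_mul_move z (Ne.symm h), movePair_comm z h, kap_swap]
    simp [hab.symm, hac.symm]

theorem move_mul_next (hab : a ≠ b) (hac : a ≠ c) (h : p ≠ o) :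
    move z u v a b p * move z u v b c o =
      kap z u v o p • (move z u v b c o * move z u v a b p) := by
  rw [move_mul_move z h, move_mul_move z h.symm, movePair_comm z h]
  simp [hab, hab.symm, hac.symm]

theorem movePair_mul_next (hab : a ≠ b) (hac : a ≠ c) (h : p ≠ o) :
    movePair z u v a b p u v a b o * move z u v b c p =
      move z u v a b p * move z u v b c p * move z u v a b o := by
  ext f m
  simp only [movePair, Module.End.mul_apply, move_apply, LinearMap.coe_mk, AddHom.coe_mk,
    Function.update_of_ne h, Function.update_of_ne h.symm, Function.update_self, if_true]
  by_cases hp : m p = a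
  · by_cases ho : m o = a
    · rw [coef_eq z h, coef_eq z h, coef_eq z h, coef_eq z h.symm]
      simp only [hp, ho, Function.update_self, coefErase_update_right, coefErase_update_left,
        Function.update_of_ne h.symm, and_self, if_true, if_neg hab, if_neg hac.symm,
        Function.update_comm h.symm, Function.update_idem]
      ring
    · simp [hp, ho]
  · simp [hp]

theorem move_mul_movePair (hab : a ≠ b) (hac : a ≠ c) (hbc : b ≠ c) (h : p ≠ o) :
    move z u v a b p * movePair z u v b c p u v b c o =
      move z u v b c o * move z u v a b p * move z u v b c p := by
  ext f m
  simp only [movePair, Module.End.mul_apply, move_apply, LinearMap.coe_mk, AddHom.coe_mk,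
    Function.update_of_ne h, Function.update_of_ne h.symm, Function.update_self, if_true, true_and]
  by_cases hp : m p = a
  · by_cases ho : m o = b
    · rw [coef_eq z h, coef_eq z h.symm, coef_eq z h, coef_eq z h]
      simp only [Function.update_of_ne h.symm, Function.update_self, coefErase_update_right,
        coefErase_update_left, ho, hp, if_true, if_neg hab, if_neg hab.symm, if_neg hbc.symm,
        if_neg hac.symm, Function.update_comm h.symm, Function.update_idem]
      ring
    · simp [hp, ho]
  · by_cases ho : m o = b <;> simp [hp, ho]

variable {z} (hz : Function.Injective z)
include hz

/-- The Serre relation for moves `a → b`, `a → b`, `b → c`. -/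
theorem serre_move_left (hab : a ≠ b) (hac : a ≠ c) (p₁ p₂ o : P) :
    (move z u v a b p₁ * move z u v a b p₂ * move z u v b c o
      - (u + v) • (move z u v a b p₁ * move z u v b c o * move z u v a b p₂)
      + (u * v) • (move z u v b c o * move z u v a b p₁ * move z u v a b p₂))
    + (move z u v a b p₂ * move z u v a b p₁ * move z u v b c o
      - (u + v) • (move z u v a b p₂ * move z u v b c o * move z u v a b p₁)
      + (u * v) • (move z u v b c o * move z u v a b p₂ * move z u v a b p₁)) = 0 := by
  -- Sites `p = o` and `q ≠ p`.
  have main : ∀ p q : P, p ≠ q →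
      (move z u v a b p * move z u v a b q * move z u v b c p
        - (u + v) • (move z u v a b p * move z u v b c p * move z u v a b q)
        + (u * v) • (move z u v b c p * move z u v a b p * move z u v a b q))
      + (move z u v a b q * move z u v a b p * move z u v b c p
        - (u + v) • (move z u v a b q * move z u v b c p * move z u v a b p)
        + (u * v) • (move z u v b c p * move z u v a b q * move z u v a b p)) = 0 := by
    intro p q h
    have e1 : move z u v a b p * move z u v a b q
        = kap z u v p q • movePair z u v a b p u v a b q := by
      rw [move_mul_move z h]; simp [hab.symm]
    have e2 : move z u v a b q * move z u v a b p
        = kap z u v q p • movePair z u v a b p u v a b q := by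
      rw [move_mul_move z h.symm, movePair_comm z h]; simp [hab.symm]
    have e3 : move z u v b c p * move z u v a b p = 0 := move_mul_move_self z hac.symm
    have e4 : move z u v a b q * move z u v b c p * move z u v a b p = 0 := by
      rw [mul_assoc, e3, mul_zero]
    have e5 : move z u v b c p * move z u v a b q * move z u v a b p = 0 := by
      rw [mul_assoc, e2, ← smul_zero (kap z u v q p / kap z u v p q), mul_smul_comm]
      have : move z u v b c p * movePair z u v a b p u v a b q = 0 := by
        ext f m
        by_cases hp : m p = b <;> simp [movePair, Module.End.mul_apply, move_apply, hp, hac.symm]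
      rw [this]; simp
    rw [e4, e5, e3, zero_mul, e1, e2, smul_mul_assoc, smul_mul_assoc,
      movePair_mul_next z hab hac h]
    have := kap_add_kap (u := u) (v := v) hz h
    rw [← this]
    module
  by_cases h12 : p₁ = p₂
  · subst h12
    have e1 : move z u v a b p₁ * move z u v a b p₁ = 0 := move_mul_move_self z hab.symm
    have e2 : move z u v a b p₁ * move z u v b c o * move z u v a b p₁ = 0 := by
      by_cases h : p₁ = o
      · subst h
        rw [mul_assoc, move_mul_move_self z hac.symm, mul_zero]
      · rw [move_mul_next z hab hac h, smul_mul_assoc, mul_assoc, e1, mul_zero, smul_zero]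
    rw [e1, e2, mul_assoc, e1]
    simp
  by_cases h1 : p₁ = o
  · subst h1; exact main _ _ h12
  by_cases h2 : p₂ = o
  · subst h2; rw [add_comm]; exact main _ _ (Ne.symm h12)
  have e1 : move z u v a b p₁ * move z u v a b p₂
      = kap z u v p₁ p₂ • movePair z u v a b p₁ u v a b p₂ := by
    rw [move_mul_move z h12]; simp [hab.symm]
  have e2 : move z u v a b p₂ * move z u v a b p₁
      = kap z u v p₂ p₁ • movePair z u v a b p₁ u v a b p₂ := by
    rw [move_mul_move z (Ne.symm h12), movePair_comm z h12]; simp [hab.symm]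
  have f1 := move_mul_next z (u := u) (v := v) hab hac h1
  have f2 := move_mul_next z (u := u) (v := v) hab hac h2
  have g1 : move z u v a b p₁ * move z u v a b p₂ * move z u v b c o
      = (kap z u v o p₁ * kap z u v o p₂ * kap z u v p₁ p₂) •
        (move z u v b c o * movePair z u v a b p₁ u v a b p₂) := by
    rw [mul_assoc, f2, mul_smul_comm, ← mul_assoc, f1, smul_mul_assoc, mul_assoc, e1, mul_smul_comm]
    module
  have g2 : move z u v a b p₂ * move z u v a b p₁ * move z u v b c o
      = (kap z u v o p₁ * kap z u v o p₂ * kap z u v p₂ p₁) •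
        (move z u v b c o * movePair z u v a b p₁ u v a b p₂) := by
    rw [mul_assoc, f1, mul_smul_comm, ← mul_assoc, f2, smul_mul_assoc, mul_assoc, e2, mul_smul_comm]
    module
  rw [g1, g2, f1, f2]
  simp only [smul_mul_assoc, mul_assoc, e1, e2, mul_smul_comm]
  have key : (kap z u v o p₁ * kap z u v o p₂ - (u + v) * kap z u v o p₁ + u * v)
        * kap z u v p₁ p₂
      + (kap z u v o p₁ * kap z u v o p₂ - (u + v) * kap z u v o p₂ + u * v)
        * kap z u v p₂ p₁ = 0 := by
    have n1 : z o - z p₁ ≠ 0 := sub_ne_zero.mpr (hz.ne (Ne.symm h1))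
    have n2 : z o - z p₂ ≠ 0 := sub_ne_zero.mpr (hz.ne (Ne.symm h2))
    have n3 : z p₁ - z p₂ ≠ 0 := sub_ne_zero.mpr (hz.ne h12)
    have n4 : z p₂ - z p₁ ≠ 0 := sub_ne_zero.mpr (hz.ne (Ne.symm h12))
    rw [← kap_swap z p₁ p₂]
    simp only [kap]
    field_simp
    ring
  have : ∀ W : Module.End L ((P → ℕ) → L), (0 : L) • W = 0 := fun W => zero_smul _ _
  rw [← this (move z u v b c o * movePair z u v a b p₁ u v a b p₂), ← key]
  module

/-- The Serre relation for moves `b → c`, `b → c`, `a → b`. -/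
theorem serre_move_right (hab : a ≠ b) (hac : a ≠ c) (hbc : b ≠ c) (p₁ p₂ o : P) :
    (move z u v a b o * move z u v b c p₁ * move z u v b c p₂
      - (u + v) • (move z u v b c p₁ * move z u v a b o * move z u v b c p₂)
      + (u * v) • (move z u v b c p₁ * move z u v b c p₂ * move z u v a b o))
    + (move z u v a b o * move z u v b c p₂ * move z u v b c p₁
      - (u + v) • (move z u v b c p₂ * move z u v a b o * move z u v b c p₁)
      + (u * v) • (move z u v b c p₂ * move z u v b c p₁ * move z u v a b o)) = 0 := by
  have main : ∀ p q : P, p ≠ q →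
      (move z u v a b p * move z u v b c p * move z u v b c q
        - (u + v) • (move z u v b c p * move z u v a b p * move z u v b c q)
        + (u * v) • (move z u v b c p * move z u v b c q * move z u v a b p))
      + (move z u v a b p * move z u v b c q * move z u v b c p
        - (u + v) • (move z u v b c q * move z u v a b p * move z u v b c p)
        + (u * v) • (move z u v b c q * move z u v b c p * move z u v a b p)) = 0 := by
    intro p q h
    have e1 : move z u v b c p * move z u v b c q
        = kap z u v p q • movePair z u v b c p u v b c q := by
      rw [move_mul_move z h]; simp [hbc.symm]
    have e2 : move z u v b c q * move z u v b c p
        = kap z u v q p • movePair z u v b c p u v b c q := by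
      rw [move_mul_move z h.symm, movePair_comm z h]; simp [hbc.symm]
    have e3 : move z u v b c p * move z u v a b p = 0 := move_mul_move_self z hac.symm
    have e5 : move z u v b c p * move z u v b c q * move z u v a b p = 0 := by
      have : movePair z u v b c p u v b c q * move z u v a b p = 0 := by
        ext f m
        simp [movePair, Module.End.mul_apply, move_apply, h, hac.symm]
      rw [e1, smul_mul_assoc, this, smul_zero]
    have e6 : move z u v b c q * move z u v b c p * move z u v a b p = 0 := by
      rw [mul_assoc, e3, mul_zero]
    rw [e5, e6, e3, zero_mul, mul_assoc, mul_assoc, e1, e2, mul_smul_comm, mul_smul_comm,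
      move_mul_movePair z hab hac hbc h]
    have := kap_add_kap (u := u) (v := v) hz h
    rw [← this]
    module
  by_cases h12 : p₁ = p₂
  · subst h12
    have e1 : move z u v b c p₁ * move z u v b c p₁ = 0 := move_mul_move_self z hbc.symm
    have e2 : move z u v b c p₁ * move z u v a b o * move z u v b c p₁ = 0 := by
      by_cases h : p₁ = o
      · subst h
        rw [move_mul_move_self z hac.symm, zero_mul]
      · rw [mul_assoc, move_mul_next z hab hac (Ne.symm h), mul_smul_comm, ← mul_assoc, e1,
          zero_mul, smul_zero]
    rw [mul_assoc, e1, e2]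
    simp
  by_cases h1 : p₁ = o
  · subst h1; exact main _ _ h12
  by_cases h2 : p₂ = o
  · subst h2; rw [add_comm]; exact main _ _ (Ne.symm h12)
  have e1 : move z u v b c p₁ * move z u v b c p₂
      = kap z u v p₁ p₂ • movePair z u v b c p₁ u v b c p₂ := by
    rw [move_mul_move z h12]; simp [hbc.symm]
  have e2 : move z u v b c p₂ * move z u v b c p₁
      = kap z u v p₂ p₁ • movePair z u v b c p₁ u v b c p₂ := by
    rw [move_mul_move z (Ne.symm h12), movePair_comm z h12]; simp [hbc.symm]
  have f1 := move_mul_next z (u := u) (v := v) hab hac (Ne.symm h1)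
  have f2 := move_mul_next z (u := u) (v := v) hab hac (Ne.symm h2)
  have g1 : move z u v b c p₁ * move z u v a b o * move z u v b c p₂
      = (kap z u v p₂ o * kap z u v p₁ p₂) •
        (movePair z u v b c p₁ u v b c p₂ * move z u v a b o) := by
    rw [mul_assoc, f2, mul_smul_comm, ← mul_assoc, e1, smul_mul_assoc, smul_smul]
  have g2 : move z u v b c p₂ * move z u v a b o * move z u v b c p₁
      = (kap z u v p₁ o * kap z u v p₂ p₁) •
        (movePair z u v b c p₁ u v b c p₂ * move z u v a b o) := by
    rw [mul_assoc, f1, mul_smul_comm, ← mul_assoc, e2, smul_mul_assoc, smul_smul]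
  have k1 : move z u v a b o * move z u v b c p₁ * move z u v b c p₂
      = (kap z u v p₁ o * kap z u v p₂ o * kap z u v p₁ p₂) •
        (movePair z u v b c p₁ u v b c p₂ * move z u v a b o) := by
    rw [f1, smul_mul_assoc, g1]; module
  have k2 : move z u v a b o * move z u v b c p₂ * move z u v b c p₁
      = (kap z u v p₁ o * kap z u v p₂ o * kap z u v p₂ p₁) •
        (movePair z u v b c p₁ u v b c p₂ * move z u v a b o) := by
    rw [f2, smul_mul_assoc, g2]; module
  rw [k1, k2, g1, g2, e1, e2]
  simp only [smul_mul_assoc]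
  have key : (kap z u v p₁ o * kap z u v p₂ o - (u + v) * kap z u v p₂ o + u * v)
        * kap z u v p₁ p₂
      + (kap z u v p₁ o * kap z u v p₂ o - (u + v) * kap z u v p₁ o + u * v)
        * kap z u v p₂ p₁ = 0 := by
    have n1 : z p₁ - z o ≠ 0 := sub_ne_zero.mpr (hz.ne h1)
    have n2 : z p₂ - z o ≠ 0 := sub_ne_zero.mpr (hz.ne h2)
    have n3 : z p₁ - z p₂ ≠ 0 := sub_ne_zero.mpr (hz.ne h12)
    rw [← kap_swap z p₁ p₂]
    simp only [kap]
    field_simp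
    ring
  have : ∀ W : Module.End L ((P → ℕ) → L), (0 : L) • W = 0 := fun W => zero_smul _ _
  rw [← this (movePair z u v b c p₁ u v b c p₂ * move z u v a b o), ← key]
  module

end Moves

/-! ### Formal exponentials and partial fractions -/

section Exponential

theorem sum_composition_succ {M : Type*} [AddCommMonoid M] (n : ℕ) (G : List ℕ → M) :
    ∑ p : Composition (n + 1), G p.blocks =
      ∑ ij ∈ Finset.HasAntidiagonal.antidiagonal n,
        ∑ p : Composition ij.2, G ((ij.1 + 1) :: p.blocks) := by
  rw [Finset.sum_sigma']
  symm
  refine Finset.sum_bij (fun a ha => (⟨(a.1.1 + 1) :: a.2.blocks, ?_, ?_⟩ : Composition (n + 1)))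
    ?_ ?_ ?_ ?_
  · intro i hi
    rcases List.mem_cons.mp hi with rfl | hi
    · omega
    · exact a.2.blocks_pos hi
  · have h1 : a.1.1 + a.1.2 = n := by simpa using ha
    have h2 := a.2.blocks_sum
    simp only [List.sum_cons]; omega
  · simp
  · rintro ⟨⟨i, j⟩, p⟩ ha ⟨⟨i', j'⟩, p'⟩ ha' h
    have h0 : (i + 1) :: p.blocks = (i' + 1) :: p'.blocks := congrArg Composition.blocks h
    rw [List.cons.injEq] at h0
    obtain ⟨h1, h2⟩ := h0
    obtain rfl : i = i' := by omega
    simp only [Finset.mem_sigma, Finset.HasAntidiagonal.mem_antidiagonal, Finset.mem_univ,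
      and_true] at ha ha'
    obtain rfl : j = j' := by omega
    rw [Composition.ext h2]
  · intro p _
    cases hp : p.blocks with
    | nil => have := p.blocks_sum; rw [hp] at this; simp at this
    | cons l t =>
      have hl : 0 < l := p.blocks_pos (by rw [hp]; simp)
      have hs := p.blocks_sum
      rw [hp, List.sum_cons] at hs
      refine ⟨⟨(l - 1, t.sum), ⟨t, fun hi => p.blocks_pos (by rw [hp]; simp [hi]), rfl⟩⟩, ?_, ?_⟩
      · simp; omega
      · apply Composition.ext
        simp only [hp]
        congr 1
        omega
  · intro a ha; rfl

variable {F : Type*} [Field F]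

theorem coeff_pow_eq_sum_composition (b : ℕ → F) (k n : ℕ) :
    PowerSeries.coeff n ((PowerSeries.mk fun l => if l = 0 then 0 else b l) ^ k) =
      ∑ p : Composition n, if p.length = k then (p.blocks.map b).prod else 0 := by
  induction k generalizing n with
  | zero =>
    cases n with
    | zero =>
      have : ∀ p : Composition 0, p.blocks = [] := fun p => by
        have := p.length_le
        exact List.length_eq_zero_iff.mp (by simp)
      rw [Fintype.sum_eq_single (Composition.ones 0) (fun p hp => absurd
        (Composition.ext ((this p).trans (this _).symm)) hp)]
      simp [Composition.length, this]
    | succ n =>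
      rw [Finset.sum_eq_zero]
      · simp
      · intro p _
        rw [if_neg]
        have := p.length_pos_of_pos (Nat.succ_pos n)
        omega
  | succ k ih =>
    cases n with
    | zero =>
      rw [Finset.sum_eq_zero]
      · simp [pow_succ]
      · intro p _
        rw [if_neg]
        have := p.length_le
        omega
    | succ n =>
      have := sum_composition_succ n
        (fun l : List ℕ => if l.length = k + 1 then (l.map b).prod else 0)
      simp only [Composition.length] at *
      rw [this, pow_succ', PowerSeries.coeff_mul, Finset.Nat.sum_antidiagonal_succ]
      simp only [PowerSeries.coeff_mk, if_true, zero_mul, zero_add, Nat.succ_ne_zero, if_false]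
      refine Finset.sum_congr rfl fun ij _ => ?_
      rw [ih, Finset.mul_sum]
      refine Finset.sum_congr rfl fun p _ => ?_
      simp

variable [CharZero F]

/-- The coefficients of a formal exponential satisfy the recursion `E' = c B' E`. -/
theorem expCoeff_succ (c : F) (b : ℕ → F) (n : ℕ) :
    ((n : F) + 1) * expCoeff F c b (n + 1) =
      ∑ ij ∈ Finset.HasAntidiagonal.antidiagonal n,
        (c * (((ij.1 : F) + 1) * b (ij.1 + 1))) * expCoeff F c b ij.2 := by
  set B : PowerSeries F := PowerSeries.mk fun l => if l = 0 then 0 else b l with hB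
  set E : ℕ → PowerSeries F := fun N =>
    ∑ k ∈ Finset.range (N + 1), (c ^ k / (k.factorial : F)) • B ^ k with hE
  have hcoeff : ∀ n N, n ≤ N → PowerSeries.coeff n (E N) = expCoeff F c b n := by
    intro n N hn
    simp only [hE, map_sum, PowerSeries.coeff_smul, hB, coeff_pow_eq_sum_composition,
      smul_eq_mul, Finset.mul_sum, expCoeff]
    rw [Finset.sum_comm]
    refine Finset.sum_congr rfl fun p _ => ?_
    rw [Finset.sum_eq_single p.length]
    · simp
    · intro k _ hk
      simp [hk.symm]
    · intro h
      have := p.length_le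
      simp at h
      omega
  have hder : ∀ N, PowerSeries.derivative F (E (N + 1)) =
      c • (PowerSeries.derivative F B * E N) := by
    intro N
    simp only [hE]
    rw [Finset.sum_range_succ']
    simp only [map_add, map_sum, Derivation.map_smul, pow_zero, Derivation.map_one_eq_zero,
      smul_zero, add_zero, Finset.mul_sum, Finset.smul_sum]
    refine Finset.sum_congr rfl fun k _ => ?_
    rw [Derivation.leibniz_pow, Nat.add_sub_cancel, mul_smul_comm, smul_smul]
    rw [← Nat.cast_smul_eq_nsmul F, smul_smul, smul_eq_mul, mul_comm (B ^ k)]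
    congr 1
    rw [Nat.factorial_succ]
    push_cast
    have h1 : ((k : F) + 1) ≠ 0 := by exact_mod_cast Nat.succ_ne_zero k
    have h2 : (k.factorial : F) ≠ 0 := by exact_mod_cast k.factorial_ne_zero
    field_simp
    ring
  have h := congrArg (PowerSeries.coeff n) (hder n)
  rw [PowerSeries.coeff_derivative, hcoeff _ _ le_rfl, PowerSeries.coeff_smul,
    smul_eq_mul,
    PowerSeries.coeff_mul, Finset.mul_sum] at h
  rw [mul_comm, h]
  refine Finset.sum_congr rfl fun ij hij => ?_
  have hle : ij.2 ≤ n := by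
    have := Finset.HasAntidiagonal.mem_antidiagonal.mp hij; omega
  rw [hcoeff _ _ hle, PowerSeries.coeff_derivative, hB,
    PowerSeries.coeff_mk, if_neg (Nat.succ_ne_zero _)]
  ring

theorem expCoeff_zero (c : F) (b : ℕ → F) : expCoeff F c b 0 = 1 := by
  have h0 : ∀ p : Composition 0, p.blocks = [] := fun p => by
    have := p.length_le
    exact List.length_eq_zero_iff.mp (by simp)
  rw [expCoeff, Fintype.sum_eq_single (Composition.ones 0) (fun p hp => absurd
    (Composition.ext ((h0 p).trans (h0 _).symm)) hp)]
  simp [Composition.length, h0]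

/-- A power series with constant term `1` is the formal exponential of `c * ∑ b l X ^ l` as soon as
its logarithmic derivative is `∑ c l b l X ^ (l - 1)`. -/
theorem expCoeff_eq_coeff (c : F) (b : ℕ → F) (T : PowerSeries F)
    (h0 : PowerSeries.coeff 0 T = 1)
    (hT : PowerSeries.derivative F T
      = (PowerSeries.mk fun i => c * (((i : F) + 1) * b (i + 1))) * T) (n : ℕ) :
    expCoeff F c b n = PowerSeries.coeff n T := by
  induction n using Nat.strong_induction_on with
  | _ n ih =>
    cases n with
    | zero => rw [h0, expCoeff_zero]
    | succ n =>
      have h1 : ((n : F) + 1) ≠ 0 := by exact_mod_cast Nat.succ_ne_zero n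
      have h := congrArg (PowerSeries.coeff n) hT
      rw [PowerSeries.coeff_derivative, PowerSeries.coeff_mul] at h
      refine mul_left_cancel₀ h1 ?_
      rw [expCoeff_succ, mul_comm _ (PowerSeries.coeff (n + 1) T), h]
      refine Finset.sum_congr rfl fun ij hij => ?_
      have hle : ij.2 < n + 1 := by
        have := Finset.HasAntidiagonal.mem_antidiagonal.mp hij; omega
      rw [PowerSeries.coeff_mk, ih _ hle]

omit [CharZero F] in
/-- The geometric series `1 / (1 - w X)`. -/
def geom (w : F) : PowerSeries F := PowerSeries.mk fun k => w ^ k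

omit [CharZero F] in
theorem one_sub_mul_geom (w : F) :
    (1 - PowerSeries.C w * PowerSeries.X) * geom w = 1 := by
  ext n
  cases n with
  | zero => simp [sub_mul, mul_assoc, geom]
  | succ n =>
    simp [sub_mul, mul_assoc, geom, PowerSeries.coeff_succ_X_mul, PowerSeries.coeff_one, pow_succ']

omit [CharZero F] in
theorem derivative_geom (w : F) :
    PowerSeries.derivative F (geom w) = PowerSeries.C w * geom w * geom w := by
  have h := one_sub_mul_geom w
  have h' := congrArg (PowerSeries.derivative F) h
  simp only [Derivation.leibniz, map_sub, Derivation.map_one_eq_zero, PowerSeries.derivative_C,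
    PowerSeries.derivative_X, smul_eq_mul, mul_zero, mul_one, zero_sub] at h'
  linear_combination geom w * h' - PowerSeries.derivative F (geom w) * h

omit [CharZero F] in
theorem derivative_linear_mul_geom (g w : F) :
    PowerSeries.derivative F ((1 - PowerSeries.C (g * w) * PowerSeries.X) * geom w) =
      (PowerSeries.mk fun i => (1 - g ^ (i + 1)) * w ^ (i + 1)) *
        ((1 - PowerSeries.C (g * w) * PowerSeries.X) * geom w) := by
  have e : (PowerSeries.mk fun i => (1 - g ^ (i + 1)) * w ^ (i + 1))
      = PowerSeries.C w * geom w - PowerSeries.C (g * w) * geom (g * w) := by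
    ext n
    simp only [map_sub, PowerSeries.coeff_C_mul, geom, PowerSeries.coeff_mk]
    ring
  have h := one_sub_mul_geom (g * w)
  rw [e]
  simp only [Derivation.leibniz, map_sub, Derivation.map_one_eq_zero, PowerSeries.derivative_C,
    PowerSeries.derivative_X, smul_eq_mul, mul_zero, mul_one, zero_sub, derivative_geom]
  linear_combination (PowerSeries.C (g * w) * geom w) * h

/-- The exponential of a sum of logarithms of linear fractions. -/
theorem expCoeff_eq_coeff_prod {ι : Type*} (Q : Finset ι) (c : F) (b : ℕ → F) (g w : ι → F)
    (hb : ∀ l : ℕ, 0 < l → c * ((l : F) * b l) = ∑ p ∈ Q, (1 - g p ^ l) * w p ^ l) (n : ℕ) :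
    expCoeff F c b n = PowerSeries.coeff n
      (∏ p ∈ Q, (1 - PowerSeries.C (g p * w p) * PowerSeries.X) * geom (w p)) := by
  classical
  apply expCoeff_eq_coeff
  · simp [geom]
  · have e : (PowerSeries.mk fun i => c * (((i : F) + 1) * b (i + 1)))
        = ∑ p ∈ Q, PowerSeries.mk fun i => (1 - g p ^ (i + 1)) * w p ^ (i + 1) := by
      ext n
      have := hb (n + 1) (Nat.succ_pos n)
      push_cast at this
      simp [this]
    rw [e]
    clear e hb
    induction Q using Finset.induction_on with
    | empty => simp
    | insert p Q hp ih =>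
      rw [Finset.prod_insert hp, Derivation.leibniz, ih, derivative_linear_mul_geom,
        Finset.sum_insert hp, smul_eq_mul, smul_eq_mul]
      ring

end Exponential

section PartialFractions

open Polynomial

variable {F ι : Type*} [Field F] [DecidableEq ι] (Q : Finset ι) (α β w : ι → F)

/-- The product `∏ (α_o w_p - β_o w_o) / (w_p - w_o)` over the indices `o ≠ p`. -/
def resid (p : ι) : F := ∏ o ∈ Q.erase p, (α o * w p - β o * w o) / (w p - w o)

variable (hw0 : ∀ p ∈ Q, w p ≠ 0) (hw : Set.InjOn w Q)
include hw0 hw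

/-- The partial fraction expansion of `∏ (α_p - β_p w_p X) / (1 - w_p X)`, cleared of
denominators. The two sides are compared at zero and at the poles. -/
theorem partialFractions_poly :
    ∏ p ∈ Q, (C (α p) - C (β p * w p) * X) =
      C (∏ p ∈ Q, α p) * ∏ p ∈ Q, (1 - C (w p) * X) +
        ∑ p ∈ Q, C ((α p - β p) * resid Q α β w p * w p) * X *
          ∏ o ∈ Q.erase p, (1 - C (w o) * X) := by
  have hd : ∀ a b : F, (C a - C b * X).natDegree ≤ 1 := fun a b => by compute_degree
  have hd1 : ∀ b : F, ((1 : F[X]) - C b * X).natDegree ≤ 1 := fun b => by compute_degree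
  classical
  have hinj : Set.InjOn (fun p => (w p)⁻¹) Q := fun p hp o ho h => hw hp ho (inv_injective h)
  have hcard : (insert 0 (Q.image fun p => (w p)⁻¹)).card = Q.card + 1 := by
    rw [Finset.card_insert_of_notMem, Finset.card_image_of_injOn hinj]
    simp only [Finset.mem_image, not_exists, not_and]
    exact fun p hp => inv_ne_zero (hw0 p hp)
  refine Polynomial.eq_of_natDegree_lt_card_of_eval_eq' _ _
    (insert 0 (Q.image fun p => (w p)⁻¹)) ?_ ?_
  · intro t ht
    rcases Finset.mem_insert.mp ht with rfl | ht
    · simp [eval_prod, eval_finsetSum]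
    · obtain ⟨p, hp, rfl⟩ := Finset.mem_image.mp ht
      have hwp := hw0 p hp
      simp only [eval_prod, eval_finsetSum, eval_add, eval_mul, eval_sub, eval_C, eval_X, eval_one]
      have z1 : ∏ o ∈ Q, (1 - w o * (w p)⁻¹) = 0 :=
        Finset.prod_eq_zero hp (by rw [mul_inv_cancel₀ hwp, sub_self])
      rw [z1, mul_zero, zero_add, Finset.sum_eq_single p]
      · rw [← Finset.mul_prod_erase Q _ hp, resid, mul_inv_cancel_right₀ hwp,
          mul_inv_cancel_right₀ hwp, mul_assoc, ← Finset.prod_mul_distrib]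
        congr 1
        refine Finset.prod_congr rfl fun o ho => ?_
        have : w p - w o ≠ 0 := sub_ne_zero.mpr fun h => (Finset.ne_of_mem_erase ho)
          (hw (Finset.mem_of_mem_erase ho) hp h.symm)
        field_simp
      · intro o ho hop
        rw [Finset.prod_eq_zero (i := p) (Finset.mem_erase.mpr ⟨hop.symm, hp⟩)
          (by rw [mul_inv_cancel₀ hwp, sub_self]), mul_zero]
      · exact fun h => absurd hp h
  · rw [hcard]
    refine Nat.lt_succ_of_le (max_le ?_ ?_)
    · refine (natDegree_prod_le _ _).trans ((Finset.sum_le_sum fun p _ => hd _ _).trans ?_)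
      simp
    · refine (natDegree_add_le _ _).trans (max_le ?_ ?_)
      · refine (natDegree_C_mul_le _ _).trans ((natDegree_prod_le _ _).trans
          ((Finset.sum_le_sum fun p _ => hd1 _).trans ?_))
        simp
      · refine natDegree_sum_le_of_forall_le _ _ fun p hp => ?_
        refine natDegree_mul_le.trans ?_
        have h1 : (C ((α p - β p) * resid Q α β w p * w p) * X).natDegree ≤ 1 := by compute_degree
        have h2 := (natDegree_prod_le (Q.erase p) fun o => (1 : F[X]) - C (w o) * X).trans
          (Finset.sum_le_sum fun o _ => hd1 (w o))
        have h3 := Finset.card_erase_add_one hp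
        simp at h2
        omega

/-- The residues of `∏ (α_p z - β_p w_p) / (z - w_p)` sum up to the difference of its values at
infinity and at zero. -/
theorem sum_resid : ∑ p ∈ Q, (α p - β p) * resid Q α β w p = ∏ p ∈ Q, α p - ∏ p ∈ Q, β p := by
  have h := congrArg (fun f : F[X] => f.coeff Q.card) (partialFractions_poly Q α β w hw0 hw)
  have hd : ∀ a b : F, (C a - C b * X).natDegree ≤ 1 := fun a b => by compute_degree
  have hd1 : ∀ b : F, ((1 : F[X]) - C b * X).natDegree ≤ 1 := fun b => by compute_degree
  have e0 : ∏ p ∈ Q, w p ≠ 0 := Finset.prod_ne_zero_iff.mpr hw0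
  have e1 : (∏ p ∈ Q, (C (α p) - C (β p * w p) * X)).coeff Q.card = ∏ p ∈ Q, (-(β p * w p)) := by
    have := coeff_prod_of_natDegree_le Q (fun p => C (α p) - C (β p * w p) * X) 1
      (fun p _ => hd _ _)
    rw [mul_one] at this
    rw [this]
    refine Finset.prod_congr rfl fun p _ => ?_
    simp [coeff_C]
  have e2 : ∀ R : Finset ι, (∏ p ∈ R, (1 - C (w p) * X)).coeff R.card = ∏ p ∈ R, (-(w p)) := by
    intro R
    have := coeff_prod_of_natDegree_le R (fun p => 1 - C (w p) * X) 1 (fun p _ => hd1 _)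
    rw [mul_one] at this
    rw [this]
    refine Finset.prod_congr rfl fun p _ => ?_
    simp [coeff_one]
  simp only [coeff_add, finsetSum_coeff, coeff_C_mul, mul_assoc, e1, e2] at h
  have e3 : ∀ p ∈ Q, (X * ∏ o ∈ Q.erase p, (1 - C (w o) * X)).coeff Q.card
      = ∏ o ∈ Q.erase p, (-(w o)) := by
    intro p hp
    rw [← Finset.card_erase_add_one hp, coeff_X_mul, e2]
  rw [Finset.sum_congr rfl fun p hp => by rw [e3 p hp]] at h
  have e4 : ∀ p ∈ Q, (α p - β p) * (resid Q α β w p * (w p * ∏ o ∈ Q.erase p, (-(w o))))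
      = -((α p - β p) * resid Q α β w p) * ∏ o ∈ Q, (-(w o)) := by
    intro p hp
    rw [← Finset.mul_prod_erase Q _ hp]; ring
  rw [Finset.sum_congr rfl e4, ← Finset.sum_mul] at h
  have e5 : ∏ p ∈ Q, (-(β p * w p)) = (∏ p ∈ Q, β p) * ∏ p ∈ Q, (-(w p)) := by
    rw [← Finset.prod_mul_distrib]
    exact Finset.prod_congr rfl fun p _ => by ring
  have e6 : ∏ p ∈ Q, (-(w p)) ≠ 0 :=
    Finset.prod_ne_zero_iff.mpr fun p hp => neg_ne_zero.mpr (hw0 p hp)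
  rw [e5, ← add_mul] at h
  have h' := mul_right_cancel₀ e6 h
  rw [Finset.sum_neg_distrib] at h'
  linear_combination h'

/-- The Taylor coefficients of `∏ (α_p - β_p w_p X) / (1 - w_p X)`, from its partial fraction
expansion. -/
theorem coeff_prod_fraction {n : ℕ} (hn : 0 < n) :
    PowerSeries.coeff n (∏ p ∈ Q, (PowerSeries.C (α p) - PowerSeries.C (β p * w p) * PowerSeries.X)
      * geom (w p)) = ∑ p ∈ Q, (α p - β p) * resid Q α β w p * w p ^ n := by
  have h := congrArg (fun f : F[X] => (f : PowerSeries F)) (partialFractions_poly Q α β w hw0 hw)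
  have hprod : ∀ (R : Finset ι) (f : ι → F[X]),
      ((∏ p ∈ R, f p : F[X]) : PowerSeries F) = ∏ p ∈ R, (f p : PowerSeries F) :=
    fun R f => map_prod (coeToPowerSeries.ringHom (R := F)) f R
  have hsum : ∀ (R : Finset ι) (f : ι → F[X]),
      ((∑ p ∈ R, f p : F[X]) : PowerSeries F) = ∑ p ∈ R, (f p : PowerSeries F) :=
    fun R f => map_sum (coeToPowerSeries.ringHom (R := F)) f R
  simp only [hprod, hsum, coe_add, coe_mul, coe_sub, coe_C, coe_X, coe_one] at h
  have hg : ∀ R : Finset ι, (∏ p ∈ R, (1 - PowerSeries.C (w p) * PowerSeries.X)) *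
      ∏ p ∈ R, geom (w p) = 1 := by
    intro R
    rw [← Finset.prod_mul_distrib]
    exact Finset.prod_eq_one fun p _ => one_sub_mul_geom (w p)
  rw [Finset.prod_mul_distrib, h, add_mul, mul_assoc, hg, mul_one, Finset.sum_mul, map_add, map_sum]
  rw [PowerSeries.coeff_C, if_neg hn.ne', zero_add]
  refine Finset.sum_congr rfl fun p hp => ?_
  rw [← Finset.mul_prod_erase Q _ hp, mul_comm (geom (w p)), ← mul_assoc,
    mul_assoc _ _ (∏ o ∈ _, _), hg, mul_one, mul_assoc, PowerSeries.coeff_C_mul]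
  obtain ⟨k, rfl⟩ : ∃ k, n = k + 1 := ⟨n - 1, by omega⟩
  rw [PowerSeries.coeff_succ_X_mul, geom, PowerSeries.coeff_mk, pow_succ']
  ring

end PartialFractions

/-! ### Graded operators and sums over sites -/

section Graded

variable {L : Type*} [Field L] {S : Type*}

/-- The operator `f ↦ (d ↦ T (f (d - k)))`, that is `T ⊗ t ^ k` on Laurent series in `t`. -/
def lift (T : Module.End L (S → L)) (k : ℤ) : Module.End L (ℤ → S → L) where
  toFun f := fun d => T (f (d - k))
  map_add' f g := by ext; simp
  map_smul' c f := by ext; simp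

/-- Multiplication by the function `c ^ d * g`; the toral generators act in this way. -/
def torus (g : S → L) (c : L) : Module.End L (ℤ → S → L) where
  toFun f := fun d => (c ^ d • g) * f d
  map_add' f g := by ext; simp; ring
  map_smul' c f := by ext; simp; ring

theorem lmul_apply (g f : S → L) : Algebra.lmul L (S → L) g f = g * f := rfl

theorem lift_apply (T : Module.End L (S → L)) (k : ℤ) (f : ℤ → S → L) (d : ℤ) :
    lift T k f d = T (f (d - k)) := rfl

theorem torus_apply (g : S → L) (c : L) (f : ℤ → S → L) (d : ℤ) :
    torus g c f d = (c ^ d • g) * f d := rfl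

theorem lift_mul (T U : Module.End L (S → L)) (k l : ℤ) :
    lift T k * lift U l = lift (T * U) (k + l) := by
  ext f d : 2
  simp [lift_apply, Module.End.mul_apply, sub_sub]

theorem lift_add (T U : Module.End L (S → L)) (k : ℤ) :
    lift (T + U) k = lift T k + lift U k := rfl

theorem lift_sub (T U : Module.End L (S → L)) (k : ℤ) :
    lift (T - U) k = lift T k - lift U k := rfl

theorem lift_neg (T : Module.End L (S → L)) (k : ℤ) : lift (-T) k = -lift T k := rfl

theorem lift_smul (c : L) (T : Module.End L (S → L)) (k : ℤ) :
    lift (c • T) k = c • lift T k := rfl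

theorem lift_zero (k : ℤ) : lift (0 : Module.End L (S → L)) k = 0 := rfl

theorem torus_mul (g g' : S → L) (c c' : L) :
    torus g c * torus g' c' = torus (g * g') (c * c') := by
  ext f d x
  simp [torus_apply, Module.End.mul_apply, mul_zpow]; ring

theorem torus_one : torus (1 : S → L) 1 = 1 := by
  ext f d x
  simp [torus_apply]

theorem torus_const (h : L) : torus (fun _ : S => h) 1 = h • 1 := by
  ext f d x
  simp [torus_apply]

theorem lift_lmul_zero (g : S → L) : torus g 1 = lift (Algebra.lmul L (S → L) g) 0 := by
  ext f d x
  simp [torus_apply, lift_apply]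

/-- Commuting a toral generator with an operator of degree `k` in the loop parameter. -/
theorem torus_mul_lift {g : S → L} {c : L} (hc : c ≠ 0) {a : L} {T : Module.End L (S → L)} {k : ℤ}
    (h : Algebra.lmul L (S → L) g * T = a • (T * Algebra.lmul L (S → L) g)) :
    torus g c * lift T k = (c ^ k * a) • (lift T k * torus g c) := by
  ext f d : 2
  have h1 := congrArg (fun U : Module.End L (S → L) => U (f (d - k))) h
  simp only [Module.End.mul_apply, LinearMap.smul_apply, lmul_apply] at h1
  simp only [Module.End.mul_apply, LinearMap.smul_apply, torus_apply, lift_apply, Pi.smul_apply,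
    smul_mul_assoc, map_smul, h1, smul_smul]
  congr 1
  rw [mul_right_comm, ← zpow_add₀ hc, add_sub_cancel]

/-- Sums of products of site operators, for the quadratic relations. -/
theorem sum_quadratic {P E : Type*} [Fintype P] [Ring E] [Algebra L E] {A B : P → E}
    {W W' : P → L} (hW : ∀ p, W p ≠ 0) (hW' : ∀ p, W' p ≠ 0) {c d e : L}
    (h : ∀ p o, W p • (A p * B o) - (c * W p) • (B o * A p)
      = -(d • (W' o • (B o * A p) - (e * W' o) • (A p * B o)))) (k k' : ℤ) :
    (∑ p, W p ^ (k + 1) • A p) * (∑ o, W' o ^ k' • B o)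
      - c • ((∑ o, W' o ^ k' • B o) * (∑ p, W p ^ (k + 1) • A p)) =
    -(d • ((∑ o, W' o ^ (k' + 1) • B o) * (∑ p, W p ^ k • A p)
      - e • ((∑ p, W p ^ k • A p) * (∑ o, W' o ^ (k' + 1) • B o)))) := by
  have e1 : ∀ (f g : P → L), (∑ p, f p • A p) * (∑ o, g o • B o)
      = ∑ p, ∑ o, (f p * g o) • (A p * B o) := by
    intro f g
    rw [Finset.sum_mul_sum]
    simp only [smul_mul_assoc, mul_smul_comm, smul_smul, mul_comm]
  have e2 : ∀ (f g : P → L), (∑ o, g o • B o) * (∑ p, f p • A p)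
      = ∑ p, ∑ o, (f p * g o) • (B o * A p) := by
    intro f g
    rw [Finset.sum_mul_sum, Finset.sum_comm]
    simp only [smul_mul_assoc, mul_smul_comm, smul_smul]
  rw [e1, e2, e1, e2]
  simp only [Finset.smul_sum, ← Finset.sum_sub_distrib, ← Finset.sum_neg_distrib]
  refine Finset.sum_congr rfl fun p _ => Finset.sum_congr rfl fun o _ => ?_
  have := congrArg (fun y => (W p ^ k * W' o ^ k') • y) (h p o)
  simp only [smul_sub, smul_neg, smul_smul] at this ⊢
  rw [zpow_add_one₀ (hW p), zpow_add_one₀ (hW' o)]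
  linear_combination (norm := module) this

theorem triple {P E : Type*} [Fintype P] [Ring E] [Algebra L E] (A B C : P → E) (f g h : P → L) :
    (∑ p, f p • A p) * (∑ q, g q • B q) * (∑ o, h o • C o)
      = ∑ p, ∑ q, ∑ o, (f p * g q * h o) • (A p * B q * C o) := by
  rw [Finset.sum_mul_sum, Finset.sum_mul]
  refine Finset.sum_congr rfl fun p _ => ?_
  rw [Finset.sum_mul]
  refine Finset.sum_congr rfl fun q _ => ?_
  rw [Finset.mul_sum]
  refine Finset.sum_congr rfl fun o _ => ?_
  simp only [smul_mul_assoc, mul_smul_comm, smul_smul]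
  congr 1
  ring

/-- Sums of products of site operators, for the Serre relations. -/
theorem sum_serre {P E : Type*} [Fintype P] [Ring E] [Algebra L E] {A B : P → E}
    {W W' : P → L} {c d : L}
    (h : ∀ p₁ p₂ o, (A p₁ * A p₂ * B o - c • (A p₁ * B o * A p₂) + d • (B o * A p₁ * A p₂))
      + (A p₂ * A p₁ * B o - c • (A p₂ * B o * A p₁) + d • (B o * A p₂ * A p₁)) = 0)
    (m₁ m₂ k : ℤ) :
    ((∑ p, W p ^ m₁ • A p) * (∑ p, W p ^ m₂ • A p) * (∑ o, W' o ^ k • B o)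
      - c • ((∑ p, W p ^ m₁ • A p) * (∑ o, W' o ^ k • B o) * (∑ p, W p ^ m₂ • A p))
      + d • ((∑ o, W' o ^ k • B o) * (∑ p, W p ^ m₁ • A p) * (∑ p, W p ^ m₂ • A p)))
    + ((∑ p, W p ^ m₂ • A p) * (∑ p, W p ^ m₁ • A p) * (∑ o, W' o ^ k • B o)
      - c • ((∑ p, W p ^ m₂ • A p) * (∑ o, W' o ^ k • B o) * (∑ p, W p ^ m₁ • A p))
      + d • ((∑ o, W' o ^ k • B o) * (∑ p, W p ^ m₂ • A p) * (∑ p, W p ^ m₁ • A p))) = 0 := by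
  set T : P → P → P → E := fun p₁ p₂ o =>
    A p₁ * A p₂ * B o - c • (A p₁ * B o * A p₂) + d • (B o * A p₁ * A p₂) with hT
  have key : ∀ m₁ m₂ : ℤ,
      ((∑ p, W p ^ m₁ • A p) * (∑ p, W p ^ m₂ • A p) * (∑ o, W' o ^ k • B o)
      - c • ((∑ p, W p ^ m₁ • A p) * (∑ o, W' o ^ k • B o) * (∑ p, W p ^ m₂ • A p))
      + d • ((∑ o, W' o ^ k • B o) * (∑ p, W p ^ m₁ • A p) * (∑ p, W p ^ m₂ • A p)))
      = ∑ p₁, ∑ p₂, ∑ o, (W p₁ ^ m₁ * W p₂ ^ m₂ * W' o ^ k) • T p₁ p₂ o := by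
    intro m₁ m₂
    have t1 := triple A A B (fun p => W p ^ m₁) (fun p => W p ^ m₂) (fun o => W' o ^ k)
    have t2 := triple A B A (fun p => W p ^ m₁) (fun o => W' o ^ k) (fun p => W p ^ m₂)
    have t3 := triple B A A (fun o => W' o ^ k) (fun p => W p ^ m₁) (fun p => W p ^ m₂)
    have t2' := t2.trans (Finset.sum_congr rfl fun p _ => Finset.sum_comm)
    have t3' := (t3.trans Finset.sum_comm).trans (Finset.sum_congr rfl fun p _ => Finset.sum_comm)
    rw [t1, t2', t3']
    simp only [Finset.smul_sum, ← Finset.sum_sub_distrib, ← Finset.sum_add_distrib, hT, smul_add,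
      smul_sub, smul_smul]
    refine Finset.sum_congr rfl fun _ _ => Finset.sum_congr rfl fun _ _ =>
      Finset.sum_congr rfl fun _ _ => ?_
    module
  rw [key m₁ m₂, key m₂ m₁]
  have sw : ∑ p₁, ∑ p₂, ∑ o, (W p₁ ^ m₂ * W p₂ ^ m₁ * W' o ^ k) • T p₁ p₂ o
      = ∑ p₁, ∑ p₂, ∑ o, (W p₁ ^ m₁ * W p₂ ^ m₂ * W' o ^ k) • T p₂ p₁ o := by
    rw [Finset.sum_comm]
    simp only [mul_comm (W _ ^ m₂)]
  rw [sw]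
  simp only [← Finset.sum_add_distrib, ← smul_add]
  refine Finset.sum_eq_zero fun p₁ _ => Finset.sum_eq_zero fun p₂ _ =>
    Finset.sum_eq_zero fun o _ => ?_
  rw [hT, h p₁ p₂ o, smul_zero]

end Graded

/-! ### Site operators of the Drinfeld generators -/

theorem pairing_eq {F : Type*} [Field F] {m : ℕ} (r s : F) (i j : Fin m) :
    pairing r s i j = if i = j then r * s⁻¹ else if (i : ℕ) + 1 = j then r⁻¹
      else if (j : ℕ) + 1 = i then s else 1 := by
  unfold pairing epsAlpha
  by_cases h1 : i = j
  · subst h1; simp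
  · have h1' : (i : ℕ) ≠ j := fun h => h1 (Fin.ext h)
    by_cases h2 : (i : ℕ) + 1 = j
    · have e1 : ¬ (j : ℕ) = i := by omega
      have e2 : ¬ (j : ℕ) + 1 = i := by omega
      have e3 : ¬ (i : ℕ) + 1 + 1 = i := by omega
      simp [h1, e3, ← h2]
    · by_cases h3 : (j : ℕ) + 1 = i
      · have e1 : ¬ (j : ℕ) = i := by omega
        have e2 : ¬ (j : ℕ) = i + 1 := by omega
        have e3 : ¬ (j : ℕ) = j + 1 + 1 := by omega
        have e4 : ¬ (j : ℕ) + 1 + 1 = j := by omega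
        simp [h1, e3, e4, ← h3]
      · have e1 : ¬ (j : ℕ) = i := by omega
        have e2 : ¬ (j : ℕ) = i + 1 := by omega
        simp [h1, h2, h3, e1, e2]

section Sites

variable {L P : Type*} [Field L] [Fintype P] [DecidableEq P] (z : P → L) (a b : L)

/-- The contribution of the site `p` to the generator `x_i^±`: it moves the site from `i` to `i + 1`
for the sign `+`, and from `i + 1` to `i` for the sign `-`. The parameters are `r = a ^ 2` and
`s = b ^ 2`. -/
def siteOp : PM → ℕ → P → Module.End L ((P → ℕ) → L)
  | PM.pos, i, p => move z (a ^ 2) (b ^ 2) i (i + 1) p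
  | PM.neg, i, p => move z (b ^ 2) (a ^ 2) (i + 1) i p

/-- The spectral parameter at which the generators with index `i` act on the site `p`. -/
def spec (i : ℕ) (p : P) : L := (a / b) ^ i * z p

variable {z a b} (hz : Function.Injective z) (ha : a ≠ 0) (hb : b ≠ 0)
include hz ha hb

/-- The quadratic relation between `x_i^+` and `x_j^+`, separately for each pair of sites. -/
theorem siteOp_quadratic_pos {m : ℕ} (i j : Fin m) (p o : P) :
    spec z a b i p • (siteOp z a b PM.pos i p * siteOp z a b PM.pos j o)
      - (pairing (a ^ 2) (b ^ 2) j i * spec z a b i p) •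
        (siteOp z a b PM.pos j o * siteOp z a b PM.pos i p)
    = -((pairing a b j i * (pairing a b i j)⁻¹) •
        (spec z a b j o • (siteOp z a b PM.pos j o * siteOp z a b PM.pos i p)
          - (pairing (a ^ 2) (b ^ 2) i j * spec z a b j o) •
            (siteOp z a b PM.pos i p * siteOp z a b PM.pos j o))) := by
  simp only [siteOp, spec]
  by_cases hij : i = j
  · subst hij
    by_cases hpo : p = o
    · subst hpo
      rw [move_mul_move_self z (by omega)]; simp
    · have h1 : z p - z o ≠ 0 := sub_ne_zero.mpr (hz.ne hpo)
      rw [move_mul_move z hpo, move_mul_move z (Ne.symm hpo), movePair_comm z (Ne.symm hpo),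
        ← kap_swap z p o]
      simp only [pairing_eq, if_true, if_neg (Nat.succ_ne_self _), kap]
      match_scalars
      field_simp
      ring
  · have hij' : (i : ℕ) ≠ j := fun h => hij (Fin.ext h)
    have hji : j ≠ i := Ne.symm hij
    by_cases h2 : (i : ℕ) + 1 = j
    · have h3 : ¬ (j : ℕ) + 1 = i := by omega
      simp only [pairing_eq, if_neg hij, if_neg hji, if_pos h2, if_neg h3]
      rw [← h2, pow_succ (a / b)]
      generalize (a / b) ^ (i : ℕ) = t
      by_cases hpo : p = o
      · subst hpo
        rw [move_mul_move_self z (a := (i : ℕ) + 1) (by omega)]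
        rw [smul_zero, smul_zero, sub_zero, zero_sub, smul_neg, neg_neg, smul_smul]
        match_scalars
        field_simp
      · have h1 : z o - z p ≠ 0 := sub_ne_zero.mpr (hz.ne (Ne.symm hpo))
        rw [move_mul_next z (by omega) (by omega) hpo]
        simp only [kap]
        match_scalars
        field_simp
        ring
    · by_cases h3 : (j : ℕ) + 1 = i
      · simp only [pairing_eq, if_neg hij, if_neg hji, if_neg h2, if_pos h3]
        rw [← h3, pow_succ (a / b)]
        generalize (a / b) ^ (j : ℕ) = t
        by_cases hpo : p = o
        · subst hpo
          rw [move_mul_move_self z (a := (j : ℕ) + 1) (by omega)]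
          rw [smul_zero, smul_zero, sub_zero, zero_sub]
          match_scalars
          field_simp
        · have h1 : z p - z o ≠ 0 := sub_ne_zero.mpr (hz.ne hpo)
          rw [move_mul_next z (p := o) (o := p) (by omega) (by omega) (Ne.symm hpo)]
          simp only [kap]
          match_scalars
          field_simp
          ring
      · simp only [pairing_eq, if_neg hij, if_neg hji, if_neg h2, if_neg h3]
        rw [move_comm_of_disjoint z (a := (i : ℕ)) (c := (j : ℕ)) (by omega) (by omega) (by omega)]
        simp

/-- The quadratic relation between `x_i^-` and `x_j^-`, separately for each pair of sites. -/
theorem siteOp_quadratic_neg {m : ℕ} (i j : Fin m) (p o : P) :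
    spec z a b i p • (siteOp z a b PM.neg i p * siteOp z a b PM.neg j o)
      - ((pairing (a ^ 2) (b ^ 2) j i)⁻¹ * spec z a b i p) •
        (siteOp z a b PM.neg j o * siteOp z a b PM.neg i p)
    = -((pairing a b j i * (pairing a b i j)⁻¹)⁻¹ •
        (spec z a b j o • (siteOp z a b PM.neg j o * siteOp z a b PM.neg i p)
          - ((pairing (a ^ 2) (b ^ 2) i j)⁻¹ * spec z a b j o) •
            (siteOp z a b PM.neg i p * siteOp z a b PM.neg j o))) := by
  simp only [siteOp, spec]
  by_cases hij : i = j
  · subst hij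
    by_cases hpo : p = o
    · subst hpo
      rw [move_mul_move_self z (by omega)]; simp
    · have h1 : z p - z o ≠ 0 := sub_ne_zero.mpr (hz.ne hpo)
      rw [move_mul_move z hpo, move_mul_move z (Ne.symm hpo), movePair_comm z (Ne.symm hpo),
        ← kap_swap z p o]
      simp only [pairing_eq, if_true, if_neg (Nat.succ_ne_self _).symm, kap]
      match_scalars
      field_simp
      ring
  · have hij' : (i : ℕ) ≠ j := fun h => hij (Fin.ext h)
    have hji : j ≠ i := Ne.symm hij
    by_cases h2 : (i : ℕ) + 1 = j
    · have h3 : ¬ (j : ℕ) + 1 = i := by omega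
      simp only [pairing_eq, if_neg hij, if_neg hji, if_pos h2, if_neg h3]
      rw [← h2, pow_succ (a / b)]
      generalize (a / b) ^ (i : ℕ) = t
      by_cases hpo : p = o
      · subst hpo
        rw [move_mul_move_self z (a := (i : ℕ) + 1) (b := (i : ℕ)) (by omega)]
        rw [smul_zero, smul_zero, sub_zero, zero_sub]
        match_scalars
        field_simp
      · have h1 : z p - z o ≠ 0 := sub_ne_zero.mpr (hz.ne hpo)
        rw [move_mul_next z (p := o) (o := p) (by omega) (by omega) (Ne.symm hpo)]
        simp only [kap]
        match_scalars
        field_simp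
        ring
    · by_cases h3 : (j : ℕ) + 1 = i
      · simp only [pairing_eq, if_neg hij, if_neg hji, if_neg h2, if_pos h3]
        rw [← h3, pow_succ (a / b)]
        generalize (a / b) ^ (j : ℕ) = t
        by_cases hpo : p = o
        · subst hpo
          rw [move_mul_move_self z (a := (j : ℕ) + 1) (b := (j : ℕ)) (by omega)]
          rw [smul_zero, smul_zero, sub_zero, zero_sub, smul_neg, neg_neg, smul_smul]
          match_scalars
          field_simp
        · have h1 : z o - z p ≠ 0 := sub_ne_zero.mpr (hz.ne (Ne.symm hpo))
          rw [move_mul_next z (p := p) (o := o) (by omega) (by omega) hpo]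
          simp only [kap]
          match_scalars
          field_simp
          ring
      · simp only [pairing_eq, if_neg hij, if_neg hji, if_neg h2, if_neg h3]
        rw [move_comm_of_disjoint z (a := (i : ℕ) + 1) (c := (j : ℕ) + 1)
          (by omega) (by omega) (by omega)]
        simp

end Sites

section Sites

variable {L P : Type*} [Field L] [Fintype P] [DecidableEq P] {z : P → L} {a b : L}

theorem siteOp_comm (e : PM) {i j : ℕ} (h : i + 2 ≤ j ∨ j + 2 ≤ i) (p o : P) :
    siteOp z a b e i p * siteOp z a b e j o = siteOp z a b e j o * siteOp z a b e i p := by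
  cases e <;> exact move_comm_of_disjoint z (by omega) (by omega) (by omega) p o

theorem siteOp_serre_lt (hz : Function.Injective z) (ha : a ≠ 0) (hb : b ≠ 0) (e : PM) {i j : ℕ}
    (h : i + 1 = j) (p₁ p₂ o : P) :
    (siteOp z a b e i p₁ * siteOp z a b e i p₂ * siteOp z a b e j o
        - ((a ^ 2) ^ e.sgn + (b ^ 2) ^ e.sgn) •
          (siteOp z a b e i p₁ * siteOp z a b e j o * siteOp z a b e i p₂)
        + (a ^ 2 * b ^ 2) ^ e.sgn •
          (siteOp z a b e j o * siteOp z a b e i p₁ * siteOp z a b e i p₂))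
      + (siteOp z a b e i p₂ * siteOp z a b e i p₁ * siteOp z a b e j o
        - ((a ^ 2) ^ e.sgn + (b ^ 2) ^ e.sgn) •
          (siteOp z a b e i p₂ * siteOp z a b e j o * siteOp z a b e i p₁)
        + (a ^ 2 * b ^ 2) ^ e.sgn •
          (siteOp z a b e j o * siteOp z a b e i p₂ * siteOp z a b e i p₁)) = 0 := by
  subst h
  cases e with
  | pos =>
    simp only [PM.sgn, siteOp, zpow_one]
    exact serre_move_left hz (by omega) (by omega) p₁ p₂ o
  | neg =>
    simp only [PM.sgn, siteOp, zpow_neg, zpow_one]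
    have h := congrArg (fun y => (a ^ 2 * b ^ 2)⁻¹ • y) (serre_move_right (u := b ^ 2)
      (v := a ^ 2) hz (a := i + 1 + 1) (b := i + 1) (c := i) (by omega) (by omega) (by omega)
      p₁ p₂ o)
    simp only [smul_zero] at h
    rw [← h]
    match_scalars <;> field_simp

theorem siteOp_serre_gt (hz : Function.Injective z) (ha : a ≠ 0) (hb : b ≠ 0) (e : PM) {i j : ℕ}
    (h : j + 1 = i) (p₁ p₂ o : P) :
    (siteOp z a b e i p₁ * siteOp z a b e i p₂ * siteOp z a b e j o
        - ((a ^ 2) ^ (-e.sgn) + (b ^ 2) ^ (-e.sgn)) •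
          (siteOp z a b e i p₁ * siteOp z a b e j o * siteOp z a b e i p₂)
        + (a ^ 2 * b ^ 2) ^ (-e.sgn) •
          (siteOp z a b e j o * siteOp z a b e i p₁ * siteOp z a b e i p₂))
      + (siteOp z a b e i p₂ * siteOp z a b e i p₁ * siteOp z a b e j o
        - ((a ^ 2) ^ (-e.sgn) + (b ^ 2) ^ (-e.sgn)) •
          (siteOp z a b e i p₂ * siteOp z a b e j o * siteOp z a b e i p₁)
        + (a ^ 2 * b ^ 2) ^ (-e.sgn) •
          (siteOp z a b e j o * siteOp z a b e i p₂ * siteOp z a b e i p₁)) = 0 := by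
  subst h
  cases e with
  | neg =>
    simp only [PM.sgn, siteOp, zpow_one, neg_neg]
    have := serre_move_left (u := b ^ 2) (v := a ^ 2) hz (a := j + 1 + 1) (b := j + 1) (c := j)
      (by omega) (by omega) p₁ p₂ o
    rwa [add_comm (b ^ 2), mul_comm (b ^ 2)] at this
  | pos =>
    simp only [PM.sgn, siteOp, zpow_neg, zpow_one]
    have h := congrArg (fun y => (a ^ 2 * b ^ 2)⁻¹ • y) (serre_move_right (u := a ^ 2)
      (v := b ^ 2) hz (a := j) (b := j + 1) (c := j + 1 + 1) (by omega) (by omega) (by omega)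
      p₁ p₂ o)
    simp only [smul_zero] at h
    rw [← h]
    match_scalars <;> field_simp <;> ring

theorem siteOp_pos_neg_comm {i j : ℕ} {p o : P} (h : i ≠ j ∨ p ≠ o) :
    siteOp z a b PM.pos i p * siteOp z a b PM.neg j o =
      siteOp z a b PM.neg j o * siteOp z a b PM.pos i p := by
  simp only [siteOp]
  by_cases hij : i = j
  · subst hij
    exact move_comm_opposite z (by omega) (h.resolve_left (by simp))
  · by_cases h3 : j + 1 = i
    · rw [h3]
      exact move_comm_of_same_source z (by omega) (by omega) p o
    · exact move_comm_of_disjoint z (by omega) (by omega) (by omega) p o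

/-- The value `r` in state `i`, `s` in state `i + 1`, and `1` in all other states. This is the
eigenvalue of `ω_i` on a single site, and that of `ω'_i` when `r` and `s` are exchanged. -/
def stateVal (r s : L) (i x : ℕ) : L := if x = i then r else if x = i + 1 then s else 1

theorem stateVal_ne_zero {r s : L} (hr : r ≠ 0) (hs : s ≠ 0) (i x : ℕ) : stateVal r s i x ≠ 0 := by
  unfold stateVal; split_ifs <;> simp [*]

/-- A site moved away and back collects an interaction factor with each of the other sites in
state `i` or `i + 1`; their product is the residue of the eigenvalue of `ω_i(z)` at this site. -/
theorem coef_mul_coef (hz : Function.Injective z) (r s : L) (i : ℕ) (m : P → ℕ) (p : P) :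
    coef z r s i m p * coef z s r (i + 1) m p =
      resid Finset.univ (fun o => stateVal r s i (m o)) (fun o => stateVal s r i (m o)) z p := by
  rw [coef, coef, resid, ← Finset.prod_mul_distrib]
  refine Finset.prod_congr rfl fun o ho => ?_
  have h1 : z p - z o ≠ 0 := sub_ne_zero.mpr (hz.ne (Finset.ne_of_mem_erase ho).symm)
  unfold stateVal kap
  by_cases h : m o = i
  · simp [h]
  · by_cases h' : m o = i + 1
    · simp [h']
    · simp [h, h', h1]

/-- The commutator of opposite moves of one site is diagonal, with the residue of a rational
function as eigenvalue. -/
theorem siteOp_commutator_self (hz : Function.Injective z) (hab : a ^ 2 - b ^ 2 ≠ 0) (i : ℕ)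
    (p : P) :
    siteOp z a b PM.pos i p * siteOp z a b PM.neg i p
      - siteOp z a b PM.neg i p * siteOp z a b PM.pos i p =
    (a ^ 2 - b ^ 2)⁻¹ • Algebra.lmul L ((P → ℕ) → L) (fun m =>
      (stateVal (a ^ 2) (b ^ 2) i (m p) - stateVal (b ^ 2) (a ^ 2) i (m p)) *
        resid Finset.univ (fun o => stateVal (a ^ 2) (b ^ 2) i (m o))
          (fun o => stateVal (b ^ 2) (a ^ 2) i (m o)) z p) := by
  simp only [siteOp]
  rw [move_mul_move_swap_self, move_mul_move_swap_self]
  ext f m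
  simp only [LinearMap.sub_apply, LinearMap.smul_apply, LinearMap.pi_apply, LinearMap.proj_apply,
    Pi.sub_apply, Pi.smul_apply, lmul_apply, Pi.mul_apply, smul_eq_mul]
  rw [← coef_mul_coef hz, mul_comm (coef z (b ^ 2) (a ^ 2) (i + 1) m p)]
  unfold stateVal
  by_cases h : m p = i
  · simp only [h, if_true, if_neg (Nat.succ_ne_self i).symm]
    field_simp
    ring
  · by_cases h' : m p = i + 1
    · simp only [h', if_true, if_neg (Nat.succ_ne_self i)]
      field_simp
      ring
    · simp [h, h']

theorem lmul_move_commutator {u v : L} {i j : ℕ} {p : P} {g : (P → ℕ) → L} {c : L}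
    (h : ∀ m : P → ℕ, m p = i → g m - g (Function.update m p j) = c) :
    Algebra.lmul L ((P → ℕ) → L) g * move z u v i j p
      - move z u v i j p * Algebra.lmul L ((P → ℕ) → L) g = c • move z u v i j p := by
  ext f m
  simp only [LinearMap.sub_apply, LinearMap.smul_apply, Module.End.mul_apply,
    Pi.sub_apply, Pi.smul_apply, lmul_apply, Pi.mul_apply, smul_eq_mul, move_apply]
  by_cases hm : m p = i
  · rw [if_pos hm, if_pos hm, ← h m hm]; ring
  · simp [hm]

theorem lmul_mul_move {u v : L} {i j : ℕ} {p : P} {g : (P → ℕ) → L} {c : L}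
    (h : ∀ m : P → ℕ, m p = i → g m = c * g (Function.update m p j)) :
    Algebra.lmul L ((P → ℕ) → L) g * move z u v i j p
      = c • (move z u v i j p * Algebra.lmul L ((P → ℕ) → L) g) := by
  ext f m
  simp only [LinearMap.smul_apply, Module.End.mul_apply,
    Pi.smul_apply, lmul_apply, Pi.mul_apply, smul_eq_mul, move_apply]
  by_cases hm : m p = i
  · rw [if_pos hm, if_pos hm, h m hm]; ring
  · simp [hm]

/-- The eigenvalue of `ω_i` (and of `ω'_i` when `r` and `s` are exchanged). -/
def omVal (P : Type*) [Fintype P] (r s : L) (i : ℕ) : (P → ℕ) → L :=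
  fun m => ∏ p, stateVal r s i (m p)

theorem omVal_update (r s : L) (i : ℕ) (m : P → ℕ) (p : P) (y : ℕ) :
    omVal P r s i m * stateVal r s i y = omVal P r s i (Function.update m p y)
      * stateVal r s i (m p) := by
  unfold omVal
  rw [← Finset.mul_prod_erase Finset.univ _ (Finset.mem_univ p),
    ← Finset.mul_prod_erase Finset.univ (fun o => stateVal r s i (Function.update m p y o))
      (Finset.mem_univ p), Function.update_self]
  have : ∏ o ∈ Finset.univ.erase p, stateVal r s i (Function.update m p y o)
      = ∏ o ∈ Finset.univ.erase p, stateVal r s i (m o) := by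
    refine Finset.prod_congr rfl fun o ho => ?_
    rw [Function.update_of_ne (Finset.ne_of_mem_erase ho)]
  rw [this]; ring

theorem stateVal_ratio {m : ℕ} {r s : L} (hr : r ≠ 0) (hs : s ≠ 0) (i j : Fin m) :
    stateVal r s i j = pairing r s j i * stateVal r s i (j + 1) := by
  rw [pairing_eq]
  unfold stateVal
  by_cases h1 : i = j
  · subst h1; simp [hs]
  · have h1' : ¬ (j : ℕ) = i := fun h => h1 (Fin.ext h.symm)
    by_cases h2 : (i : ℕ) + 1 = j
    · have e1 : ¬ (j : ℕ) + 1 = i := by omega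
      have e2 : ¬ (j : ℕ) + 1 = i + 1 := by omega
      simp only [if_neg (Ne.symm h1), if_neg h1', if_pos h2.symm, if_neg e1, if_pos h2, if_neg e2]
      simp
    · have e1 : ¬ (j : ℕ) + 1 = i + 1 := by omega
      by_cases h3 : (j : ℕ) + 1 = i
      · simp [Ne.symm h1, h1', h3, Ne.symm h2, hr]
      · simp only [if_neg (Ne.symm h1), if_neg h1', if_neg h2, if_neg h3, if_neg (Ne.symm h2),
          if_neg e1]
        simp

theorem stateVal_ratio' {m : ℕ} {r s : L} (hr : r ≠ 0) (hs : s ≠ 0) (i j : Fin m) :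
    stateVal s r i j = (pairing r s i j)⁻¹ * stateVal s r i (j + 1) := by
  rw [stateVal_ratio hs hr]
  congr 1
  rw [pairing_eq, pairing_eq]
  by_cases h1 : i = j
  · subst h1; simp
  · have h1' : ¬ (j : ℕ) = i := fun h => h1 (Fin.ext h.symm)
    by_cases h2 : (i : ℕ) + 1 = j
    · have e1 : ¬ (j : ℕ) + 1 = i := by omega
      simp only [if_neg (Ne.symm h1), if_neg h1, if_neg e1, if_pos h2, inv_inv]
    · simp only [if_neg (Ne.symm h1), if_neg h1, if_neg h2]
      split_ifs <;> simp

/-- Conjugation of a site operator by `ω_i`. -/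
theorem omVal_siteOp {m : ℕ} {r s : L} (hr : r ≠ 0) (hs : s ≠ 0) (i j : Fin m) (e : PM) (p : P)
    {c : L} (hc0 : c ≠ 0) (hc : stateVal r s i j = c * stateVal r s i (j + 1)) :
    Algebra.lmul L ((P → ℕ) → L) (omVal P r s i) * siteOp z a b e j p
      = c ^ e.sgn • (siteOp z a b e j p * Algebra.lmul L ((P → ℕ) → L) (omVal P r s i)) := by
  cases e with
  | pos =>
    refine lmul_mul_move fun m' hm => ?_
    have h := omVal_update r s i m' p (j + 1)
    have h0 := stateVal_ne_zero hr hs i (j + 1)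
    rw [hm, hc] at h
    refine mul_right_cancel₀ h0 (h.trans ?_)
    simp only [PM.sgn, zpow_one]; ring
  | neg =>
    refine lmul_mul_move fun m' hm => ?_
    have h := omVal_update r s i m' p j
    have h0 := stateVal_ne_zero hr hs i (j + 1)
    rw [hm, hc] at h
    refine mul_right_cancel₀ (mul_ne_zero hc0 h0) (h.trans ?_)
    simp only [PM.sgn, zpow_neg, zpow_one]
    field_simp

/-- The contribution of a site in state `x` to the eigenvalue of `a_i(l)`, up to a power of `γ`. -/
def bSite (z : P → L) (a b : L) (i : ℕ) (l : ℤ) (x : ℕ) (p : P) : L :=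
  (1 - (stateVal (b ^ 2) (a ^ 2) i x / stateVal (a ^ 2) (b ^ 2) i x) ^ l) * spec z a b i p ^ l
    / (l * (a ^ 2 - b ^ 2))

/-- The eigenvalue of `a_i(l)`, up to a power of `γ`. -/
def bVal (z : P → L) (a b : L) (i : ℕ) (l : ℤ) : (P → ℕ) → L :=
  fun m => ∑ p, bSite z a b i l (m p) p

theorem bVal_update (i : ℕ) (l : ℤ) (m : P → ℕ) (p : P) (y : ℕ) :
    bVal z a b i l m - bVal z a b i l (Function.update m p y)
      = bSite z a b i l (m p) p - bSite z a b i l y p := by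
  unfold bVal
  rw [← Finset.sum_sub_distrib, Finset.sum_eq_single p]
  · rw [Function.update_self]
  · intro o _ ho
    rw [Function.update_of_ne ho, sub_self]
  · simp

/-- The difference of the eigenvalues of `a_i(l)` on the two states joined by `x_j^±` is the
structure constant of `[a_i(l), x_j^±(k)]`, times a power of the spectral parameter. -/
theorem bSite_sub {m : ℕ} (ha : a ≠ 0) (hb : b ≠ 0) (i j : Fin m) (l : ℤ) (p : P) :
    bSite z a b i l j p - bSite z a b i l (j + 1) p =
      (pairing a b i i ^ (l * CartanMatrix.A m i j)
          - pairing a b i i ^ (-(l * CartanMatrix.A m i j)))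
        / (l * (a ^ 2 - b ^ 2)) * spec z a b j p ^ l := by
  have hq : a / b ≠ 0 := div_ne_zero ha hb
  have hu : ((a / b) ^ l) ≠ 0 := zpow_ne_zero _ hq
  have e1 : (b ^ 2 / a ^ 2) ^ l = ((a / b) ^ l)⁻¹ ^ 2 := by
    rw [← div_pow, ← zpow_natCast, zpow_comm, zpow_natCast, ← inv_zpow, inv_div]
  have e2 : (a ^ 2 / b ^ 2) ^ l = ((a / b) ^ l) ^ 2 := by
    rw [← div_pow, ← zpow_natCast, zpow_comm, zpow_natCast]
  have e3 : pairing a b i i = a / b := by rw [pairing_eq, if_pos rfl, div_eq_mul_inv]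
  have e4 : ∀ k : ℕ, spec z a b (k + 1) p ^ l = (a / b) ^ l * spec z a b k p ^ l := by
    intro k; rw [spec, spec, pow_succ', mul_assoc, mul_zpow]
  rw [e3]
  by_cases h1 : i = j
  · subst h1
    have c : CartanMatrix.A m i i = 2 := by simp [CartanMatrix.A]
    rw [c, zpow_neg, zpow_mul]
    simp only [bSite, stateVal, if_true, if_neg (Nat.succ_ne_self _), e1, e2]
    rw [show ((a / b) ^ l) ^ (2 : ℤ) = ((a / b) ^ l) ^ 2 from zpow_natCast _ 2]
    ring
  · have h1' : ¬ (j : ℕ) = i := fun h => h1 (Fin.ext h.symm)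
    by_cases h2 : (i : ℕ) + 1 = j
    · have c : CartanMatrix.A m i j = -1 := by simp [CartanMatrix.A, h1, h2]
      have n1 : ¬ (j : ℕ) + 1 = i := by omega
      have n2 : ¬ (j : ℕ) + 1 = i + 1 := by omega
      rw [c, mul_neg_one, neg_neg, zpow_neg]
      simp only [bSite, stateVal, if_neg h1', if_neg n1, if_neg n2, if_pos h2.symm, e2, div_one,
        one_zpow, sub_self, zero_mul, zero_div, sub_zero]
      rw [← h2, e4]
      field_simp
    · have n2 : ¬ (j : ℕ) + 1 = i + 1 := by omega
      by_cases h3 : (j : ℕ) + 1 = i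
      · have c : CartanMatrix.A m i j = -1 := by simp [CartanMatrix.A, h1, h3]
        rw [c, mul_neg_one, neg_neg, zpow_neg]
        simp only [bSite, stateVal, if_neg h1', if_pos h3, if_neg (Ne.symm h2), e1, div_one,
          one_zpow, sub_self, zero_mul, zero_div, zero_sub]
        rw [← h3, e4]
        field_simp
        ring
      · have c : CartanMatrix.A m i j = 0 := by simp [CartanMatrix.A, h1, h2, h3]
        simp [bSite, stateVal, h1', h3, Ne.symm h2, c]

theorem bVal_siteOp {m : ℕ} (ha : a ≠ 0) (hb : b ≠ 0) (i j : Fin m) (l : ℤ) (e : PM) (p : P) :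
    Algebra.lmul L ((P → ℕ) → L) (bVal z a b i l) * siteOp z a b e j p
      - siteOp z a b e j p * Algebra.lmul L ((P → ℕ) → L) (bVal z a b i l) =
    (e.sgn * ((pairing a b i i ^ (l * CartanMatrix.A m i j)
      - pairing a b i i ^ (-(l * CartanMatrix.A m i j))) / (l * (a ^ 2 - b ^ 2))
        * spec z a b j p ^ l)) • siteOp z a b e j p := by
  rw [← bSite_sub ha hb]
  cases e with
  | pos =>
    refine lmul_move_commutator fun m' hm => ?_
    rw [bVal_update, hm]; simp [PM.sgn]
  | neg =>
    refine lmul_move_commutator fun m' hm => ?_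
    rw [bVal_update, hm]; simp [PM.sgn]

end Sites

/-! ### The representation of the Drinfeld realization -/

section Series

variable {L : Type*} [Field L]

theorem expCoeff_scale (c t : L) (b : ℕ → L) (n : ℕ) :
    expCoeff L c (fun l => t ^ l * b l) n = t ^ n * expCoeff L c b n := by
  have hl : ∀ l : List ℕ, (l.map fun i => t ^ i * b i).prod = t ^ l.sum * (l.map b).prod := by
    intro l
    induction l with
    | nil => simp
    | cons i l ih => simp only [List.map_cons, List.prod_cons, ih, List.sum_cons, pow_add]; ring
  simp only [expCoeff, hl, Composition.blocks_sum, Finset.mul_sum, smul_eq_mul]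
  exact Finset.sum_congr rfl fun p _ => by ring

/-- The formal exponential of a series of commuting multiplication operators is the multiplication
by the formal exponential. -/
theorem expCoeff_lift {K S : Type*} [Field K] [Algebra K L] (c : K) (δ : ℤ) (g : ℕ → S → L)
    (n : ℕ) :
    expCoeff K c (fun l => lift (Algebra.lmul L (S → L) (g l)) (δ * l)) n =
      lift (Algebra.lmul L (S → L) fun m => expCoeff L (algebraMap K L c) (fun l => g l m) n)
        (δ * n) := by
  have hl : ∀ l : List ℕ, (l.map fun i => lift (Algebra.lmul L (S → L) (g i)) (δ * i)).prod
      = lift (Algebra.lmul L (S → L) (l.map g).prod) (δ * (l.sum : ℕ)) := by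
    intro l
    induction l with
    | nil =>
      ext f d x
      simp [lift_apply]
    | cons i l ih =>
      rw [List.map_cons, List.prod_cons, ih, lift_mul, List.map_cons, List.prod_cons, map_mul,
        List.sum_cons]
      push_cast
      rw [mul_add]
  simp only [expCoeff, hl, Composition.blocks_sum]
  ext f d x
  have hev : ∀ l : List ℕ, (l.map g).prod x = (l.map fun i => g i x).prod := by
    intro l
    induction l with
    | nil => rfl
    | cons i l ih => simp [ih]
  simp only [LinearMap.sum_apply, Finset.sum_apply, LinearMap.smul_apply, Pi.smul_apply, lift_apply,
    lmul_apply, Pi.mul_apply, Finset.sum_mul, hev]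
  refine Finset.sum_congr rfl fun p _ => ?_
  rw [Algebra.smul_def, smul_eq_mul, map_div₀, map_pow, map_natCast, mul_assoc]

/-- If the numbers `b l` are the power sums that occur in the logarithm of
`∏ (1 - (β_p / α_p) w_p X) / (1 - w_p X)`, then the formal exponential is this rational function,
and its coefficients are sums of residues. -/
theorem prod_mul_expCoeff [CharZero L] {P : Type*} [Fintype P] [DecidableEq P] (α β w : P → L)
    (hα : ∀ p, α p ≠ 0) (hw0 : ∀ p, w p ≠ 0) (hw : Function.Injective w) (c : L) (b : ℕ → L)
    (hb : ∀ l : ℕ, 0 < l → c * ((l : L) * b l) = ∑ p, (1 - (β p / α p) ^ l) * w p ^ l) (n : ℕ) :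
    (∏ p, α p) * expCoeff L c b n =
      if n = 0 then ∏ p, α p else ∑ p, (α p - β p) * resid Finset.univ α β w p * w p ^ n := by
  rcases Nat.eq_zero_or_pos n with rfl | hn
  · rw [expCoeff_zero, if_pos rfl, mul_one]
  · rw [if_neg hn.ne', ← coeff_prod_fraction Finset.univ α β w (fun p _ => hw0 p) hw.injOn hn,
      expCoeff_eq_coeff_prod Finset.univ c b (fun p => β p / α p) w hb, ← PowerSeries.coeff_C_mul]
    congr 1
    rw [map_prod, ← Finset.prod_mul_distrib]
    refine Finset.prod_congr rfl fun p _ => ?_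
    rw [← mul_assoc]
    congr 1
    rw [mul_sub, mul_one, ← mul_assoc, ← map_mul]
    congr 3
    field_simp [hα p]

theorem resid_smul {ι : Type*} [DecidableEq ι] (Q : Finset ι) (α β z : ι → L) {c : L} (hc : c ≠ 0)
    (p : ι) : resid Q α β (fun o => c * z o) p = resid Q α β z p := by
  refine Finset.prod_congr rfl fun o _ => ?_
  rw [← mul_sub, mul_left_comm, mul_left_comm (β o), ← mul_sub, mul_div_mul_left _ _ hc]

/-- The symmetry of the residues under the exchange of zero and infinity. -/
theorem resid_inv {ι : Type*} [DecidableEq ι] (Q : Finset ι) (α β z : ι → L) (hz : ∀ o, z o ≠ 0)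
    (p : ι) : resid Q β α (fun o => (z o)⁻¹) p = resid Q α β z p := by
  refine Finset.prod_congr rfl fun o _ => ?_
  have h1 := hz o
  have h2 := hz p
  rw [← mul_div_mul_right _ _ (neg_ne_zero.mpr (mul_ne_zero h1 h2))]
  congr 1 <;> field_simp <;> ring

end Series

section Representation

variable {K L P : Type*} [Field K] [Field L] [Algebra K L] [Fintype P] [DecidableEq P] {n : ℕ}

/-- The shift of the spectral parameters: there is none for `x_i^+(k)`, and those of `x_i^-(k)` are
multiplied by `γ = h ^ 2`. -/
def level (h : L) : PM → L
  | PM.pos => 1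
  | PM.neg => h ^ 2

/-- The power of `γ^{1/2}` in the action of `a_i(l)`. -/
def heisLevel (h : L) (l : ℤ) : L := if 0 < l then h ^ (3 * l) else h ^ (-l)

/-- The function by which a toral generator acts, with `r = a ^ 2`, `s = b ^ 2`. -/
def torFun (P : Type*) [Fintype P] (a b h : L) : Tor n → (P → ℕ) → L
  | Tor.om i => omVal P (a ^ 2) (b ^ 2) i
  | Tor.om' i => omVal P (b ^ 2) (a ^ 2) i
  | Tor.gam => fun _ => h
  | Tor.gam' => fun _ => h
  | Tor.d => 1
  | Tor.d' => 1

/-- The scaling of the loop parameter by a toral generator. -/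
def torScale (a b : L) : Tor n → L
  | Tor.d => a ^ 2
  | Tor.d' => b ^ 2
  | _ => 1

/-- The action of `x_i^±(k)` in degree zero of the loop parameter. -/
def xSum (z : P → L) (a b h : L) (e : PM) (i : ℕ) (k : ℤ) : Module.End L ((P → ℕ) → L) :=
  ∑ p, (level h e * spec z a b i p) ^ k • siteOp z a b e i p

/-- The action of the generators of the Drinfeld realization on functions on
`ℤ × (configurations of sites)`, at level `γ = γ' = h ^ 2`. It is a Drinfeld tensor product of loop
vector representations, one for each site. -/
def genOp (z : P → L) (a b h : L) : Gen n → Module.End L (ℤ → (P → ℕ) → L)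
  | Gen.x e i k => lift (xSum z a b h e i k) k
  | Gen.a i l _ => lift (Algebra.lmul L ((P → ℕ) → L) (heisLevel h l • bVal z a b i l)) l
  | Gen.tor t e => torus (torFun P a b h t ^ e.sgn) (torScale a b t ^ e.sgn)

end Representation

section Representation

variable {K L P : Type*} [Field K] [Field L] [Algebra K L] [Fintype P] [DecidableEq P] {n : ℕ}

omit [Algebra K L] in
theorem map_pairing {m : ℕ} (φ : K →+* L) (r s : K) (i j : Fin m) :
    φ (pairing r s i j) = pairing (φ r) (φ s) i j := by
  simp [pairing]

theorem pairing_ne_zero {m : ℕ} {r s : K} (hr : r ≠ 0) (hs : s ≠ 0) (i j : Fin m) :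
    pairing r s i j ≠ 0 :=
  mul_ne_zero (zpow_ne_zero _ hr) (zpow_ne_zero _ hs)

section Operators

variable {z : P → L} {a b h : L}

theorem torFun_ne_zero (ha : a ≠ 0) (hb : b ≠ 0) (hh : h ≠ 0) (t : Tor n) (m : P → ℕ) :
    torFun P a b h t m ≠ 0 := by
  have ha2 : a ^ 2 ≠ 0 := pow_ne_zero 2 ha
  have hb2 : b ^ 2 ≠ 0 := pow_ne_zero 2 hb
  cases t with
  | om i => exact Finset.prod_ne_zero_iff.mpr fun p _ => stateVal_ne_zero ha2 hb2 i (m p)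
  | om' i => exact Finset.prod_ne_zero_iff.mpr fun p _ => stateVal_ne_zero hb2 ha2 i (m p)
  | gam => exact hh
  | gam' => exact hh
  | d => exact one_ne_zero
  | d' => exact one_ne_zero

theorem torScale_ne_zero (ha : a ≠ 0) (hb : b ≠ 0) (t : Tor n) : torScale a b t ≠ 0 := by
  cases t <;> simp [torScale, ha, hb]

theorem torus_inv {S : Type*} {g : S → L} {c : L} (hg : ∀ m, g m ≠ 0) (hc : c ≠ 0) :
    torus g c * torus g⁻¹ c⁻¹ = 1 := by
  have e : g * g⁻¹ = 1 := funext fun m => mul_inv_cancel₀ (hg m)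
  rw [torus_mul, e, mul_inv_cancel₀ hc, torus_one]

theorem torus_conj {S : Type*} {g : S → L} {c y : L} (hg : ∀ m, g m ≠ 0) (hc : c ≠ 0)
    {X : Module.End L (ℤ → S → L)} (hX : torus g c * X = y • (X * torus g c)) :
    torus g c * X * torus g⁻¹ c⁻¹ = y • X := by
  rw [hX, smul_mul_assoc, mul_assoc, torus_inv hg hc, mul_one]

theorem omVal_xSum {m : ℕ} {r s : L} (hr : r ≠ 0) (hs : s ≠ 0) (i j : Fin m) (e : PM) (k : ℤ)
    {c : L} (hc0 : c ≠ 0) (hc : stateVal r s i j = c * stateVal r s i (j + 1)) :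
    Algebra.lmul L ((P → ℕ) → L) (omVal P r s i) * xSum z a b h e j k
      = c ^ e.sgn • (xSum z a b h e j k * Algebra.lmul L ((P → ℕ) → L) (omVal P r s i)) := by
  simp only [xSum, Finset.mul_sum, Finset.sum_mul, Finset.smul_sum]
  refine Finset.sum_congr rfl fun p _ => ?_
  rw [mul_smul_comm, omVal_siteOp hr hs i j e p hc0 hc, smul_mul_assoc, smul_comm]

theorem heisLevel_eq (hh : h ≠ 0) (e : PM) {l : ℤ} (hl : l ≠ 0) :
    (h ^ 2) ^ l.natAbs * h ^ (e.sgn * l) * level h e ^ l = heisLevel h l := by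
  have e1 : (h ^ 2) ^ l.natAbs = h ^ (2 * |l|) := by
    rw [Int.abs_eq_natAbs, zpow_mul, zpow_natCast, show h ^ (2 : ℤ) = h ^ 2 from zpow_natCast h 2]
  have e2 : level h e ^ l = h ^ ((1 - e.sgn) * l) := by
    cases e with
    | pos => simp [level, PM.sgn]
    | neg => 
      simp only [level, PM.sgn]
      rw [zpow_mul, show (1 - -1 : ℤ) = (2 : ℕ) from rfl, zpow_natCast]
  rw [e1, e2, ← zpow_add₀ hh, ← zpow_add₀ hh, heisLevel]
  split_ifs with hl'
  · rw [abs_of_pos hl']; congr 1; ring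
  · rw [abs_of_neg (by omega)]; congr 1; ring

theorem bVal_xSum {m : ℕ} (ha : a ≠ 0) (hb : b ≠ 0) (hh : h ≠ 0) (hz0 : ∀ p, z p ≠ 0) (i j : Fin m)
    {l : ℤ} (hl : l ≠ 0) (e : PM) (k : ℤ) :
    Algebra.lmul L ((P → ℕ) → L) (heisLevel h l • bVal z a b i l) * xSum z a b h e j k
      - xSum z a b h e j k * Algebra.lmul L ((P → ℕ) → L) (heisLevel h l • bVal z a b i l) =
    (e.sgn * ((h ^ 2) ^ l.natAbs * (pairing a b i i ^ (l * CartanMatrix.A m i j)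
      - pairing a b i i ^ (-(l * CartanMatrix.A m i j)))) / (l * (a ^ 2 - b ^ 2))
        * h ^ (e.sgn * l)) • xSum z a b h e j (l + k) := by
  simp only [xSum, Finset.mul_sum, Finset.sum_mul, Finset.smul_sum, ← Finset.sum_sub_distrib,
    map_smul]
  refine Finset.sum_congr rfl fun p _ => ?_
  have hsp : level h e * spec z a b j p ≠ 0 := by
    refine mul_ne_zero ?_ (mul_ne_zero (pow_ne_zero _ (div_ne_zero ha hb)) (hz0 p))
    cases e <;> simp [level, hh]
  have key := congrArg (fun y => (heisLevel h l * (level h e * spec z a b j p) ^ k) • y)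
    (bVal_siteOp (z := z) ha hb i j l e p)
  simp only [smul_sub, smul_smul] at key
  simp only [smul_mul_assoc, mul_smul_comm, smul_smul]
  rw [mul_comm ((level h e * spec z a b j p) ^ k) (heisLevel h l), key, zpow_add₀ hsp]
  congr 1
  rw [← heisLevel_eq hh e hl, mul_zpow, mul_zpow]
  ring

theorem xSum_quadratic {m : ℕ} (hz : Function.Injective z) (hz0 : ∀ p, z p ≠ 0) (ha : a ≠ 0)
    (hb : b ≠ 0) (hh : h ≠ 0) (e : PM) (i j : Fin m) (k k' : ℤ) :
    xSum z a b h e i (k + 1) * xSum z a b h e j k'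
      - pairing (a ^ 2) (b ^ 2) j i ^ e.sgn • (xSum z a b h e j k' * xSum z a b h e i (k + 1)) =
    -((pairing a b j i * (pairing a b i j)⁻¹) ^ e.sgn •
      (xSum z a b h e j (k' + 1) * xSum z a b h e i k
        - pairing (a ^ 2) (b ^ 2) i j ^ e.sgn •
          (xSum z a b h e i k * xSum z a b h e j (k' + 1)))) := by
  have hlev : level h e ≠ 0 := by cases e <;> simp [level, hh]
  have hsp : ∀ (i : Fin m) (p : P), level h e * spec z a b i p ≠ 0 := fun i p =>
    mul_ne_zero hlev (mul_ne_zero (pow_ne_zero _ (div_ne_zero ha hb)) (hz0 p))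
  refine sum_quadratic (hsp i) (hsp j) (fun p o => ?_) k k'
  have key : spec z a b i p • (siteOp z a b e i p * siteOp z a b e j o)
      - (pairing (a ^ 2) (b ^ 2) j i ^ e.sgn * spec z a b i p) •
        (siteOp z a b e j o * siteOp z a b e i p)
    = -((pairing a b j i * (pairing a b i j)⁻¹) ^ e.sgn •
        (spec z a b j o • (siteOp z a b e j o * siteOp z a b e i p)
          - (pairing (a ^ 2) (b ^ 2) i j ^ e.sgn * spec z a b j o) •
            (siteOp z a b e i p * siteOp z a b e j o))) := by
    cases e with
    | pos => simpa only [PM.sgn, zpow_one] using siteOp_quadratic_pos hz ha hb i j p o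
    | neg =>
      simpa only [PM.sgn, zpow_neg, zpow_one] using siteOp_quadratic_neg hz ha hb i j p o
  have := congrArg (fun y => level h e • y) key
  simp only [smul_sub, smul_neg, smul_smul] at this ⊢
  linear_combination (norm := module) this

theorem xSum_comm (e : PM) {i j : ℕ} (hij : i + 2 ≤ j ∨ j + 2 ≤ i) (k k' : ℤ) :
    xSum z a b h e i k * xSum z a b h e j k' = xSum z a b h e j k' * xSum z a b h e i k := by
  simp only [xSum, Finset.mul_sum, Finset.sum_mul]
  rw [Finset.sum_comm]
  refine Finset.sum_congr rfl fun p _ => Finset.sum_congr rfl fun o _ => ?_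
  simp only [smul_mul_assoc, mul_smul_comm]
  rw [siteOp_comm e hij, smul_comm]

/-- In the commutator of `x_i^+(k)` and `x_j^-(k')` only the terms with `i = j` in which the same
site moves forth and back survive. -/
theorem xSum_pos_neg (hz : Function.Injective z) (hab : a ^ 2 - b ^ 2 ≠ 0)
    (ha : a ≠ 0) (hb : b ≠ 0) (hz0 : ∀ p, z p ≠ 0) (i j : ℕ) (k k' : ℤ) :
    xSum z a b h PM.pos i k * xSum z a b h PM.neg j k'
      - xSum z a b h PM.neg j k' * xSum z a b h PM.pos i k =
    if i = j then ((a ^ 2 - b ^ 2)⁻¹ * (h ^ 2) ^ k') • Algebra.lmul L ((P → ℕ) → L) (fun m =>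
      ∑ p, (stateVal (a ^ 2) (b ^ 2) i (m p) - stateVal (b ^ 2) (a ^ 2) i (m p)) *
        resid Finset.univ (fun o => stateVal (a ^ 2) (b ^ 2) i (m o))
          (fun o => stateVal (b ^ 2) (a ^ 2) i (m o)) (spec z a b i) p * spec z a b i p ^ (k + k'))
    else 0 := by
  have e1 : xSum z a b h PM.pos i k * xSum z a b h PM.neg j k'
      - xSum z a b h PM.neg j k' * xSum z a b h PM.pos i k =
      ∑ p, ∑ o, (spec z a b i p ^ k * (h ^ 2 * spec z a b j o) ^ k') •
        (siteOp z a b PM.pos i p * siteOp z a b PM.neg j o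
          - siteOp z a b PM.neg j o * siteOp z a b PM.pos i p) := by
    simp only [xSum, Finset.sum_mul_sum, level, one_mul]
    rw [Finset.sum_comm (s := Finset.univ) (t := Finset.univ)
      (f := fun o p => ((h ^ 2 * spec z a b j o) ^ k' • siteOp z a b PM.neg j o) *
        (spec z a b i p ^ k • siteOp z a b PM.pos i p))]
    simp only [← Finset.sum_sub_distrib]
    refine Finset.sum_congr rfl fun p _ => Finset.sum_congr rfl fun o _ => ?_
    simp only [smul_mul_assoc, mul_smul_comm, smul_smul, smul_sub, mul_comm]
  rw [e1]
  split_ifs with hij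
  · subst hij
    have e2 : ∀ p : P, ∑ o, (spec z a b i p ^ k * (h ^ 2 * spec z a b i o) ^ k') •
        (siteOp z a b PM.pos i p * siteOp z a b PM.neg i o
          - siteOp z a b PM.neg i o * siteOp z a b PM.pos i p) =
        (spec z a b i p ^ k * (h ^ 2 * spec z a b i p) ^ k') •
        (siteOp z a b PM.pos i p * siteOp z a b PM.neg i p
          - siteOp z a b PM.neg i p * siteOp z a b PM.pos i p) := by
      intro p
      refine Finset.sum_eq_single p (fun o _ ho => ?_) (by simp)
      rw [siteOp_pos_neg_comm (Or.inr ho.symm), sub_self, smul_zero]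
    simp only [e2, siteOp_commutator_self hz hab]
    ext f m
    simp only [LinearMap.sum_apply, LinearMap.smul_apply, Finset.sum_apply, Pi.smul_apply,
      lmul_apply, Pi.mul_apply, smul_eq_mul, Finset.sum_mul, Finset.mul_sum]
    refine Finset.sum_congr rfl fun p _ => ?_
    have hq : (a / b) ^ i ≠ 0 := pow_ne_zero _ (div_ne_zero ha hb)
    have hs : spec z a b i p ≠ 0 := mul_ne_zero hq (hz0 p)
    have hres := resid_smul Finset.univ (fun o => stateVal (a ^ 2) (b ^ 2) i (m o))
          (fun o => stateVal (b ^ 2) (a ^ 2) i (m o)) z hq p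
    change resid _ _ _ (spec z a b i) p = _ at hres
    rw [← hres, zpow_add₀ hs, mul_zpow]
    ring
  · refine Finset.sum_eq_zero fun p _ => Finset.sum_eq_zero fun o _ => ?_
    rw [siteOp_pos_neg_comm (Or.inl hij), sub_self, smul_zero]

end Operators

end Representation

section Representation

variable {K L P : Type*} [Field K] [Field L] [Algebra K L] [Fintype P] [DecidableEq P] {n : ℕ}
  (z : P → L) (rh sh : K) (h : L)

/-- The action of the free algebra on the generators of the Drinfeld realization. -/
def freeRep : FreeGen K n →ₐ[K] Module.End L (ℤ → (P → ℕ) → L) :=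
  FreeAlgebra.lift K (genOp z (algebraMap K L rh) (algebraMap K L sh) h)

theorem freeRep_x (e : PM) (i : Fin (n - 1)) (k : ℤ) :
    freeRep z rh sh h (fx K e i k)
      = lift (xSum z (algebraMap K L rh) (algebraMap K L sh) h e i k) k :=
  FreeAlgebra.lift_ι_apply _ _

theorem freeRep_a (i : Fin (n - 1)) (l : ℤ) :
    freeRep z rh sh h (fa K i l)
      = lift (Algebra.lmul L ((P → ℕ) → L)
          (heisLevel h l • bVal z (algebraMap K L rh) (algebraMap K L sh) i l)) l := by
  unfold fa
  split_ifs with hl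
  · exact FreeAlgebra.lift_ι_apply _ _
  · have hl : l = 0 := by omega
    subst hl
    ext f d m
    simp [lift_apply, bVal, bSite]

theorem freeRep_t (t : Tor n) (e : PM) :
    freeRep z rh sh h (ft K t e)
      = torus (torFun P (algebraMap K L rh) (algebraMap K L sh) h t ^ e.sgn)
          (torScale (algebraMap K L rh) (algebraMap K L sh) t ^ e.sgn) :=
  FreeAlgebra.lift_ι_apply _ _

theorem torus_const_zpow (e : PM) :
    torus ((fun _ : P → ℕ => h) ^ e.sgn) ((1 : L) ^ e.sgn) = h ^ e.sgn • 1 := by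
  rw [one_zpow, ← torus_const]
  rfl

theorem freeRep_tpow {t : Tor n} (ht : t = Tor.gam ∨ t = Tor.gam') (k : ℤ) :
    freeRep z rh sh h (tpow K t k)
      = (h ^ k • 1 : Module.End L (ℤ → (P → ℕ) → L)) := by
  have e1 : ∀ e : PM, freeRep z rh sh h (ft K t e)
      = (h ^ e.sgn • 1 : Module.End L (ℤ → (P → ℕ) → L)) := by
    intro e
    rw [freeRep_t]
    rcases ht with rfl | rfl <;> exact torus_const_zpow h e
  unfold tpow
  split_ifs with hk
  · obtain ⟨k, rfl⟩ := Int.eq_ofNat_of_zero_le hk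
    rw [map_pow, e1, smul_pow, one_pow]
    simp [PM.sgn]
  · obtain ⟨k', hk'⟩ := Int.eq_ofNat_of_zero_le (show 0 ≤ -k by omega)
    obtain rfl : k = -k' := by omega
    rw [map_pow, e1, smul_pow, one_pow]
    simp [PM.sgn]

theorem map_expCoeff {A B : Type*} [Ring A] [Algebra K A] [Ring B] [Algebra K B] (f : A →ₐ[K] B)
    (c : K) (b : ℕ → A) (m : ℕ) : f (expCoeff K c b m) = expCoeff K c (fun l => f (b l)) m := by
  simp only [expCoeff, map_sum, map_smul, map_list_prod, List.map_map]
  rfl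

variable {z rh sh h}

theorem spec_injective {a b : L} (hz : Function.Injective z) (ha : a ≠ 0) (hb : b ≠ 0) (i : ℕ) :
    Function.Injective (spec z a b i) := fun _ _ hpo =>
  hz (mul_left_cancel₀ (pow_ne_zero _ (div_ne_zero ha hb)) hpo)

theorem spec_ne_zero {a b : L} (hz0 : ∀ p, z p ≠ 0) (ha : a ≠ 0) (hb : b ≠ 0) (i : ℕ) (p : P) :
    spec z a b i p ≠ 0 :=
  mul_ne_zero (pow_ne_zero _ (div_ne_zero ha hb)) (hz0 p)

/-- The eigenvalue of `ω_i(M)`: a coefficient of the expansion at infinity of the rational function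
`∏ (α_p z - β_p w_p) / (z - w_p)`, up to a power of `γ^{1/2}`. -/
theorem freeRep_omSeries [CharZero L] (hz : Function.Injective z) (hz0 : ∀ p, z p ≠ 0)
    (hr : rh ≠ 0) (hs : sh ≠ 0) (hrs : rh ^ 2 - sh ^ 2 ≠ 0) (i : Fin (n - 1)) (M : ℤ) :
    freeRep z rh sh h (omSeries K (rh ^ 2) (sh ^ 2) i M) =
      lift (Algebra.lmul L ((P → ℕ) → L) fun m =>
        let α := fun o => stateVal (algebraMap K L rh ^ 2) (algebraMap K L sh ^ 2) i (m o)
        let β := fun o => stateVal (algebraMap K L sh ^ 2) (algebraMap K L rh ^ 2) i (m o)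
        let w := spec z (algebraMap K L rh) (algebraMap K L sh) i
        if M < 0 then 0 else h ^ (3 * M) * (if M = 0 then ∏ p, α p else
          ∑ p, (α p - β p) * resid Finset.univ α β w p * w p ^ M)) M := by
  have ha : algebraMap K L rh ≠ 0 := by simpa using hr
  have hb : algebraMap K L sh ≠ 0 := by simpa using hs
  have hab : algebraMap K L rh ^ 2 - algebraMap K L sh ^ 2 ≠ 0 := by
    rw [← map_pow, ← map_pow, ← map_sub]; exact (map_ne_zero _).mpr hrs
  unfold omSeries
  by_cases hM : 0 ≤ M
  · rw [if_pos hM]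
    obtain ⟨M, rfl⟩ := Int.eq_ofNat_of_zero_le hM
    rw [map_mul, map_expCoeff]
    simp only [freeRep_a, Int.toNat_natCast]
    have e1 := expCoeff_lift (S := P → ℕ) (L := L) (rh ^ 2 - sh ^ 2) 1 (fun l : ℕ => heisLevel h l •
      bVal z (algebraMap K L rh) (algebraMap K L sh) i l) M
    simp only [one_mul] at e1
    rw [e1, freeRep_t]
    have e2 : torus (torFun P (algebraMap K L rh) (algebraMap K L sh) h (Tor.om i) ^ PM.pos.sgn)
          (torScale (algebraMap K L rh) (algebraMap K L sh) (Tor.om i) ^ PM.pos.sgn)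
        = lift (Algebra.lmul L ((P → ℕ) → L)
            (omVal P (algebraMap K L rh ^ 2) (algebraMap K L sh ^ 2) i)) 0 := by
      rw [← lift_lmul_zero]
      simp [torFun, torScale, PM.sgn]
    rw [e2, lift_mul, zero_add, ← map_mul]
    congr 2
    funext m
    have hn : ¬ (M : ℤ) < 0 := by omega
    simp only [if_neg hn, Pi.mul_apply, Pi.smul_apply, smul_eq_mul]
    have e3 : ∀ l : ℕ, heisLevel h (l : ℤ) = (h ^ 3) ^ l := by
      intro l
      rcases Nat.eq_zero_or_pos l with rfl | hl
      · simp [heisLevel]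
      · rw [heisLevel, if_pos (by omega), zpow_mul, zpow_natCast]
        congr 1
        exact zpow_natCast h 3
    have e4 : h ^ (3 * (M : ℤ)) = (h ^ 3) ^ M := by
      rw [zpow_mul, zpow_natCast]
      congr 1
      exact zpow_natCast h 3
    simp only [e3]
    rw [expCoeff_scale, e4, mul_left_comm]
    congr 1
    rw [omVal, prod_mul_expCoeff (fun p => stateVal (algebraMap K L rh ^ 2)
      (algebraMap K L sh ^ 2) i (m p)) (fun p => stateVal (algebraMap K L sh ^ 2)
      (algebraMap K L rh ^ 2) i (m p)) (spec z (algebraMap K L rh) (algebraMap K L sh) i)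
      (fun p => stateVal_ne_zero (pow_ne_zero 2 ha) (pow_ne_zero 2 hb) _ _)
      (spec_ne_zero hz0 ha hb i) (spec_injective hz ha hb i)]
    · simp only [Nat.cast_eq_zero, zpow_natCast]
    · intro l hl
      have hl' : (l : L) ≠ 0 := by exact_mod_cast hl.ne'
      simp only [bVal, bSite, map_sub, map_pow, Finset.mul_sum, zpow_natCast, Int.cast_natCast]
      refine Finset.sum_congr rfl fun p _ => ?_
      field_simp
  · rw [if_neg hM]
    have hM' : M < 0 := by omega
    simp only [if_pos hM', map_zero]
    ext f d m
    simp [lift_apply]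

/-- The eigenvalue of `ω'_i(M)`: a coefficient of the expansion at zero of the same rational
function. -/
theorem freeRep_omSeries' [CharZero L] (hz : Function.Injective z) (hz0 : ∀ p, z p ≠ 0)
    (hr : rh ≠ 0) (hs : sh ≠ 0) (hrs : rh ^ 2 - sh ^ 2 ≠ 0) (i : Fin (n - 1)) (M : ℤ) :
    freeRep z rh sh h (omSeries' K (rh ^ 2) (sh ^ 2) i M) =
      lift (Algebra.lmul L ((P → ℕ) → L) fun m =>
        let α := fun o => stateVal (algebraMap K L rh ^ 2) (algebraMap K L sh ^ 2) i (m o)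
        let β := fun o => stateVal (algebraMap K L sh ^ 2) (algebraMap K L rh ^ 2) i (m o)
        let w := spec z (algebraMap K L rh) (algebraMap K L sh) i
        if 0 < M then 0 else h ^ (-M) * (if M = 0 then ∏ p, β p else
          -∑ p, (α p - β p) * resid Finset.univ α β w p * w p ^ M)) M := by
  have ha : algebraMap K L rh ≠ 0 := by simpa using hr
  have hb : algebraMap K L sh ≠ 0 := by simpa using hs
  have hab : algebraMap K L rh ^ 2 - algebraMap K L sh ^ 2 ≠ 0 := by
    rw [← map_pow, ← map_pow, ← map_sub]; exact (map_ne_zero _).mpr hrs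
  unfold omSeries'
  by_cases hM : M ≤ 0
  · rw [if_pos hM]
    obtain ⟨N, hN⟩ := Int.eq_ofNat_of_zero_le (show 0 ≤ -M by omega)
    obtain rfl : M = -N := by omega
    rw [map_mul, map_expCoeff]
    simp only [freeRep_a, neg_neg, Int.toNat_natCast]
    have e1 := expCoeff_lift (S := P → ℕ) (L := L) (-(rh ^ 2 - sh ^ 2)) (-1)
      (fun l : ℕ => heisLevel h (-l) •
        bVal z (algebraMap K L rh) (algebraMap K L sh) i (-l)) N
    simp only [neg_one_mul] at e1
    rw [e1, freeRep_t]
    have e2 : torus (torFun P (algebraMap K L rh) (algebraMap K L sh) h (Tor.om' i) ^ PM.pos.sgn)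
          (torScale (algebraMap K L rh) (algebraMap K L sh) (Tor.om' i) ^ PM.pos.sgn)
        = lift (Algebra.lmul L ((P → ℕ) → L)
            (omVal P (algebraMap K L sh ^ 2) (algebraMap K L rh ^ 2) i)) 0 := by
      rw [← lift_lmul_zero]
      simp [torFun, torScale, PM.sgn]
    rw [e2, lift_mul, zero_add, ← map_mul]
    congr 2
    funext m
    have hn : ¬ 0 < -(N : ℤ) := by omega
    simp only [if_neg hn, Pi.mul_apply, Pi.smul_apply, smul_eq_mul]
    have e3 : ∀ l : ℕ, heisLevel h (-(l : ℤ)) = h ^ l := by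
      intro l
      rw [heisLevel, if_neg (by omega), neg_neg, zpow_natCast]
    simp only [e3]
    rw [expCoeff_scale, zpow_natCast, mul_left_comm]
    congr 1
    rw [omVal, prod_mul_expCoeff (fun p => stateVal (algebraMap K L sh ^ 2)
      (algebraMap K L rh ^ 2) i (m p)) (fun p => stateVal (algebraMap K L rh ^ 2)
      (algebraMap K L sh ^ 2) i (m p))
      (fun p => (spec z (algebraMap K L rh) (algebraMap K L sh) i p)⁻¹)
      (fun p => stateVal_ne_zero (pow_ne_zero 2 hb) (pow_ne_zero 2 ha) _ _)
      (fun p => inv_ne_zero (spec_ne_zero hz0 ha hb i p))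
      (inv_injective.comp (spec_injective hz ha hb i))]
    · simp only [neg_eq_zero, Nat.cast_eq_zero, zpow_neg, zpow_natCast, ← Finset.sum_neg_distrib]
      split_ifs
      · rfl
      · refine Finset.sum_congr rfl fun p _ => ?_
        rw [resid_inv _ _ _ _ (spec_ne_zero hz0 ha hb i), inv_pow]
        ring
    · intro l hl
      have hl' : (l : L) ≠ 0 := by exact_mod_cast hl.ne'
      simp only [bVal, bSite, map_sub, map_pow, map_neg, Finset.mul_sum, zpow_neg, zpow_natCast,
        Int.cast_neg, Int.cast_natCast, ← inv_pow, inv_div]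
      refine Finset.sum_congr rfl fun p _ => ?_
      field_simp
  · rw [if_neg hM]
    have hM' : 0 < M := by omega
    simp only [if_pos hM', map_zero]
    ext f d m
    simp [lift_apply]

end Representation

section Representation

variable {K L P : Type*} [Field K] [Field L] [Algebra K L] [Fintype P] [DecidableEq P] {n : ℕ}
  {z : P → L} {rh sh : K} {h : L}

theorem lift_comp_commutator {S : Type*} (T U : Module.End L (S → L)) (k l : ℤ) :
    lift T k * lift U l - lift U l * lift T k = lift (T * U - U * T) (k + l) := by
  rw [lift_mul, lift_mul, add_comm l k, lift_sub]

theorem freeRep_smul (c : K) (X : FreeGen K n) :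
    freeRep z rh sh h (c • X) = algebraMap K L c • freeRep z rh sh h X := by
  rw [map_smul, algebraMap_smul]

theorem xSum_serre (hz : Function.Injective z) {a b : L} (ha : a ≠ 0) (hb : b ≠ 0) (e : PM)
    {i j : ℕ} {f : ℤ} (hf : i + 1 = j ∧ f = e.sgn ∨ j + 1 = i ∧ f = -e.sgn) (m₁ m₂ k : ℤ) :
    (xSum z a b h e i m₁ * xSum z a b h e i m₂ * xSum z a b h e j k
      - ((a ^ 2) ^ f + (b ^ 2) ^ f) •
        (xSum z a b h e i m₁ * xSum z a b h e j k * xSum z a b h e i m₂)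
      + (a ^ 2 * b ^ 2) ^ f •
        (xSum z a b h e j k * xSum z a b h e i m₁ * xSum z a b h e i m₂))
    + (xSum z a b h e i m₂ * xSum z a b h e i m₁ * xSum z a b h e j k
      - ((a ^ 2) ^ f + (b ^ 2) ^ f) •
        (xSum z a b h e i m₂ * xSum z a b h e j k * xSum z a b h e i m₁)
      + (a ^ 2 * b ^ 2) ^ f •
        (xSum z a b h e j k * xSum z a b h e i m₂ * xSum z a b h e i m₁)) = 0 := by
  refine sum_serre (fun p₁ p₂ o => ?_) m₁ m₂ k
  rcases hf with ⟨hij, rfl⟩ | ⟨hij, rfl⟩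
  · exact siteOp_serre_lt hz ha hb e hij p₁ p₂ o
  · exact siteOp_serre_gt hz ha hb e hij p₁ p₂ o

theorem freeRep_serreTerm (e : PM) (f : ℤ) (i j : Fin (n - 1)) (m₁ m₂ k : ℤ) :
    freeRep z rh sh h (serreTerm K (rh ^ 2) (sh ^ 2) e f i j m₁ m₂ k) =
      let a := algebraMap K L rh
      let b := algebraMap K L sh
      lift (xSum z a b h e i m₁ * xSum z a b h e i m₂ * xSum z a b h e j k
      - ((a ^ 2) ^ f + (b ^ 2) ^ f) •
        (xSum z a b h e i m₁ * xSum z a b h e j k * xSum z a b h e i m₂)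
      + (a ^ 2 * b ^ 2) ^ f •
        (xSum z a b h e j k * xSum z a b h e i m₁ * xSum z a b h e i m₂)) (m₁ + m₂ + k) := by
  simp only [serreTerm, map_add, map_sub, freeRep_smul, map_mul, freeRep_x, lift_mul,
    map_zpow₀, map_pow, lift_add, lift_sub, lift_smul]
  rw [add_right_comm m₁ k m₂, show k + m₁ + m₂ = m₁ + m₂ + k by ring]

theorem neighbours_of_cartan {m : ℕ} {i j : Fin m} (hA : CartanMatrix.A m i j = -1) :
    (i : ℕ) + 1 = j ∨ (j : ℕ) + 1 = i := by
  by_contra hn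
  rw [not_or] at hn
  by_cases hij : i = j
  · simp [CartanMatrix.A, hij] at hA
  · simp [CartanMatrix.A, hij, hn.1, hn.2] at hA

theorem far_of_cartan {m : ℕ} {i j : Fin m} (hA : CartanMatrix.A m i j = 0) :
    (i : ℕ) + 2 ≤ j ∨ (j : ℕ) + 2 ≤ i := by
  by_cases hij : i = j
  · simp [CartanMatrix.A, hij] at hA
  · have h1 : (i : ℕ) ≠ j := fun h => hij (Fin.ext h)
    by_cases hn : (i : ℕ) + 1 = j ∨ (j : ℕ) + 1 = i
    · simp [CartanMatrix.A, hij, hn] at hA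
    · omega

/-- The representation respects the commutator relation between `x_i^+(k)` and `x_j^-(k')`: this is
the comparison of the expansions of a rational function at its poles, at zero and at infinity. -/
theorem freeRep_pos_neg [CharZero L] (hz : Function.Injective z) (hz0 : ∀ p, z p ≠ 0)
    (hr : rh ≠ 0) (hs : sh ≠ 0) (hrs : rh ^ 2 - sh ^ 2 ≠ 0) (hh : h ≠ 0) (i : Fin (n - 1))
    (k k' : ℤ) :
    lift (xSum z (algebraMap K L rh) (algebraMap K L sh) h PM.pos i k
        * xSum z (algebraMap K L rh) (algebraMap K L sh) h PM.neg i k'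
      - xSum z (algebraMap K L rh) (algebraMap K L sh) h PM.neg i k'
        * xSum z (algebraMap K L rh) (algebraMap K L sh) h PM.pos i k) (k + k') =
    (algebraMap K L rh ^ 2 - algebraMap K L sh ^ 2)⁻¹ •
      ((h ^ (-2 * k) * h ^ (-(k + k'))) •
          freeRep z rh sh h (omSeries K (rh ^ 2) (sh ^ 2) i (k + k'))
        - (h ^ (2 * k') * h ^ (k + k')) •
          freeRep z rh sh h (omSeries' K (rh ^ 2) (sh ^ 2) i (k + k'))) := by
  have ha : algebraMap K L rh ≠ 0 := (map_ne_zero _).mpr hr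
  have hb : algebraMap K L sh ≠ 0 := (map_ne_zero _).mpr hs
  have hab : algebraMap K L rh ^ 2 - algebraMap K L sh ^ 2 ≠ 0 := by
    rw [← map_pow, ← map_pow, ← map_sub]; exact (map_ne_zero _).mpr hrs
  rw [xSum_pos_neg hz hab ha hb hz0, if_pos rfl, freeRep_omSeries hz hz0 hr hs hrs,
    freeRep_omSeries' hz hz0 hr hs hrs]
  have h2 : (h ^ 2) ^ k' = h ^ (2 * k') := by
    rw [zpow_mul]; congr 1; exact (zpow_natCast h 2).symm
  rw [h2]
  ext f d m
  simp only [lift_apply, LinearMap.smul_apply, LinearMap.sub_apply, Pi.smul_apply, Pi.sub_apply,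
    lmul_apply, Pi.mul_apply, smul_eq_mul]
  -- For `k + k' > 0` only `ω_i(k + k')` contributes, for `k + k' < 0` only `ω'_i(k + k')`; for
  -- `k + k' = 0` both do, and the residue theorem is needed.
  rcases lt_trichotomy (k + k') 0 with hM | hM | hM
  · have e1 : ¬ 0 < k + k' := by omega
    rw [if_pos hM, if_neg e1, if_neg hM.ne]
    have e2 : h ^ (k + k') * h ^ (-(k + k')) = 1 := by
      rw [← zpow_add₀ hh, add_neg_cancel, zpow_zero]
    linear_combination (-(algebraMap K L rh ^ 2 - algebraMap K L sh ^ 2)⁻¹ * h ^ (2 * k')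
      * (∑ p : P, _) * f (d - (k + k')) m) * e2
  · have e1 : ¬ 0 < k + k' := by omega
    have e2 : ¬ k + k' < 0 := by omega
    rw [if_neg e1, if_neg e2, if_pos hM, if_pos hM]
    simp only [hM, neg_zero, mul_zero, zpow_zero, mul_one, one_mul]
    rw [sum_resid Finset.univ _ _ _ (fun p _ => spec_ne_zero hz0 ha hb i p)
      (spec_injective hz ha hb i).injOn, show -2 * k = 2 * k' by omega]
    ring
  · have e1 : ¬ k + k' < 0 := by omega
    rw [if_pos hM, if_neg e1, if_neg hM.ne']
    have e2 : h ^ (-2 * k) * h ^ (-(k + k')) * h ^ (3 * (k + k')) = h ^ (2 * k') := by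
      rw [← zpow_add₀ hh, ← zpow_add₀ hh]; congr 1; ring
    rw [← e2]
    ring

/-- The operators `genOp` satisfy the defining relations of the Drinfeld realization. -/
theorem freeRep_rel [CharZero L] (hz : Function.Injective z) (hz0 : ∀ p, z p ≠ 0)
    (hr : rh ≠ 0) (hs : sh ≠ 0) (hrs : rh ^ 2 - sh ^ 2 ≠ 0)
    (hh : h ^ 2 = algebraMap K L (rh * sh)) {u v : FreeGen K n}
    (huv : DrinfeldRel K (rh ^ 2) (sh ^ 2) rh sh u v) :
    freeRep z rh sh h u = freeRep z rh sh h v := by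
  have ha : algebraMap K L rh ≠ 0 := (map_ne_zero _).mpr hr
  have hb : algebraMap K L sh ≠ 0 := (map_ne_zero _).mpr hs
  have ha2 : algebraMap K L rh ^ 2 ≠ 0 := pow_ne_zero 2 ha
  have hb2 : algebraMap K L sh ^ 2 ≠ 0 := pow_ne_zero 2 hb
  have hh0 : h ≠ 0 := by
    rintro rfl
    rw [zero_pow two_ne_zero] at hh
    exact (map_ne_zero (algebraMap K L)).mpr (mul_ne_zero hr hs) hh.symm
  have hinv : ∀ t : Tor n, freeRep z rh sh h (ft K t PM.pos) * freeRep z rh sh h (ft K t PM.neg)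
      = 1 := by
    intro t
    rw [freeRep_t, freeRep_t]
    simp only [PM.sgn, zpow_one, zpow_neg]
    exact torus_inv (torFun_ne_zero ha hb hh0 t) (torScale_ne_zero ha hb t)
  have htor : ∀ (t t' : Tor n) (e e' : PM),
      freeRep z rh sh h (ft K t e) * freeRep z rh sh h (ft K t' e')
        = freeRep z rh sh h (ft K t' e') * freeRep z rh sh h (ft K t e) := by
    intro t t' e e'
    simp only [freeRep_t, torus_mul, mul_comm]
  have hconj : ∀ (t : Tor n) (T : Module.End L ((P → ℕ) → L)) (k : ℤ) (y y' : L),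
      Algebra.lmul L ((P → ℕ) → L) (torFun P (algebraMap K L rh) (algebraMap K L sh) h t) * T
        = y • (T * Algebra.lmul L ((P → ℕ) → L)
          (torFun P (algebraMap K L rh) (algebraMap K L sh) h t)) →
      torScale (algebraMap K L rh) (algebraMap K L sh) t ^ k * y = y' →
      freeRep z rh sh h (ft K t PM.pos) * lift T k * freeRep z rh sh h (ft K t PM.neg)
        = y' • lift T k := by
    intro t T k y y' hT hy
    rw [freeRep_t, freeRep_t]
    simp only [PM.sgn, zpow_one, zpow_neg]
    refine torus_conj (torFun_ne_zero ha hb hh0 t) (torScale_ne_zero ha hb t) ?_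
    rw [torus_mul_lift (torScale_ne_zero ha hb t) hT, hy]
  have hone : ∀ T : Module.End L ((P → ℕ) → L), Algebra.lmul L ((P → ℕ) → L) 1 * T
      = (1 : L) • (T * Algebra.lmul L ((P → ℕ) → L) 1) := by
    intro T; rw [map_one, one_mul, mul_one, one_smul]
  have hlmul : ∀ f g : (P → ℕ) → L, Algebra.lmul L ((P → ℕ) → L) f * Algebra.lmul L ((P → ℕ) → L) g
      = Algebra.lmul L ((P → ℕ) → L) g * Algebra.lmul L ((P → ℕ) → L) f := by
    intro f g; rw [← map_mul, mul_comm, map_mul]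
  have haom : ∀ (t : Tor n) (e : PM) (i : Fin (n - 1)) (l : ℤ),
      torScale (algebraMap K L rh) (algebraMap K L sh) t = 1 →
      freeRep z rh sh h (fa K i l) * freeRep z rh sh h (ft K t e)
        = freeRep z rh sh h (ft K t e) * freeRep z rh sh h (fa K i l) := by
    intro t e i l ht
    rw [freeRep_a, freeRep_t, ht, one_zpow, lift_lmul_zero, lift_mul, lift_mul, hlmul, add_comm]
  have hgam : ∀ (t : Tor n), t = Tor.gam ∨ t = Tor.gam' → ∀ (e : PM) (X : FreeGen K n),
      freeRep z rh sh h (ft K t e) * freeRep z rh sh h X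
        = freeRep z rh sh h X * freeRep z rh sh h (ft K t e) := by
    intro t ht e X
    have : freeRep z rh sh h (ft K t e) = (h ^ e.sgn • 1 : Module.End L (ℤ → (P → ℕ) → L)) := by
      rw [freeRep_t]
      rcases ht with rfl | rfl <;> exact torus_const_zpow h e
    rw [this, smul_mul_assoc, mul_smul_comm, one_mul, mul_one]
  have hheis : ∀ (i j : Fin (n - 1)) (l : ℤ), algebraMap K L (heis K rh sh i j l)
      = (h ^ 2) ^ l.natAbs * (pairing (algebraMap K L rh) (algebraMap K L sh) i i
          ^ (l * CartanMatrix.A (n - 1) i j) - pairing (algebraMap K L rh) (algebraMap K L sh) i i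
          ^ (-(l * CartanMatrix.A (n - 1) i j))) := by
    intro i j l
    rw [heis, map_mul, map_pow, ← hh, map_sub, map_zpow₀, map_zpow₀, map_pairing]
  have hax : ∀ (t : Tor n), t = Tor.gam ∨ t = Tor.gam' → ∀ (e : PM) (i j : Fin (n - 1)) (l k : ℤ),
      l ≠ 0 → freeRep z rh sh h (fa K i l * fx K e j k - fx K e j k * fa K i l) =
      freeRep z rh sh h ((((e.sgn : K) * heis K rh sh i j l / ((l : K) * (rh ^ 2 - sh ^ 2))) •
          (tpow K t (e.sgn * l) * fx K e j (l + k)))) := by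
    intro t ht e i j l k hl
    rw [map_sub, map_mul, map_mul, freeRep_smul, map_mul, freeRep_a, freeRep_x, freeRep_x,
      freeRep_tpow z rh sh h ht, lift_comp_commutator, bVal_xSum ha hb hh0 hz0 i j hl e k,
      smul_mul_assoc, one_mul, smul_smul, lift_smul]
    congr 1
    simp only [map_div₀, map_mul, hheis, map_intCast, map_sub, map_pow]
  induction huv with
  | inv_right t => rw [map_mul, hinv, map_one]
  | inv_left t => rw [map_mul, htor, hinv, map_one]
  | tor_comm t t' e e' => rw [map_mul, map_mul, htor]
  | gam_central e g => rw [map_mul, map_mul, hgam _ (Or.inl rfl)]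
  | gam_central' e g => rw [map_mul, map_mul, hgam _ (Or.inr rfl)]
  | gam_gam' =>
    rw [map_mul, freeRep_tpow z rh sh h (Or.inl rfl), freeRep_tpow z rh sh h (Or.inr rfl),
      Algebra.algebraMap_eq_smul_one, freeRep_smul, map_one, smul_mul_assoc, one_mul, smul_smul,
      show h ^ (2 : ℤ) = h ^ 2 from zpow_natCast h 2, hh,
      ← map_mul]
    congr 2
    ring
  | a_a i j l l' hl hl' =>
    have e1 : freeRep z rh sh h (fa K i l * fa K j l' - fa K j l' * fa K i l) = 0 := by
      rw [map_sub, map_mul, map_mul, freeRep_a, freeRep_a, lift_comp_commutator, hlmul, sub_self,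
        lift_zero]
    rw [e1]
    split_ifs
    · rw [freeRep_smul, map_sub, freeRep_tpow z rh sh h (Or.inl rfl),
        freeRep_tpow z rh sh h (Or.inr rfl), sub_self, smul_zero]
    · rw [map_zero]
  | a_om i j l hl e => rw [map_mul, map_mul, haom _ _ _ _ rfl]
  | a_om' i j l hl e => rw [map_mul, map_mul, haom _ _ _ _ rfl]
  | d_x e i k =>
    rw [map_mul, map_mul, freeRep_smul, freeRep_x]
    exact hconj _ _ _ _ _ (hone _) (by simp [torScale])
  | d_x' e i k =>
    rw [map_mul, map_mul, freeRep_smul, freeRep_x]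
    exact hconj _ _ _ _ _ (hone _) (by simp [torScale])
  | d_a i l hl =>
    rw [map_mul, map_mul, freeRep_smul, freeRep_a]
    exact hconj _ _ _ _ _ (hone _) (by simp [torScale])
  | d_a' i l hl =>
    rw [map_mul, map_mul, freeRep_smul, freeRep_a]
    exact hconj _ _ _ _ _ (hone _) (by simp [torScale])
  | om_x e i j k =>
    rw [map_mul, map_mul, freeRep_smul, freeRep_x]
    refine hconj _ _ _ _ _ (omVal_xSum ha2 hb2 i j e k (pairing_ne_zero ha2 hb2 j i)
      (stateVal_ratio ha2 hb2 i j)) ?_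
    simp [torScale, map_zpow₀, map_pairing]
  | om_x' e i j k =>
    rw [map_mul, map_mul, freeRep_smul, freeRep_x]
    refine hconj _ _ _ _ _ (omVal_xSum hb2 ha2 i j e k
      (inv_ne_zero (pairing_ne_zero ha2 hb2 i j)) (stateVal_ratio' ha2 hb2 i j)) ?_
    simp [torScale, map_zpow₀, map_pairing]
  | a_x_neg e i j l k hl => exact hax _ (Or.inl rfl) e i j l k hl.ne
  | a_x_pos e i j l k hl => exact hax _ (Or.inr rfl) e i j l k hl.ne'
  | x_x e i j k k' =>
    have key := congrArg (fun T => lift T (k + 1 + k'))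
      (xSum_quadratic (h := h) hz hz0 ha hb hh0 e i j k k')
    simp only [lift_sub, lift_neg, lift_smul] at key
    simp only [map_sub, map_neg, freeRep_smul, map_mul, freeRep_x, lift_mul,
      map_zpow₀, map_inv₀, map_pairing, map_pow]
    rw [add_comm k' (k + 1), show k' + 1 + k = k + 1 + k' by ring,
      show k + (k' + 1) = k + 1 + k' by ring]
    exact key
  | x_y i j k k' =>
    rw [map_sub, map_mul, map_mul, freeRep_x, freeRep_x, lift_comp_commutator]
    by_cases hij : i = j
    · subst hij
      rw [if_pos rfl, freeRep_pos_neg hz hz0 hr hs hrs hh0]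
      rw [freeRep_smul, map_sub, map_mul, map_mul, map_mul, map_mul,
        freeRep_tpow z rh sh h (Or.inl rfl), freeRep_tpow z rh sh h (Or.inr rfl),
        freeRep_tpow z rh sh h (Or.inl rfl), freeRep_tpow z rh sh h (Or.inr rfl)]
      simp only [smul_mul_assoc, one_mul, smul_smul]
      rw [one_div, map_inv₀, map_sub, map_pow, map_pow]
    · have hij' : (i : ℕ) ≠ j := fun h => hij (Fin.ext h)
      have hab : algebraMap K L rh ^ 2 - algebraMap K L sh ^ 2 ≠ 0 := by
        rw [← map_pow, ← map_pow, ← map_sub]; exact (map_ne_zero _).mpr hrs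
      rw [if_neg hij, map_zero, xSum_pos_neg hz hab ha hb hz0, if_neg hij', lift_zero]
  | serre_comm e i j m k hA =>
    rw [map_mul, map_mul, freeRep_x, freeRep_x, lift_mul, lift_mul, xSum_comm e (far_of_cartan hA),
      add_comm]
  | serre_lt e i j m₁ m₂ k hA hij =>
    have hij' : (i : ℕ) < j := hij
    have hn : (i : ℕ) + 1 = j := by have := neighbours_of_cartan hA; omega
    rw [map_add, freeRep_serreTerm, freeRep_serreTerm, add_comm m₂ m₁, map_zero]
    simp only
    rw [← lift_add, xSum_serre hz ha hb e (Or.inl ⟨hn, rfl⟩), lift_zero]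
  | serre_gt e i j m₁ m₂ k hA hij =>
    have hij' : (j : ℕ) < i := hij
    have hn : (j : ℕ) + 1 = i := by have := neighbours_of_cartan hA; omega
    rw [map_add, freeRep_serreTerm, freeRep_serreTerm, add_comm m₂ m₁, map_zero]
    simp only
    rw [← lift_add, xSum_serre hz ha hb e (Or.inr ⟨hn, rfl⟩), lift_zero]

/-- The Drinfeld tensor product of loop vector representations, one for each site. -/
theorem exists_rep [CharZero L] (n : ℕ) (hz : Function.Injective z) (hz0 : ∀ p, z p ≠ 0)
    (hr : rh ≠ 0) (hs : sh ≠ 0) (hrs : rh ^ 2 - sh ^ 2 ≠ 0)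
    (hh : h ^ 2 = algebraMap K L (rh * sh)) :
    ∃ ρ : Uaff n (rh ^ 2) (sh ^ 2) rh sh →ₐ[K] Module.End L (ℤ → (P → ℕ) → L),
      ∀ e i, ρ (xgen n (rh ^ 2) (sh ^ 2) rh sh e 0 i) =
        lift (∑ p, siteOp z (algebraMap K L rh) (algebraMap K L sh) e i p) 0 := by
  refine ⟨RingQuot.liftAlgHom K ⟨freeRep z rh sh h, fun _ _ huv =>
    freeRep_rel hz hz0 hr hs hrs hh huv⟩, fun e i => ?_⟩
  rw [xgen, RingQuot.liftAlgHom_mkAlgHom_apply, freeRep_x]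
  simp [xSum]

end Representation

/-! ### Serre relations and good Lyndon words -/

section SerreElements

variable {K A : Type*} [Field K] [Ring A] [Algebra K A] {m : ℕ} {r s : K}

theorem lift_adPow_one (x : Fin m → A) (i j : Fin m) :
    FreeAlgebra.lift K x (adPow r s i j 1)
      = x i * x j - pairing r s j i • (x j * x i) := by
  simp [adPow, qbr, map_sub, map_mul, map_smul]

theorem lift_adPow_two (x : Fin m → A) (i j : Fin m) :
    FreeAlgebra.lift K x (adPow r s i j 2)
      = x i * x i * x j - (pairing r s j i * (1 + pairing r s i i)) • (x i * x j * x i)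
        + (pairing r s j i ^ 2 * pairing r s i i) • (x j * x i * x i) := by
  simp only [adPow, qbr, map_sub, map_mul, map_smul, FreeAlgebra.lift_ι_apply, mul_sub, sub_mul,
    mul_smul_comm, smul_mul_assoc, mul_assoc]
  module

/-- A finite sequence, extended by zero. -/
def extZero (x : Fin m → A) (k : ℕ) : A := if h : k < m then x ⟨k, h⟩ else 0

theorem extZero_val (x : Fin m → A) (i : Fin m) : extZero x i = x i := by
  simp [extZero]

theorem extZero_of_le (x : Fin m → A) {k : ℕ} (h : m ≤ k) : extZero x k = 0 := by
  simp [extZero, h]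

theorem cartan_far {i j : Fin m} (h : (i : ℕ) + 2 ≤ j ∨ (j : ℕ) + 2 ≤ i) :
    CartanMatrix.A m i j = 0 := by
  have h1 : i ≠ j := by rintro rfl; omega
  have h2 : ¬ ((i : ℕ) + 1 = j ∨ (j : ℕ) + 1 = i) := by omega
  simp [CartanMatrix.A, h1, h2]

theorem cartan_near {i j : Fin m} (h : (i : ℕ) + 1 = j ∨ (j : ℕ) + 1 = i) :
    CartanMatrix.A m i j = -1 := by
  have h1 : i ≠ j := by rintro rfl; omega
  simp [CartanMatrix.A, h1, h]

/-- The elements `x i` satisfy the `(r,s)`-Serre relations. -/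
def SatisfiesSerre (r s : K) (x : Fin m → A) : Prop :=
  ∀ i j : Fin m, i ≠ j →
    FreeAlgebra.lift K x (adPow r s i j (1 - CartanMatrix.A m i j).toNat) = 0

/-- The two cubic Serre relations of neighbouring letters say that each of the letters
`q`-commutes with their bracket. The extension by zero makes the boundary cases trivial. -/
theorem SatisfiesSerre.serreSeq {x : Fin m → A} (h : SatisfiesSerre r s x) (hr : r ≠ 0)
    (hs : s ≠ 0) : SerreSeq r s (extZero x) := by
  have two : ∀ i j : Fin m, ((i : ℕ) + 1 = j ∨ (j : ℕ) + 1 = i) →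
      x i * x i * x j - (pairing r s j i * (1 + pairing r s i i)) • (x i * x j * x i)
        + (pairing r s j i ^ 2 * pairing r s i i) • (x j * x i * x i) = 0 := by
    intro i j hij
    have := h i j (by rintro rfl; omega)
    rw [cartan_near hij] at this
    rw [← lift_adPow_two]
    exact this
  constructor
  · intro i j hij
    by_cases hj : j < m
    · have hi : i < m := by omega
      have := h ⟨i, hi⟩ ⟨j, hj⟩ (by simp; omega)
      rw [cartan_far (Or.inl hij), show (1 - 0 : ℤ).toNat = 1 from rfl, lift_adPow_one,
        pairing_eq, if_neg (by simp; omega), if_neg (by simp; omega), if_neg (by simp; omega),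
        one_smul] at this
      simpa [extZero, hi, hj] using sub_eq_zero.mp this
    · rw [extZero_of_le x (not_lt.mp hj)]; simp
  · intro i
    by_cases hj : i + 1 < m
    · have hi : i < m := by omega
      have := two ⟨i, hi⟩ ⟨i + 1, hj⟩ (Or.inl rfl)
      rw [pairing_eq r s ⟨i + 1, hj⟩, if_neg (by simp), if_neg (by simp; omega), if_pos rfl,
        pairing_eq, if_pos rfl] at this
      simp only [extZero, hi, hj, dif_pos, qbr]
      rw [← sub_eq_zero, ← this]
      simp only [mul_sub, sub_mul, mul_smul_comm, smul_mul_assoc, mul_assoc]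
      match_scalars <;> field_simp <;> ring
    · rw [extZero_of_le x (not_lt.mp hj)]; simp [qbr]
  · intro i
    by_cases hj : i + 1 < m
    · have hi : i < m := by omega
      have := two ⟨i + 1, hj⟩ ⟨i, hi⟩ (Or.inr rfl)
      rw [pairing_eq r s ⟨i, hi⟩, if_neg (by simp), if_pos rfl,
        pairing_eq, if_pos rfl] at this
      simp only [extZero, hi, hj, dif_pos, qbr]
      have := congrArg (fun y => (r * s) • y) this
      simp only [smul_zero] at this
      rw [← sub_eq_zero, ← this]
      simp only [mul_sub, sub_mul, mul_smul_comm, smul_mul_assoc, mul_assoc]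
      match_scalars <;> field_simp <;> ring
    · rw [extZero_of_le x (not_lt.mp hj)]; simp [qbr]

theorem lift_wordElt (x : Fin m → A) (w : List (Fin m)) :
    FreeAlgebra.lift K x (wordElt K w) = (w.map x).prod := by
  simp [wordElt, map_list_prod, List.map_map, Function.comp_def]

theorem wordProd_extZero (x : Fin m → A) (w : List (Fin m)) :
    wordProd (extZero x) (w.map Fin.val) = (w.map x).prod := by
  simp [wordProd, Function.comp_def, extZero_val]

theorem wordProd_extZero_eq_zero (x : Fin m → A) {w : List ℕ} (hw : ¬ ∀ i ∈ w, i < m) :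
    wordProd (extZero x) w = 0 := by
  push Not at hw
  obtain ⟨i, hi, him⟩ := hw
  exact List.prod_eq_zero (List.mem_map.mpr ⟨i, hi, extZero_of_le x him⟩)

theorem exists_map_val {w : List ℕ} (hw : ∀ i ∈ w, i < m) :
    ∃ v : List (Fin m), v.map Fin.val = w :=
  ⟨w.pmap (fun i hi => (⟨i, hi⟩ : Fin m)) hw, by simp [List.map_pmap]⟩

theorem map_val_lt_iff {u v : List (Fin m)} : u.map Fin.val < v.map Fin.val ↔ u < v := by
  induction u generalizing v with
  | nil => cases v <;> simp
  | cons a u ih => cases v with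
    | nil => simp
    | cons b v =>
      rw [List.map_cons, List.map_cons, List.cons_lt_cons_iff, List.cons_lt_cons_iff, ih,
        Fin.lt_def, Fin.val_inj]

/-- The images of the letters in the free algebra modulo the Serre ideal. -/
theorem satisfiesSerre_quotient (m : ℕ) (r s : K) :
    SatisfiesSerre r s fun i : Fin m =>
      RingCon.mkₐ K (serreIdeal m r s).ringCon (FreeAlgebra.ι K i) := by
  intro i j hij
  have e : FreeAlgebra.lift K (fun i : Fin m =>
      RingCon.mkₐ K (serreIdeal m r s).ringCon (FreeAlgebra.ι K i))
      = RingCon.mkₐ K (serreIdeal m r s).ringCon := by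
    ext; simp
  rw [e]
  have hmem : adPow r s i j (1 - CartanMatrix.A m i j).toNat ∈ serreIdeal m r s :=
    TwoSidedIdeal.subset_span ⟨i, j, hij, rfl⟩
  exact (RingCon.eq _).mpr ((TwoSidedIdeal.mem_iff _ _).mp hmem)

/-- A good word is a concatenation of intervals in decreasing order. -/
theorem exists_concatWord_of_isGood (hr : r ≠ 0) (hs : s ≠ 0) (hne : r + s ≠ 0)
    {w : List (Fin m)} (hw : IsGood (serreIdeal m r s) w) :
    ∃ L : List (ℕ × ℕ), (∀ u ∈ L, IsSeg m u) ∧ L.Pairwise SegGE ∧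
      concatWord L = w.map Fin.val := by
  by_contra hL
  push Not at hL
  refine hw ?_
  set π := RingCon.mkₐ K (serreIdeal m r s).ringCon with hπ
  have key := ((satisfiesSerre_quotient m r s).serreSeq hr hs).wordProd_mem_spanAbove hne
    (m := m) (w.map Fin.val) (by simp) hL
  have hword : ∀ v : List (Fin m),
      wordProd (extZero fun i : Fin m => π (FreeAlgebra.ι K i)) (v.map Fin.val)
        = π (wordElt K v) := by
    intro v
    rw [wordProd_extZero, wordElt, map_list_prod, List.map_map]
    rfl
  have hle : spanAbove K (extZero fun i : Fin m => π (FreeAlgebra.ι K i)) (w.map Fin.val) ≤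
      (Submodule.span K (wordElt K '' {v : List (Fin m) | WordPrec v w})).map π.toLinearMap := by
    refine Submodule.span_le.mpr ?_
    rintro y ⟨v, hv, hl, rfl⟩
    by_cases hb : ∀ i ∈ v, i < m
    · obtain ⟨v, rfl⟩ := exists_map_val hb
      rw [hword]
      exact ⟨_, Submodule.subset_span ⟨v, Or.inr ⟨by simpa using hl, map_val_lt_iff.mp hv⟩, rfl⟩,
        rfl⟩
    · rw [wordProd_extZero_eq_zero _ hb]
      exact Submodule.zero_mem _
  obtain ⟨f, hf, hfw⟩ := hle key
  refine ⟨f, hf, ?_⟩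
  rw [hword] at hfw
  rw [← TwoSidedIdeal.rel_iff]
  exact (RingCon.eq _).mp hfw.symm

/-- The matrix unit `E_{i,i+1}`, as an operator on functions. -/
def unitOp (K : Type*) [Field K] (i : ℕ) : Module.End K (ℕ → K) where
  toFun f := fun y => if y = i then f (i + 1) else 0
  map_add' f g := by ext y; by_cases h : y = i <;> simp [h]
  map_smul' c f := by ext y; by_cases h : y = i <;> simp [h]

theorem unitOp_apply (i : ℕ) (f : ℕ → K) (y : ℕ) :
    unitOp K i f y = if y = i then f (i + 1) else 0 := rfl

theorem unitOp_mul {i j : ℕ} (h : j ≠ i + 1) : unitOp K i * unitOp K j = 0 := by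
  ext f y
  simp [Module.End.mul_apply, unitOp_apply, h.symm]

theorem satisfiesSerre_unitOp (m : ℕ) (r s : K) :
    SatisfiesSerre r s fun i : Fin m => unitOp K i := by
  intro i j hij
  have hij' : (i : ℕ) ≠ j := fun h => hij (Fin.ext h)
  by_cases hn : (i : ℕ) + 1 = j ∨ (j : ℕ) + 1 = i
  · rw [cartan_near hn, show (1 - -1 : ℤ).toNat = 2 from rfl, lift_adPow_two]
    have h1 : unitOp K i * unitOp K i = 0 := unitOp_mul (by omega)
    rw [h1, mul_assoc (unitOp K j), h1, zero_mul, mul_zero, smul_zero, add_zero, zero_sub,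
      neg_eq_zero]
    rcases hn with hn | hn
    · rw [mul_assoc, unitOp_mul (i := j) (by omega), mul_zero, smul_zero]
    · rw [unitOp_mul (i := i) (by omega), zero_mul, smul_zero]
  · rw [cartan_far (by omega), show (1 - 0 : ℤ).toNat = 1 from rfl, lift_adPow_one,
      unitOp_mul (by omega), unitOp_mul (by omega), smul_zero, sub_zero]

/-- A product of the matrix units `E_{i,i+1}` vanishes unless the word is an interval. -/
theorem unitOp_word (w : List ℕ) (f : ℕ → K) (y : ℕ) :
    (w.map (unitOp K)).prod f y = if w = List.range' y w.length then f (y + w.length) else 0 := by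
  induction w generalizing y with
  | nil => simp
  | cons i w ih =>
    rw [List.map_cons, List.prod_cons, Module.End.mul_apply, unitOp_apply, ih, List.length_cons,
      List.range'_succ]
    by_cases hy : y = i
    · subst hy
      rw [if_pos rfl]
      by_cases hw : w = List.range' (y + 1) w.length
      · rw [if_pos hw, if_pos (by rw [← hw]), add_right_comm, add_assoc]
      · rw [if_neg hw, if_neg (by simpa using hw)]
    · rw [if_neg hy, if_neg]
      rintro h
      exact hy (List.cons.inj h).1.symm

/-- Intervals are good words: the matrix units `E_{i,i+1}` give a linear form that vanishes on the
Serre ideal and on all words but one. -/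
theorem isGood_of_map_val {w : List (Fin m)} {a k : ℕ} (hw : w.map Fin.val = List.range' a k) :
    IsGood (serreIdeal m r s) w := by
  rintro ⟨f, hf, hJ⟩
  set τ := FreeAlgebra.lift K (fun i : Fin m => unitOp K i) with hτ
  have hle : serreIdeal m r s ≤ TwoSidedIdeal.ker τ := by
    refine TwoSidedIdeal.span_le.mpr ?_
    rintro y ⟨i, j, hij, rfl⟩
    exact (TwoSidedIdeal.mem_ker _).mpr (satisfiesSerre_unitOp m r s i j hij)
  have h0 : τ (wordElt K w - f) = 0 := (TwoSidedIdeal.mem_ker _).mp (hle hJ)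
  have hk : k = w.length := by simpa using (congrArg List.length hw).symm
  have hval : ∀ v : List (Fin m), τ (wordElt K v) (Pi.single (a + k) 1) a
      = if v = w then 1 else 0 := by
    intro v
    rw [hτ, lift_wordElt, show v.map (fun i : Fin m => unitOp K i)
      = (v.map Fin.val).map (unitOp K) by simp, unitOp_word, List.length_map]
    by_cases hv : v = w
    · subst hv
      rw [← hk, hw, if_pos rfl, if_pos rfl, Pi.single_eq_same]
    · rw [if_neg hv]
      by_cases hv' : v.map Fin.val = List.range' a v.length
      · rw [if_pos hv', Pi.single_eq_of_ne]
        intro hl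
        have : v.length = k := by omega
        rw [this, ← hw] at hv'
        exact hv (List.map_injective_iff.mpr Fin.val_injective hv')
      · rw [if_neg hv']
  have hf0 : τ f (Pi.single (a + k) 1) a = 0 := by
    have : ∀ g ∈ Submodule.span K (wordElt K '' {v : List (Fin m) | WordPrec v w}),
        τ g (Pi.single (a + k) 1) a = 0 := by
      intro g hg
      induction hg using Submodule.span_induction with
      | mem g hg =>
        obtain ⟨v, hv, rfl⟩ := hg
        rw [hval, if_neg]
        rintro rfl
        rcases hv with hv | hv
        · exact lt_irrefl _ hv
        · exact lt_irrefl _ hv.2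
      | zero => simp
      | add x y _ _ hx hy => simp [hx, hy]
      | smul c x _ hx => simp [hx]
    exact this f hf
  have h1 := congrArg (fun T => T (Pi.single (a + k) 1) a) h0
  simp only [map_sub, LinearMap.sub_apply, Pi.sub_apply, hval, hf0, if_pos, LinearMap.zero_apply,
    Pi.zero_apply, sub_zero] at h1
  exact one_ne_zero h1

end SerreElements

section LyndonWords

variable {m : ℕ}

/-- Intervals are Lyndon words. -/
theorem isLyndon_of_map_val {w : List (Fin m)} {a k : ℕ} (hk : 0 < k)
    (hw : w.map Fin.val = List.range' a k) : IsLyndon w := by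
  refine ⟨by rintro rfl; simp at hw; omega, ?_⟩
  rintro u v rfl hu hv
  rw [List.map_append] at hw
  obtain ⟨l, hl, h1, h2⟩ := List.range'_eq_append_iff.mp hw.symm
  rw [← map_val_lt_iff, List.map_append, hw, h2]
  have hu' : 0 < u.length := List.length_pos_iff.mpr hu
  have hv' : 0 < v.length := List.length_pos_iff.mpr hv
  have e1 := congrArg List.length h1
  have e2 := congrArg List.length h2
  simp at e1 e2
  obtain ⟨k, rfl⟩ : ∃ k', k = k' + 1 := ⟨k - 1, by omega⟩
  obtain ⟨k', hk'⟩ : ∃ k', k + 1 - l = k' + 1 := ⟨k - l, by omega⟩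
  rw [hk', List.range'_succ, List.range'_succ, List.cons_lt_cons_iff]
  left; omega

theorem lt_append_of_ne_nil {I : Type*} [LinearOrder I] (u : List I) {v : List I} (hv : v ≠ []) :
    u < u ++ v := by
  have := (append_lt_append_left_iff u (u := []) (v := v)).mpr (by
    cases v with
    | nil => exact absurd rfl hv
    | cons a v => exact List.nil_lt_cons a v)
  rwa [List.append_nil] at this

/-- Decreasing concatenations of several intervals are not Lyndon words. -/
theorem exists_segWord_of_isLyndon {w : List (Fin m)} (hw : IsLyndon w) {L : List (ℕ × ℕ)}
    (hS : ∀ u ∈ L, IsSeg m u) (hL : L.Pairwise SegGE) (hLw : concatWord L = w.map Fin.val) :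
    ∃ u, IsSeg m u ∧ w.map Fin.val = segWord u := by
  cases L with
  | nil =>
    simp only [concatWord, List.flatMap_nil] at hLw
    exact absurd (List.map_eq_nil_iff.mp hLw.symm) hw.1
  | cons u L =>
    rcases List.eq_nil_or_concat L with rfl | ⟨L, v, rfl⟩
    · exact ⟨u, hS u (by simp), by rw [← hLw]; simp [concatWord]⟩
    · exfalso
      simp only [List.concat_eq_append] at hS hL hLw
      have hu := (hS u (by simp)).1
      have hv := (hS v (by simp)).1
      have huv : SegGE u v := (List.pairwise_cons.mp hL).1 v (by simp)
      have e : concatWord (u :: L ++ [v]) = (segWord u ++ concatWord L) ++ segWord v := by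
        rw [concatWord_append, concatWord_cons]; simp [concatWord]
      change concatWord (u :: L ++ [v]) = _ at hLw
      rw [e] at hLw
      obtain ⟨w₁, w₂, rfl, h1, h2⟩ := List.map_eq_append_iff.mp hLw.symm
      have hlt := hw.2 w₁ w₂ rfl
        (by rintro rfl; rw [segWord_eq_cons hu] at h1; simp at h1)
        (by rintro rfl; rw [segWord_eq_cons hv] at h2; simp at h2)
      rw [← map_val_lt_iff, ← hLw, h2] at hlt
      refine lt_asymm hlt ?_
      unfold SegGE at huv
      rcases huv with h | ⟨h, h'⟩
      · rw [segWord_eq_cons hu, segWord_eq_cons hv]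
        simp only [List.cons_append, List.cons_lt_cons_iff]
        left; exact h
      · have e2 : segWord u = segWord v ++ segWord (v.2, u.2) := by
          have := segWord_append (a := v.1) (b := v.2) (c := u.2) hv.le h'
          rw [← this, h]
        rw [e2, List.append_assoc, List.append_assoc]
        refine lt_append_of_ne_nil _ ?_
        rw [segWord_eq_cons hv]
        simp

end LyndonWords

section Bracketing

variable {K A : Type*} [Field K] [Ring A] [Algebra K A] {m : ℕ} {r s : K}

/-- Appending the next letter to an interval is bracketing with the parameter `r`. -/
theorem wordChar_interval (j : Fin m) {u : List (Fin m)} {a k : ℕ}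
    (hu : u.map Fin.val = List.range' a (k + 1)) (hj : (j : ℕ) = a + (k + 1)) :
    wordChar (fun i j => (pairing r s i j)⁻¹) u [j] = r := by
  rw [List.range'_concat] at hu
  obtain ⟨u, u', rfl, h1, h2⟩ := List.map_eq_append_iff.mp hu
  obtain ⟨i, rfl, hi⟩ : ∃ i : Fin m, u' = [i] ∧ (i : ℕ) = a + 1 * k := by
    cases u' with
    | nil => simp at h2
    | cons i u' =>
      simp only [List.map_cons, List.cons.injEq, List.map_eq_nil_iff] at h2
      exact ⟨i, by rw [h2.2], h2.1⟩
  have h3 : ∀ i ∈ u, (pairing r s i j)⁻¹ = 1 := by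
    intro i' hi'
    have hm : (i' : ℕ) ∈ List.range' a k := by rw [← h1]; exact List.mem_map_of_mem hi'
    rw [List.mem_range'_1] at hm
    rw [pairing_eq, if_neg (by rintro rfl; omega), if_neg (by omega), if_neg (by omega), inv_one]
  have h4 : (pairing r s i j)⁻¹ = r := by
    rw [pairing_eq, if_neg (by rintro rfl; omega), if_pos (by omega), inv_inv]
  simp only [wordChar, List.map_append, List.prod_append, List.map_cons, List.map_nil,
    List.prod_cons, List.prod_nil, mul_one, h4]
  rw [List.prod_eq_one, one_mul]
  intro y hy
  obtain ⟨i', hi', rfl⟩ := List.mem_map.mp hy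
  exact h3 i' hi'

/-- The quantum bracketing of an interval is its root vector. -/
theorem isBracketing_interval (x : Fin m → A) {w : List (Fin m)} {a k : ℕ}
    (hw : w.map Fin.val = List.range' a (k + 1)) :
    IsBracketing (fun i j => (pairing r s i j)⁻¹) x w (leftBracket r (w.map x)) := by
  induction k generalizing w with
  | zero =>
    cases w with
    | nil => simp at hw
    | cons i w =>
      simp only [List.map_cons, zero_add, List.range'_one, List.cons.injEq,
        List.map_eq_nil_iff] at hw
      rw [hw.2]
      exact IsBracketing.letter i
  | succ k ih =>
    rw [List.range'_concat] at hw
    obtain ⟨u, u', rfl, h1, h2⟩ := List.map_eq_append_iff.mp hw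
    obtain ⟨j, rfl, hj⟩ : ∃ j : Fin m, u' = [j] ∧ (j : ℕ) = a + 1 * (k + 1) := by
      cases u' with
      | nil => simp at h2
      | cons i u' =>
        simp only [List.map_cons, List.cons.injEq, List.map_eq_nil_iff] at h2
        exact ⟨i, by rw [h2.2], h2.1⟩
    have hu : u ≠ [] := by rintro rfl; simp at h1
    have key := IsBracketing.bracket (χ := fun i j => (pairing r s i j)⁻¹) (x := x) u [j] _ _
      (isLyndon_of_map_val (Nat.succ_pos k) h1) (by simp) (by
        intro u' v' h hv' _
        have h3 := congrArg List.length h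
        have h4 : 0 < v'.length := List.length_pos_iff.mpr hv'
        simp at h3
        omega) (ih h1) (IsBracketing.letter j)
    rw [wordChar_interval j h1 (by omega)] at key
    rw [List.map_append, List.map_singleton, leftBracket_concat r (by simpa using hu)]
    exact key

end Bracketing

/-! ### Monomials and sorted lists of intervals -/

section Lists

/-- The interval `(i, j)` of a positive root `α_{ij}`. -/
def PosRoot.seg {n : ℕ} (α : PosRoot n) : ℕ × ℕ := (α.1.1, α.1.2)

theorem PosRoot.seg_injective (n : ℕ) : Function.Injective (PosRoot.seg (n := n)) := by
  rintro ⟨⟨i, j⟩, hij⟩ ⟨⟨i', j'⟩, hij'⟩ h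
  simp only [PosRoot.seg, Prod.mk.injEq, Fin.val_inj] at h
  exact Subtype.ext (Prod.ext h.1 h.2)

theorem PosRoot.isSeg {n : ℕ} (α : PosRoot n) : IsSeg (n - 1) α.seg := by
  have h1 : (α.1.1 : ℕ) < α.1.2 := α.2
  have h2 : (α.1.2 : ℕ) < n := α.1.2.isLt
  exact ⟨h1, by change (α.1.2 : ℕ) ≤ _; omega⟩

theorem PosRoot.exists_seg_eq {n : ℕ} {u : ℕ × ℕ} (hu : IsSeg (n - 1) u) :
    ∃ α : PosRoot n, α.seg = u := by
  obtain ⟨h1, h2⟩ := hu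
  exact ⟨⟨(⟨u.1, by omega⟩, ⟨u.2, by omega⟩), h1⟩, rfl⟩

theorem SegGE.antisymm {u v : ℕ × ℕ} (h : SegGE u v) (h' : SegGE v u) : u = v := by
  unfold SegGE at *
  exact Prod.ext (by omega) (by omega)

theorem SegGE.refl (u : ℕ × ℕ) : SegGE u u := Or.inr ⟨rfl, le_rfl⟩

theorem mem_posRootList {n : ℕ} (α : PosRoot n) : α ∈ posRootList n := by
  obtain ⟨⟨i, j⟩, hij⟩ := α
  exact List.mem_flatMap.mpr ⟨i, List.mem_finRange i,
    List.mem_filterMap.mpr ⟨j, List.mem_finRange j, dif_pos hij⟩⟩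

theorem posRootList_pairwise (n : ℕ) :
    (posRootList n).Pairwise fun α β => SegGE β.seg α.seg ∧ α ≠ β := by
  rw [posRootList, List.pairwise_flatMap]
  constructor
  · intro i _
    rw [List.pairwise_filterMap]
    refine (List.pairwise_lt_finRange n).imp ?_
    intro j j' hjj α hα β hβ
    split_ifs at hα hβ with h1 h2
    cases hα; cases hβ
    exact ⟨Or.inr ⟨rfl, Fin.lt_def.mp hjj |>.le⟩, fun h => hjj.ne (by cases h; rfl)⟩
  · refine (List.pairwise_lt_finRange n).imp ?_
    intro i i' hii α hα β hβ
    simp only [List.mem_filterMap] at hα hβ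
    obtain ⟨j, _, hj⟩ := hα
    obtain ⟨j', _, hj'⟩ := hβ
    split_ifs at hj hj' with h1 h2
    cases hj; cases hj'
    exact ⟨Or.inl hii, fun h => hii.ne (by cases h; rfl)⟩

theorem posRootList_nodup (n : ℕ) : (posRootList n).Nodup :=
  (posRootList_pairwise n).imp fun h => h.2

/-- The sorted list of intervals in which the interval of `α` occurs `ℓ α` times. -/
def segList {n : ℕ} (ℓ : PosRoot n → ℕ) : List (ℕ × ℕ) :=
  (posRootList n).reverse.flatMap fun α => List.replicate (ℓ α) α.seg

theorem segList_isSeg {n : ℕ} (ℓ : PosRoot n → ℕ) : ∀ u ∈ segList ℓ, IsSeg (n - 1) u := by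
  intro u hu
  simp only [segList, List.mem_flatMap, List.mem_replicate] at hu
  obtain ⟨α, _, _, rfl⟩ := hu
  exact α.isSeg

theorem segList_pairwise {n : ℕ} (ℓ : PosRoot n → ℕ) : (segList ℓ).Pairwise SegGE := by
  rw [segList, List.pairwise_flatMap]
  refine ⟨fun α _ => List.pairwise_replicate.mpr (Or.inr (SegGE.refl _)), ?_⟩
  rw [List.pairwise_reverse]
  refine (posRootList_pairwise n).imp fun {α β} h u hu v hv => ?_
  rw [List.eq_of_mem_replicate hu, List.eq_of_mem_replicate hv]
  exact h.1

theorem count_segList {n : ℕ} (ℓ : PosRoot n → ℕ) (α : PosRoot n) :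
    (segList ℓ).count α.seg = ℓ α := by
  classical
  have key : ∀ S : List (PosRoot n), S.Nodup →
      (S.flatMap fun β => List.replicate (ℓ β) β.seg).count α.seg = if α ∈ S then ℓ α else 0 := by
    intro S hS
    induction S with
    | nil => simp
    | cons β S ih =>
      rw [List.nodup_cons] at hS
      rw [List.flatMap_cons, List.count_append, ih hS.2, List.count_replicate]
      by_cases h : α = β
      · subst h; simp [hS.1]
      · have : β.seg ≠ α.seg := fun e => h (PosRoot.seg_injective n e).symm
        simp [h, this]
  rw [segList, key _ (List.nodup_reverse.mpr (posRootList_nodup n)),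
    if_pos (List.mem_reverse.mpr (mem_posRootList α))]

theorem segList_injective (n : ℕ) : Function.Injective (segList (n := n)) := by
  intro ℓ ℓ' h
  funext α
  rw [← count_segList ℓ, h, count_segList]

theorem exists_segList_eq {n : ℕ} {L : List (ℕ × ℕ)} (hS : ∀ u ∈ L, IsSeg (n - 1) u)
    (hL : L.Pairwise SegGE) : ∃ ℓ : PosRoot n → ℕ, segList ℓ = L := by
  refine ⟨fun α => L.count α.seg, ?_⟩
  refine List.Perm.eq_of_pairwise (le := SegGE) (fun _ _ _ _ => SegGE.antisymm)
    (segList_pairwise _) hL ?_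
  rw [List.perm_iff_count]
  intro u
  by_cases hu : IsSeg (n - 1) u
  · obtain ⟨α, rfl⟩ := PosRoot.exists_seg_eq hu
    rw [count_segList]
  · rw [List.count_eq_zero_of_not_mem fun h => hu (segList_isSeg _ u h),
      List.count_eq_zero_of_not_mem fun h => hu (hS u h)]

/-- The word of an interval. -/
def finWord (m : ℕ) (u : ℕ × ℕ) : List (Fin m) :=
  (List.finRange m).filter fun k => decide (u.1 ≤ k.val ∧ k.val < u.2)

theorem finWord_map_val {m : ℕ} {u : ℕ × ℕ} (hu : u.2 ≤ m) :
    (finWord m u).map Fin.val = segWord u := by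
  refine List.Perm.eq_of_pairwise (le := fun a b => a < b) (fun a b _ _ h h' => absurd h h'.asymm)
    ?_ (List.pairwise_lt_range' 1) ?_
  · rw [List.pairwise_map]
    exact ((List.pairwise_lt_finRange m).filter _).imp fun h => h
  · unfold finWord segWord
    refine (List.perm_ext_iff_of_nodup (List.Nodup.map Fin.val_injective
      ((List.nodup_finRange m).filter _)) (List.nodup_range' (step := 1))).mpr fun k => ?_
    simp only [List.mem_map, List.mem_filter, List.mem_finRange, true_and,
      decide_eq_true_eq, List.mem_range'_1]
    constructor
    · rintro ⟨k, hk, rfl⟩; omega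
    · intro hk
      exact ⟨⟨k, by omega⟩, by simp; omega, rfl⟩

theorem segWord_injOn {u v : ℕ × ℕ} (hu : u.1 < u.2) (hv : v.1 < v.2)
    (h : segWord u = segWord v) : u = v := by
  have h1 := congrArg List.length h
  rw [segWord_eq_cons hu, segWord_eq_cons hv] at h
  have h2 := (List.cons.inj h).1
  simp only [segWord, List.length_range'] at h1
  exact Prod.ext h2 (by omega)

theorem segWord_le {u v : ℕ × ℕ} (hu : u.1 < u.2) (hv : v.1 < v.2) (h : SegGE u v) :
    segWord v ≤ segWord u := by
  rcases h with h | ⟨h, h'⟩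
  · rw [segWord_eq_cons hu, segWord_eq_cons hv]
    exact (List.cons_lt_cons_iff.mpr (Or.inl h)).le
  · rcases eq_or_lt_of_le h' with h'' | h''
    · rw [Prod.ext h h'']
    · have := segWord_append hv.le h'
      have e : segWord u = segWord v ++ segWord (v.2, u.2) := by rw [← this, h]
      rw [e]
      refine (lt_append_of_ne_nil _ ?_).le
      rw [segWord_eq_cons (by exact h'')]; simp

theorem SegGE.total (u v : ℕ × ℕ) : SegGE u v ∨ SegGE v u := by
  unfold SegGE; omega

end Lists

section LyndonFamily

variable {K A : Type*} [Field K] [Ring A] [Algebra K A] {r s : K}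

theorem leftBracket_finWord {m : ℕ} (x : Fin m → A) {u : ℕ × ℕ} (hu : u.2 ≤ m) :
    leftBracket r ((finWord m u).map x) = rootElt r (extZero x) u.1 u.2 := by
  have e : (finWord m u).map x = (segWord u).map (extZero x) := by
    rw [← finWord_map_val hu, List.map_map]
    exact List.map_congr_left fun i _ => (extZero_val x i).symm
  rw [e, rootElt, segWord]

theorem prod_map_replicate_flatMap {α β : Type*} (S : List α) (ℓ : α → ℕ) (g : α → β) (f : β → A) :
    ((S.flatMap fun a => List.replicate (ℓ a) (g a)).map f).prod
      = (S.map fun a => f (g a) ^ ℓ a).prod := by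
  induction S with
  | nil => simp
  | cons a S ih => simp [ih]

/-- The ordered monomials in the root vectors are products of root vectors of sorted lists of
intervals. -/
theorem monomial_eq_rootProd {n : ℕ} (x : Fin (n - 1) → A) (ℓ : PosRoot n → ℕ) :
    ((posRootList n).reverse.map fun α => leftBracket r ((support α).map x) ^ ℓ α).prod
      = rootProd r (extZero x) (segList ℓ) := by
  rw [rootProd, segList, prod_map_replicate_flatMap]
  congr 1
  refine List.map_congr_left fun α _ => ?_
  rw [← leftBracket_finWord x α.isSeg.2]
  rfl

variable {n : ℕ} {x : Fin (n - 1) → A}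

/-- The good Lyndon words are the words of the intervals. -/
theorem exists_finWord_eq (hr : r ≠ 0) (hs : s ≠ 0) (hne : r + s ≠ 0) {m : ℕ} {w : List (Fin m)}
    (hw : IsLyndon w) (hg : IsGood (serreIdeal m r s) w) : ∃ u, IsSeg m u ∧ finWord m u = w := by
  obtain ⟨L, h1, h2, h3⟩ := exists_concatWord_of_isGood hr hs hne hg
  obtain ⟨u, hu, h⟩ := exists_segWord_of_isLyndon hw h1 h2 h3
  exact ⟨u, hu, List.map_injective_iff.mpr Fin.val_injective ((finWord_map_val hu.2).trans h.symm)⟩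

theorem finWord_isLyndon {m : ℕ} {u : ℕ × ℕ} (hu : IsSeg m u) : IsLyndon (finWord m u) :=
  isLyndon_of_map_val (Nat.sub_pos_of_lt hu.1) (finWord_map_val hu.2)

theorem finWord_isGood {m : ℕ} {u : ℕ × ℕ} (hu : IsSeg m u) :
    IsGood (serreIdeal m r s) (finWord m u) :=
  isGood_of_map_val (finWord_map_val hu.2)

/-- Products of root vectors over sorted lists of intervals are the products of the bracketings of
the good Lyndon words in decreasing order. -/
theorem isLyndonFamily_rootProd (hr : r ≠ 0) (hs : s ≠ 0) (hne : r + s ≠ 0) :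
    IsLyndonFamily r s x fun ℓ : PosRoot n → ℕ => rootProd r (extZero x) (segList ℓ) := by
  refine ⟨fun w => leftBracket r (w.map x), ?_, ?_⟩
  · intro w hw hg
    obtain ⟨u, hu, rfl⟩ := exists_finWord_eq hr hs hne hw hg
    have h := finWord_map_val hu.2
    rw [segWord, show u.2 - u.1 = u.2 - u.1 - 1 + 1 by have := hu.1; omega] at h
    exact isBracketing_interval x h
  · have hle : ∀ u v : ℕ × ℕ, IsSeg (n - 1) u → IsSeg (n - 1) v →
        (finWord (n - 1) v ≤ finWord (n - 1) u ↔ SegGE u v) := by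
      intro u v hu hv
      rw [← not_lt, ← map_val_lt_iff, finWord_map_val hu.2, finWord_map_val hv.2, not_lt]
      constructor
      · intro h
        rcases SegGE.total u v with h' | h'
        · exact h'
        · have := segWord_injOn hu.1 hv.1 (le_antisymm (segWord_le hv.1 hu.1 h') h)
          rw [this]; exact SegGE.refl v
      · exact segWord_le hu.1 hv.1
    have hpw : ∀ L : List (ℕ × ℕ), (∀ u ∈ L, IsSeg (n - 1) u) →
        ((L.map (finWord (n - 1))).Pairwise (fun u v => v ≤ u) ↔ L.Pairwise SegGE) := by
      intro L hL
      rw [List.pairwise_map]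
      exact List.Pairwise.iff_of_mem fun {u v} hu hv => hle u v (hL u hu) (hL v hv)
    let e : (PosRoot n → ℕ) → {l : List (List (Fin (n - 1))) //
        l.Pairwise (fun u v => v ≤ u) ∧
          ∀ w ∈ l, IsLyndon w ∧ IsGood (serreIdeal (n - 1) r s) w} := fun ℓ =>
      ⟨(segList ℓ).map (finWord (n - 1)), (hpw _ (segList_isSeg ℓ)).mpr (segList_pairwise ℓ), by
        intro w hw
        obtain ⟨u, hu, rfl⟩ := List.mem_map.mp hw
        exact ⟨finWord_isLyndon (segList_isSeg ℓ u hu), finWord_isGood (segList_isSeg ℓ u hu)⟩⟩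
    have he : Function.Bijective e := by
      constructor
      · intro ℓ ℓ' h
        have h := congrArg (fun l => l.1.map (List.map Fin.val)) h
        simp only [e, List.map_map] at h
        refine segList_injective n ?_
        have hinj : ∀ L L' : List (ℕ × ℕ), (∀ u ∈ L, IsSeg (n - 1) u) →
            (∀ u ∈ L', IsSeg (n - 1) u) → L.map (List.map Fin.val ∘ finWord (n - 1))
              = L'.map (List.map Fin.val ∘ finWord (n - 1)) → L = L' := by
          intro L
          induction L with
          | nil => intro L' _ _ h; simpa using h.symm
          | cons u L ih =>
            intro L' hL hL' h
            cases L' with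
            | nil => simp at h
            | cons v L' =>
              rw [List.map_cons, List.map_cons, List.cons.injEq, Function.comp_apply,
                Function.comp_apply, finWord_map_val (hL u (by simp)).2,
                finWord_map_val (hL' v (by simp)).2] at h
              rw [segWord_injOn (hL u (by simp)).1 (hL' v (by simp)).1 h.1,
                ih L' (fun w hw => hL w (by simp [hw])) (fun w hw => hL' w (by simp [hw])) h.2]
        exact hinj _ _ (segList_isSeg ℓ) (segList_isSeg ℓ') h
      · rintro ⟨l, hl, hg⟩
        obtain ⟨L, hL, rfl⟩ : ∃ L : List (ℕ × ℕ), (∀ u ∈ L, IsSeg (n - 1) u) ∧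
            L.map (finWord (n - 1)) = l := by
          clear hl
          induction l with
          | nil => exact ⟨[], by simp, rfl⟩
          | cons w l ih =>
            obtain ⟨L, hL, rfl⟩ := ih fun w hw => hg w (by simp [hw])
            obtain ⟨u, hu, rfl⟩ := exists_finWord_eq hr hs hne (hg w (by simp)).1
              (hg w (by simp)).2
            refine ⟨u :: L, ?_, rfl⟩
            intro v hv
            rcases List.mem_cons.mp hv with rfl | hv
            · exact hu
            · exact hL v hv
        obtain ⟨ℓ, rfl⟩ := exists_segList_eq hL ((hpw L hL).mp hl)
        exact ⟨ℓ, rfl⟩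
    refine ⟨Equiv.ofBijective e he, fun ℓ => ?_⟩
    simp only [Equiv.ofBijective_apply, e, List.map_map, rootProd]
    congr 1
    refine List.map_congr_left fun u hu => ?_
    rw [Function.comp_apply, leftBracket_finWord x (segList_isSeg ℓ u hu).2]

theorem rootProd_mem_adjoin {m : ℕ} (x : Fin m → A) {L : List (ℕ × ℕ)} (hL : ∀ u ∈ L, IsSeg m u) :
    rootProd r (extZero x) L ∈ Algebra.adjoin K (Set.range x) := by
  have hx : ∀ k, extZero x k ∈ Algebra.adjoin K (Set.range x) := by
    intro k
    unfold extZero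
    split_ifs with h
    · exact Algebra.subset_adjoin ⟨_, rfl⟩
    · exact Subalgebra.zero_mem _
  refine Subalgebra.list_prod_mem _ ?_
  intro y hy
  obtain ⟨⟨a, b⟩, hu, rfl⟩ := List.mem_map.mp hy
  have hab := (hL _ hu).1
  clear hu hy
  simp only at hab ⊢
  induction b, hab using Nat.le_induction with
  | base => rw [rootElt_self_succ]; exact hx a
  | succ b hb ih =>
    rw [rootElt_succ _ _ hb, qbr]
    exact Subalgebra.sub_mem _ (Subalgebra.mul_mem _ ih (hx b))
      (Subalgebra.smul_mem _ (Subalgebra.mul_mem _ (hx b) ih) _)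

/-- The ordered monomials span the algebra generated by the `x i`. -/
theorem span_rootProd (h : SatisfiesSerre r s x) (hr : r ≠ 0) (hs : s ≠ 0) (hne : r + s ≠ 0) :
    Submodule.span K (Set.range fun ℓ : PosRoot n → ℕ => rootProd r (extZero x) (segList ℓ))
      = Subalgebra.toSubmodule (Algebra.adjoin K (Set.range x)) := by
  refine le_antisymm (Submodule.span_le.mpr ?_) ?_
  · rintro _ ⟨ℓ, rfl⟩
    exact rootProd_mem_adjoin x (segList_isSeg ℓ)
  · rw [Algebra.adjoin_eq_span]
    refine Submodule.span_le.mpr fun y hy => ?_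
    obtain ⟨l, hl, rfl⟩ := Submonoid.exists_list_of_mem_closure hy
    obtain ⟨w, rfl⟩ : ∃ w : List (Fin (n - 1)), w.map x = l := by
      clear hy
      induction l with
      | nil => exact ⟨[], rfl⟩
      | cons a l ih =>
        obtain ⟨w, rfl⟩ := ih fun y hy => hl y (by simp [hy])
        obtain ⟨i, rfl⟩ := hl a (by simp)
        exact ⟨i :: w, rfl⟩
    rw [← wordProd_extZero]
    refine Submodule.span_mono ?_ ((h.serreSeq hr hs).wordProd_mem_span hne (w.map Fin.val)
      (m := n - 1) (by simp))
    rintro p ⟨L, hL, hp, _, _, rfl⟩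
    obtain ⟨ℓ, rfl⟩ := exists_segList_eq hL hp
    exact ⟨ℓ, rfl⟩

end LyndonFamily

/-! ### Triangular families of linear forms -/

section Independence

/-- A decreasing concatenation of intervals determines the intervals: the letter after an interval
is at most its first letter, so it does not continue the interval. -/
theorem concatWord_injOn {m : ℕ} {L M : List (ℕ × ℕ)} (hL : ∀ u ∈ L, IsSeg m u)
    (hM : ∀ u ∈ M, IsSeg m u) (hL' : L.Pairwise SegGE) (hM' : M.Pairwise SegGE)
    (h : concatWord L = concatWord M) : L = M := by
  have aux : ∀ (u v : ℕ × ℕ) (L M : List (ℕ × ℕ)), IsSeg m u → (∀ w ∈ L, IsSeg m w) →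
      (u :: L).Pairwise SegGE → concatWord (u :: L) = concatWord (v :: M) → v.1 = u.1 →
      ¬ u.2 < v.2 := by
    intro u v L M hu hL hp h hvu hlt
    have e : segWord v = segWord u ++ segWord (u.2, v.2) := by
      have := segWord_append (a := u.1) (b := u.2) (c := v.2) hu.1.le hlt.le
      rw [← this, ← hvu]
    rw [concatWord_cons, concatWord_cons, e, List.append_assoc, List.append_cancel_left_eq,
      segWord_eq_cons (u := (u.2, v.2)) hlt] at h
    cases L with
    | nil => simp [concatWord] at h
    | cons u' L =>
      rw [concatWord_cons, segWord_eq_cons (hL u' (by simp)).1] at h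
      have h1 := (List.cons.inj h).1
      have h2 := (List.pairwise_cons.mp hp).1 u' (by simp)
      have h3 := hu.1
      simp only at h1
      unfold SegGE at h2
      omega
  induction L generalizing M with
  | nil =>
    cases M with
    | nil => rfl
    | cons v M =>
      rw [concatWord_cons, segWord_eq_cons (hM v (by simp)).1] at h
      simp [concatWord] at h
  | cons u L ih =>
    cases M with
    | nil =>
      rw [concatWord_cons, segWord_eq_cons (hL u (by simp)).1] at h
      simp [concatWord] at h
    | cons v M =>
      have hu := hL u (by simp)
      have hv := hM v (by simp)
      have h1 : u.1 = v.1 := by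
        have h := h
        rw [concatWord_cons, concatWord_cons, segWord_eq_cons hu.1, segWord_eq_cons hv.1] at h
        exact (List.cons.inj h).1
      have h2 := aux u v L M hu (fun w hw => hL w (by simp [hw])) hL' h h1.symm
      have h3 := aux v u M L hv (fun w hw => hM w (by simp [hw])) hM' h.symm h1
      have huv : u = v := Prod.ext h1 (by omega)
      subst huv
      rw [concatWord_cons, concatWord_cons, List.append_cancel_left_eq] at h
      rw [ih (fun w hw => hL w (by simp [hw])) (fun w hw => hM w (by simp [hw]))
        (List.pairwise_cons.mp hL').2 (List.pairwise_cons.mp hM').2 h]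

/-- Ordered monomials are linearly independent if each of their leading words is detected by a
linear form that vanishes on all greater words. -/
theorem linearIndependent_rootProd {K A V : Type*} [Field K] [Ring A] [Algebra K A]
    [AddCommGroup V] [Module K V] {n : ℕ} {r : K} {x : ℕ → A}
    (h : ∀ L : List (ℕ × ℕ), (∀ u ∈ L, IsSeg (n - 1) u) → L.Pairwise SegGE →
      ∃ φ : A →ₗ[K] V, (∀ w, φ (wordProd x w) ≠ 0 → w ≤ concatWord L) ∧
        φ (wordProd x (concatWord L)) ≠ 0) :
    LinearIndependent K fun ℓ : PosRoot n → ℕ => rootProd r x (segList ℓ) := by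
  classical
  -- In a linear relation, take the monomial with the smallest leading word and apply its form.
  rw [linearIndependent_iff']
  intro T g hg
  by_contra hne
  push Not at hne
  obtain ⟨ℓ₁, hℓ₁, hg₁⟩ := hne
  obtain ⟨ℓ₀, hℓ₀, hmin⟩ := (T.filter fun ℓ => g ℓ ≠ 0).exists_min_image
    (fun ℓ => concatWord (segList ℓ)) ⟨ℓ₁, by simp [hℓ₁, hg₁]⟩
  rw [Finset.mem_filter] at hℓ₀
  obtain ⟨φ, hφ, hφ0⟩ := h (segList ℓ₀) (segList_isSeg ℓ₀) (segList_pairwise ℓ₀)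
  have key : ∀ ℓ ∈ T, g ℓ ≠ 0 → φ (rootProd r x (segList ℓ))
      = φ (wordProd x (concatWord (segList ℓ))) := by
    intro ℓ hℓ hgℓ
    have hle := hmin ℓ (by simp [hℓ, hgℓ])
    have hmem := rootProd_sub_wordProd_mem r x (segList ℓ) fun u hu => (segList_isSeg ℓ u hu).1
    have hker : spanAbove K x (concatWord (segList ℓ)) ≤ LinearMap.ker φ := by
      refine Submodule.span_le.mpr ?_
      rintro y ⟨v, hv, _, rfl⟩
      by_contra hy
      exact absurd (hφ v hy) (not_le.mpr (hle.trans_lt hv))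
    have := hker hmem
    rwa [LinearMap.mem_ker, map_sub, sub_eq_zero] at this
  have h0 := congrArg φ hg
  rw [map_sum, map_zero, Finset.sum_eq_single ℓ₀] at h0
  · rw [map_smul, key ℓ₀ hℓ₀.1 hℓ₀.2] at h0
    exact (smul_ne_zero hℓ₀.2 hφ0) h0
  · intro ℓ hℓ hne
    rw [map_smul]
    by_cases hgℓ : g ℓ = 0
    · rw [hgℓ, zero_smul]
    · rw [key ℓ hℓ hgℓ]
      by_contra hy
      have h1 := hφ _ (right_ne_zero_of_smul hy)
      have h2 := hmin ℓ (by simp [hℓ, hgℓ])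
      exact hne (segList_injective n (concatWord_injOn (segList_isSeg ℓ) (segList_isSeg ℓ₀)
        (segList_pairwise ℓ) (segList_pairwise ℓ₀) (le_antisymm h1 h2)))
  · intro h; exact absurd hℓ₀.1 h

end Independence

/-! ### Weighted paths of configurations -/

section Paths

variable {F P : Type*} [Field F] [Fintype P] [DecidableEq P]

/-- The sum over all ways to go from the configuration `m` to the configuration `e` by moving, for
each letter `i` of the word in turn, some site from `i` to `i + 1`; moving the site `p` in the
configuration `m` has the weight `c m p`. -/
def pathSum (c : (P → ℕ) → P → F) (e : P → ℕ) : List ℕ → (P → ℕ) → F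
  | [], m => if m = e then 1 else 0
  | i :: w, m => ∑ p, if m p = i then c m p * pathSum c e w (Function.update m p (i + 1)) else 0

/-- The concatenation of the intervals that remain for the sites in `S`. -/
def siteWord (e m : P → ℕ) (S : List P) : List ℕ := S.flatMap fun p => segWord (m p, e p)

variable {c : (P → ℕ) → P → F} {e : P → ℕ}

theorem exists_of_pathSum_cons_ne_zero {i : ℕ} {w : List ℕ} {m : P → ℕ}
    (h : pathSum c e (i :: w) m ≠ 0) :
    ∃ p, m p = i ∧ pathSum c e w (Function.update m p (i + 1)) ≠ 0 := by
  obtain ⟨p, _, hp⟩ := Finset.exists_ne_zero_of_sum_ne_zero h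
  by_cases hm : m p = i
  · rw [if_pos hm] at hp
    exact ⟨p, hm, right_ne_zero_of_mul hp⟩
  · rw [if_neg hm] at hp; exact absurd rfl hp

theorem le_of_pathSum_ne_zero {w : List ℕ} {m : P → ℕ} (h : pathSum c e w m ≠ 0) (q : P) :
    m q ≤ e q := by
  induction w generalizing m with
  | nil =>
    by_cases hm : m = e
    · rw [hm]
    · simp [pathSum, hm] at h
  | cons i w ih =>
    obtain ⟨p, hp, h'⟩ := exists_of_pathSum_cons_ne_zero h
    have := ih h'
    by_cases hq : q = p
    · subst hq
      rw [Function.update_self] at this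
      omega
    · rwa [Function.update_of_ne hq] at this

theorem siteWord_update {m : P → ℕ} {S : List P} {p : P} (hp : p ∉ S) (y : ℕ) :
    siteWord e (Function.update m p y) S = siteWord e m S := by
  unfold siteWord
  refine List.flatMap_congr fun q hq => ?_
  rw [Function.update_of_ne]
  rintro rfl; exact hp hq

theorem segWord_append_lt {m : P → ℕ} {u p : P} {T : List P} (hp : m p < e p)
    (hmu : m p = m u) (heu : e p < e u) (hup : u ≠ p) :
    segWord (m p, e p) ++ siteWord e m ((u :: T).erase p) < siteWord e m (u :: T) := by
  have e1 : segWord (m u, e u) = segWord (m p, e p) ++ segWord (e p, e u) := by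
    rw [← hmu]; exact segWord_append hp.le heu.le
  have e2 : (u :: T).erase p = u :: T.erase p := by
    rw [List.erase_cons_tail]; simpa using hup
  rw [e2]
  simp only [siteWord, List.flatMap_cons]
  rw [e1]
  simp only [List.append_assoc]
  rw [append_lt_append_left_iff, segWord_eq_cons (u := (m p, e p)) hp,
    segWord_eq_cons (u := (e p, e u)) heu]
  simp only [List.cons_append]
  rw [List.cons_lt_cons_iff]
  exact Or.inl hp

/-- Taking the intervals in decreasing order gives the greatest word. -/
theorem segWord_append_le {m : P → ℕ} {S : List P} (hS : ∀ q ∈ S, m q < e q)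
    (hp : S.Pairwise fun q q' => SegGE (m q, e q) (m q', e q')) {p : P} (hpS : p ∈ S) :
    segWord (m p, e p) ++ siteWord e m (S.erase p) ≤ siteWord e m S := by
  induction S with
  | nil => simp at hpS
  | cons u T ih =>
    by_cases hup : u = p
    · subst hup
      simp [siteWord]
    · have hT : p ∈ T := by
        rcases List.mem_cons.mp hpS with h | h
        · exact absurd h.symm hup
        · exact h
      have hpe := hS p hpS
      rw [List.pairwise_cons] at hp
      rcases hp.1 p hT with h | ⟨h, h'⟩
      · refine le_of_lt ?_
        have e2 : siteWord e m (u :: T) = segWord (m u, e u) ++ siteWord e m T := by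
          simp [siteWord]
        rw [e2, segWord_eq_cons (u := (m p, e p)) hpe,
          segWord_eq_cons (u := (m u, e u)) (hS u (by simp)), List.cons_append, List.cons_append,
          List.cons_lt_cons_iff]
        exact Or.inl h
      · simp only at h h'
        rcases eq_or_lt_of_le h' with h'' | h''
        · have e2 : (u :: T).erase p = u :: T.erase p := by
            rw [List.erase_cons_tail]; simpa using hup
          have := ih (fun q hq => hS q (by simp [hq])) hp.2 hT
          rw [e2]
          have e3 : ∀ S : List P, siteWord e m (u :: S) = segWord (m u, e u) ++ siteWord e m S := by
            intro S; simp [siteWord]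
          rw [e3, e3, ← h, ← h'']
          rw [← not_lt] at this ⊢
          rwa [append_lt_append_left_iff]
        · exact (segWord_append_lt hpe h h'' hup).le

/-- If a site with the greatest position moves and the rest of the word is at most the decreasing
concatenation of what remains, then the whole word is at most the word that takes the interval of
this site first. -/
theorem cons_le_segWord_append {m : P → ℕ} {S : List P} (hn : S.Nodup)
    (hS : ∀ q, q ∈ S ↔ m q < e q)
    (hp : S.Pairwise fun q q' => SegGE (m q, e q) (m q', e q')) {p : P} (hpe : m p < e p)
    (hmax : ∀ q ∈ S, m q ≤ m p) {w : List ℕ} {m' : P → ℕ}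
    (hm' : m' = Function.update m p (m p + 1))
    (hw : ∀ S' : List P, S'.Nodup → (∀ q, q ∈ S' ↔ m' q < e q) →
      (S'.Pairwise fun q q' => SegGE (m' q, e q) (m' q', e q')) → w ≤ siteWord e m' S') :
    m p :: w ≤ segWord (m p, e p) ++ siteWord e m (S.erase p) := by
  have hnm : p ∉ S.erase p := hn.not_mem_erase
  have mp : m' p = m p + 1 := by rw [hm', Function.update_self]
  have mq : ∀ q, q ≠ p → m' q = m q := fun q hq => by rw [hm', Function.update_of_ne hq]
  have hne : ∀ q ∈ S.erase p, q ≠ p := by rintro q hq rfl; exact hnm hq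
  have h4 : (S.erase p).Pairwise fun q q' => SegGE (m' q, e q) (m' q', e q') := by
    refine List.Pairwise.imp_of_mem ?_ (hp.sublist List.erase_sublist)
    intro q q' hq hq' h5
    rwa [mq q (hne q hq), mq q' (hne q' hq')]
  have e1 : ∀ S' : List P, S' = (if m p + 1 < e p then p :: S.erase p else S.erase p) →
      siteWord e m' S' = segWord (m p + 1, e p) ++ siteWord e m (S.erase p) := by
    rintro S' rfl
    split_ifs
    · have : siteWord e m' (p :: S.erase p) = segWord (m' p, e p) ++ siteWord e m' (S.erase p) := by
        simp [siteWord]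
      rw [this, mp, hm', siteWord_update hnm]
    · have : e p - (m p + 1) = 0 := by omega
      rw [hm', siteWord_update hnm]
      simp [segWord, this]
  have key := hw (if m p + 1 < e p then p :: S.erase p else S.erase p) (by
      split_ifs
      · exact List.nodup_cons.mpr ⟨hnm, hn.erase p⟩
      · exact hn.erase p) (by
      intro q
      by_cases hq : q = p
      · subst hq
        rw [mp]
        split_ifs with h3
        · simp [h3]
        · simp [h3, hnm]
      · rw [mq q hq]
        split_ifs with h3 <;> simp [hq, List.mem_erase_of_ne, hS]) (by
      split_ifs with h3
      · refine List.pairwise_cons.mpr ⟨fun q hq => Or.inl ?_, h4⟩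
        have := hmax q (List.mem_of_mem_erase hq)
        rw [mp, mq q (hne q hq)]
        simp only
        omega
      · exact h4)
  rw [e1 _ rfl] at key
  rw [segWord_eq_cons (u := (m p, e p)) hpe, List.cons_append]
  rw [← not_lt] at key ⊢
  rw [List.cons_lt_cons_iff]
  rintro (h | ⟨_, h⟩)
  · exact lt_irrefl _ h
  · exact key h

/-- Words with nonzero path sum are at most the decreasing concatenation of the remaining
intervals. -/
theorem le_siteWord_of_pathSum_ne_zero {w : List ℕ} {m : P → ℕ} (h : pathSum c e w m ≠ 0)
    {S : List P} (hn : S.Nodup) (hS : ∀ q, q ∈ S ↔ m q < e q)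
    (hp : S.Pairwise fun q q' => SegGE (m q, e q) (m q', e q')) : w ≤ siteWord e m S := by
  induction w generalizing m S with
  | nil => rw [← not_lt]; simp
  | cons i w ih =>
    obtain ⟨p, hpi, h'⟩ := exists_of_pathSum_cons_ne_zero h
    have hpe := le_of_pathSum_ne_zero h' p
    rw [Function.update_self] at hpe
    subst hpi
    have hpS := (hS p).mpr hpe
    by_cases hmax : ∀ q ∈ S, m q ≤ m p
    · exact (cons_le_segWord_append hn hS hp hpe hmax rfl fun S' h1 h2 h3 => ih h' h1 h2 h3).trans
        (segWord_append_le (fun q hq => (hS q).mp hq) hp hpS)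
    · push Not at hmax
      obtain ⟨q, hq, hqp⟩ := hmax
      cases S with
      | nil => simp at hq
      | cons u T =>
        have hu : m q ≤ m u := by
          rcases List.mem_cons.mp hq with rfl | hq
          · exact le_rfl
          · have := (List.pairwise_cons.mp hp).1 q hq
            unfold SegGE at this
            simp only at this
            omega
        have e2 : siteWord e m (u :: T) = segWord (m u, e u) ++ siteWord e m T := by
          simp [siteWord]
        refine le_of_lt ?_
        rw [e2, segWord_eq_cons (u := (m u, e u)) ((hS u).mp (by simp)), List.cons_append,
          List.cons_lt_cons_iff]
        left
        simp only
        omega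

end Paths

section OrderedPath

variable {F : Type*} [Field F] {k : ℕ} {a e : Fin k → ℕ} {c : (Fin k → ℕ) → Fin k → F}

/-- The configuration in which the first `j` sites have arrived and all others have not moved. -/
def arrived (a e : Fin k → ℕ) (j : ℕ) : Fin k → ℕ := fun o => if (o : ℕ) < j then e o else a o

theorem mem_drop_finRange {j : ℕ} {q : Fin k} : q ∈ (List.finRange k).drop j ↔ j ≤ q := by
  rw [List.mem_drop_iff_getElem]
  constructor
  · rintro ⟨i, hi, rfl⟩
    simp
  · intro h
    exact ⟨q - j, by simp; omega, by ext; simp; omega⟩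

theorem drop_finRange {j : ℕ} (hj : j < k) :
    (List.finRange k).drop j = ⟨j, hj⟩ :: (List.finRange k).drop (j + 1) := by
  rw [List.drop_eq_getElem_cons (by simpa using hj)]
  simp

theorem drop_finRange_pairwise (j : ℕ) :
    ((List.finRange k).drop j).Pairwise fun p q => p < q :=
  (List.pairwise_lt_finRange k).sublist (List.drop_sublist _ _)

theorem siteWord_congr {P : Type*} {e m m' : P → ℕ} {S : List P}
    (h : ∀ q ∈ S, m q = m' q) : siteWord e m S = siteWord e m' S :=
  List.flatMap_congr fun q hq => by rw [h q hq]

theorem siteWord_cons {P : Type*} {e m : P → ℕ} (p : P) (S : List P) :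
    siteWord e m (p :: S) = segWord (m p, e p) ++ siteWord e m S := by
  simp [siteWord]

/-- The only path with nonzero weight along the decreasing concatenation of the intervals lets the
sites arrive one after the other. -/
theorem pathSum_siteWord_ne_zero (ha : ∀ p, a p < e p)
    (hs : ∀ p q, p < q → SegGE (a p, e p) (a q, e q))
    (hc : ∀ (j : Fin k) (t : ℕ), a j ≤ t → t < e j →
      c (Function.update (arrived a e j) j t) j ≠ 0)
    (hc' : ∀ j p : Fin k, j < p → a p = a j → e p = e j → ∀ w,
      c (arrived a e j) p * pathSum c e w (Function.update (arrived a e j) p (a p + 1)) = 0) :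
    pathSum c e (siteWord e a (List.finRange k)) a ≠ 0 := by
  suffices h : ∀ d j : ℕ, j + d = k →
      pathSum c e (siteWord e a ((List.finRange k).drop j)) (arrived a e j) ≠ 0 by
    have h0 := h k 0 (zero_add k)
    rwa [List.drop_zero, show arrived a e 0 = a by ext o; simp [arrived]] at h0
  intro d
  induction d with
  | zero =>
    intro j hj
    obtain rfl : j = k := by omega
    rw [List.drop_of_length_le (by simp), show arrived a e j = e by ext o; simp [arrived]]
    simp [siteWord, pathSum]
  | succ d ih =>
    intro j hj
    have hjk : j < k := by omega
    set J : Fin k := ⟨j, hjk⟩ with hJ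
    have hJv : (J : ℕ) = j := rfl
    have hih := ih (j + 1) (by omega)
    set T := (List.finRange k).drop (j + 1) with hT
    have hTm : ∀ q, q ∈ T ↔ j + 1 ≤ (q : ℕ) := fun q => mem_drop_finRange
    have inner : ∀ d' t : ℕ, t + d' = e J → a J ≤ t →
        pathSum c e (segWord (t, e J) ++ siteWord e a T)
          (Function.update (arrived a e j) J t) ≠ 0 := by
      intro d'
      induction d' with
      | zero =>
        intro t ht _
        obtain rfl : t = e J := by omega
        have e1 : segWord (e J, e J) = [] := by simp [segWord]
        have e2 : Function.update (arrived a e j) J (e J) = arrived a e (j + 1) := by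
          ext o
          by_cases ho : o = J
          · subst ho; simp [arrived, hJ]
          · have : (o : ℕ) ≠ j := fun h => ho (Fin.ext h)
            rw [Function.update_of_ne ho]
            simp only [arrived]
            by_cases h1 : (o : ℕ) < j
            · rw [if_pos h1, if_pos (by omega)]
            · rw [if_neg h1, if_neg (by omega)]
        rw [e1, e2, List.nil_append]
        exact hih
      | succ d' ih' =>
        intro t ht hat
        have hte : t < e J := by omega
        set m := Function.update (arrived a e j) J t with hm
        have mJ : m J = t := Function.update_self ..
        have mlt : ∀ p : Fin k, (p : ℕ) < j → m p = e p := by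
          intro p hp
          rw [hm, Function.update_of_ne (by rintro rfl; omega), arrived, if_pos hp]
        have mgt : ∀ p : Fin k, j < (p : ℕ) → m p = a p := by
          intro p hp
          rw [hm, Function.update_of_ne (by rintro rfl; omega), arrived, if_neg (by omega)]
        have sge : ∀ p : Fin k, j < (p : ℕ) → SegGE (a J, e J) (a p, e p) := fun p hp =>
          hs J p hp
        rw [segWord_eq_cons (u := (t, e J)) hte, List.cons_append, pathSum,
          Finset.sum_eq_single J]
        · rw [if_pos mJ]
          refine mul_ne_zero (hc J t hat hte) ?_
          have := ih' (t + 1) (by omega) (by omega)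
          rw [hm, Function.update_idem]
          exact this
        · intro p _ hpJ
          rw [ite_eq_right_iff]
          intro hpt
          have hpj : (p : ℕ) ≠ j := fun h => hpJ (Fin.ext h)
          rcases lt_or_gt_of_ne hpj with hlt | hgt
          · -- a site that has arrived cannot move on
            by_contra hne
            have h1 := le_of_pathSum_ne_zero (right_ne_zero_of_mul hne) p
            rw [Function.update_self] at h1
            have := mlt p hlt
            simp only at h1 hpt
            omega
          · have h1 := mgt p hgt
            have h2 := sge p hgt
            simp only at hpt
            have hpa : a p = t := by omega
            have hap := ha p
            unfold SegGE at h2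
            simp only at h2
            have hta : t = a J := by omega
            have hmj : m = arrived a e J := by
              rw [hm, hta]
              ext o
              by_cases ho : o = J
              · subst ho; simp [arrived]
              · rw [Function.update_of_ne ho]
            rcases eq_or_lt_of_le (show e p ≤ e J by omega) with he | he
            · rw [hmj]
              simp only
              rw [← hpa]
              exact hc' J p hgt (by omega) he _
            · -- starting a shorter interval leads to a smaller word
              by_contra hne
              have hm' := right_ne_zero_of_mul hne
              have hSm : ∀ q, q ∈ J :: T ↔ m q < e q := by
                intro q
                rw [List.mem_cons, hTm]
                by_cases hq : (q : ℕ) < j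
                · rw [mlt q hq]
                  simp only [lt_self_iff_false, iff_false, not_or]
                  exact ⟨by rintro rfl; omega, by omega⟩
                · by_cases hqJ : q = J
                  · subst hqJ; simp [mJ, hte]
                  · have hqj : (q : ℕ) ≠ j := fun h => hqJ (Fin.ext h)
                    rw [mgt q (by omega)]
                    have := ha q
                    simp only [hqJ, false_or]
                    constructor
                    · intro _; exact this
                    · intro _; omega
              have hpw : (J :: T).Pairwise fun q q' => SegGE (m q, e q) (m q', e q') := by
                have h5 := drop_finRange_pairwise (k := k) j
                rw [drop_finRange hjk] at h5
                refine List.Pairwise.imp_of_mem ?_ h5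
                intro q q' hq hq' hqq
                have hq1 : j ≤ (q : ℕ) := by
                  rcases List.mem_cons.mp hq with rfl | hq
                  · exact le_rfl
                  · have := (hTm q).mp hq; omega
                have e1 : ∀ q : Fin k, j ≤ (q : ℕ) → m q = a q := by
                  intro q hq
                  rcases eq_or_lt_of_le hq with h | h
                  · obtain rfl : q = J := Fin.ext h.symm
                    rw [mJ, hta]
                  · exact mgt q h
                rw [e1 q hq1, e1 q' (hq1.trans (Fin.lt_def.mp hqq).le)]
                exact hs q q' hqq
              have hn : (J :: T).Nodup := by
                have h5 := drop_finRange_pairwise (k := k) j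
                rw [drop_finRange hjk] at h5
                exact h5.imp fun h => h.ne
              have hmax : ∀ q ∈ J :: T, m q ≤ m p := by
                intro q hq
                rw [hpt]
                rcases List.mem_cons.mp hq with rfl | hq
                · exact mJ.le
                · have h6 := (hTm q).mp hq
                  rw [mgt q (by omega)]
                  have := sge q (by omega)
                  unfold SegGE at this
                  simp only at this
                  omega
              have h7 := cons_le_segWord_append hn hSm hpw (p := p) (by omega) hmax rfl
                fun S' k1 k2 k3 => le_siteWord_of_pathSum_ne_zero (by
                  simp only [hpt]; exact hm') k1 k2 k3
              have h8 := segWord_append_lt (m := m) (e := e) (T := T) (u := J) (p := p) (by omega)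
                (by omega) he hpJ.symm
              refine absurd (h7.trans_lt h8) ?_
              rw [siteWord_cons, mJ, segWord_eq_cons (u := (t, e J)) hte, hpt, List.cons_append,
                siteWord_congr (m' := a) fun q hq => mgt q (by have := (hTm q).mp hq; omega)]
              exact lt_irrefl _
        · intro h; exact absurd (Finset.mem_univ _) h
    have h0 := inner (e J - a J) (a J) (by have := ha J; omega) le_rfl
    rw [drop_finRange hjk, siteWord_cons]
    have e1 : Function.update (arrived a e j) J (a J) = arrived a e j := by
      have : a J = arrived a e j J := by simp [arrived, hJ]
      rw [this, Function.update_eq_self]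
    rwa [e1] at h0

end OrderedPath

/-! ### Matrix coefficients of the representation -/

section MatrixCoefficients

variable {L P : Type*} [Field L] [Fintype P] [DecidableEq P] {z : P → L} {a b : L}

/-- Words in the `x_i^+` carry the delta function at `e` to the path sums with end `e`. -/
theorem pos_word_single (e m : P → ℕ) (w : List ℕ) :
    (w.map fun i => ∑ p, siteOp z a b PM.pos i p).prod (Pi.single e 1) m
      = pathSum (fun m p => coef z (a ^ 2) (b ^ 2) (m p) m p) e w m := by
  induction w generalizing m with
  | nil => simp [pathSum, Pi.single_apply]
  | cons i w ih =>
    rw [List.map_cons, List.prod_cons, Module.End.mul_apply, LinearMap.sum_apply,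
      Finset.sum_apply, pathSum]
    refine Finset.sum_congr rfl fun p _ => ?_
    rw [siteOp, move_apply, ih]
    split_ifs with h
    · rw [h]
    · rfl

theorem neg_single (m : P → ℕ) (i : ℕ) :
    (∑ p, siteOp z a b PM.neg i p) (Pi.single m 1) =
      ∑ p, if m p = i then coef z (b ^ 2) (a ^ 2) (m p + 1) m p •
        (Pi.single (Function.update m p (i + 1)) 1 : (P → ℕ) → L) else 0 := by
  ext m'
  rw [LinearMap.sum_apply, Finset.sum_apply, Finset.sum_apply]
  refine Finset.sum_congr rfl fun p _ => ?_
  rw [siteOp, move_apply, Pi.single_apply]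
  by_cases h : m' p = i + 1 ∧ Function.update m' p i = m
  · obtain ⟨h1, rfl⟩ := h
    rw [if_pos h1, if_pos rfl, Function.update_self, if_pos rfl, Function.update_idem,
      show Function.update m' p (i + 1) = m' by rw [← h1, Function.update_eq_self], Pi.smul_apply,
      Pi.single_eq_same, coef_update_self]
    rfl
  · have hr : ¬ (m p = i ∧ m' = Function.update m p (i + 1)) := by
      rintro ⟨h1, rfl⟩
      exact h ⟨Function.update_self .., by
        rw [Function.update_idem, ← h1, Function.update_eq_self]⟩
    have e1 : (if m' p = i + 1 then coef z (b ^ 2) (a ^ 2) (i + 1) m' p *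
        (if Function.update m' p i = m then 1 else 0) else 0) = (0 : L) := by
      split_ifs with h1 h2
      · exact absurd ⟨h1, h2⟩ h
      · rw [mul_zero]
      · rfl
    rw [e1]
    split_ifs with h1
    · rw [Pi.smul_apply, Pi.single_eq_of_ne (fun h2 => hr ⟨h1, h2⟩), smul_zero]
    · rfl

/-- Reversed words in the `x_i^-` have the path sums as coefficients with the start and the end of
the paths exchanged: the operators act on functions, so `x_i^-` shifts delta functions upwards. -/
theorem neg_word_single (e m : P → ℕ) (w : List ℕ) :
    (w.map fun i => ∑ p, siteOp z a b PM.neg i p).reverse.prod (Pi.single m 1) e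
      = pathSum (fun m p => coef z (b ^ 2) (a ^ 2) (m p + 1) m p) e w m := by
  induction w generalizing m with
  | nil => simp [pathSum, Pi.single_apply, eq_comm]
  | cons i w ih =>
    rw [List.map_cons, List.reverse_cons, List.prod_append, List.prod_singleton,
      Module.End.mul_apply, neg_single, map_sum, Finset.sum_apply, pathSum]
    refine Finset.sum_congr rfl fun p _ => ?_
    split_ifs with h
    · rw [map_smul, Pi.smul_apply, ih, smul_eq_mul]
    · rw [map_zero]; rfl

end MatrixCoefficients

section Parameters

variable {F : Type*} [Field F] {k : ℕ}

/-- Spectral parameters for sites with the intervals `(a p, e p)`: those of the sites `p` and `o`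
resonate, in the sense that `r z_p = s z_o`, if and only if `p` is the successor of `o` and both
sites have the same interval. The resonances force sites with the same interval to move one after
the other. The Cantor pairing separates different intervals, and the exponent `k - p` lets the
power of `r` drop by one from a site to its successor. -/
def siteParam (r s : F) (a e : Fin k → ℕ) (p : Fin k) : F :=
  s ^ (p : ℕ) * r ^ (k - p + Nat.pair (a p) (e p))

/-- There are no multiplicative relations between `r` and `s`. -/
def MulIndep (r s : F) : Prop :=
  ∀ x y x' y' : ℕ, r ^ x * s ^ y = r ^ x' * s ^ y' → x = x' ∧ y = y'

variable {r s : F} {a e : Fin k → ℕ}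

theorem siteParam_injective (h : MulIndep r s) : Function.Injective (siteParam r s a e) := by
  intro p o hpo
  unfold siteParam at hpo
  rw [mul_comm, mul_comm (s ^ (o : ℕ))] at hpo
  exact Fin.ext (h _ _ _ _ hpo).2

theorem siteParam_ne_zero (hr : r ≠ 0) (hs : s ≠ 0) (p : Fin k) : siteParam r s a e p ≠ 0 :=
  mul_ne_zero (pow_ne_zero _ hs) (pow_ne_zero _ hr)

theorem siteParam_resonance (h : MulIndep r s) {p o : Fin k} :
    r * siteParam r s a e p = s * siteParam r s a e o ↔
      (p : ℕ) = o + 1 ∧ a p = a o ∧ e p = e o := by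
  have hp := p.isLt
  have ho := o.isLt
  have e1 : r * siteParam r s a e p
      = r ^ (k - p + Nat.pair (a p) (e p) + 1) * s ^ (p : ℕ) := by
    rw [siteParam]; ring
  have e2 : s * siteParam r s a e o
      = r ^ (k - o + Nat.pair (a o) (e o)) * s ^ ((o : ℕ) + 1) := by
    rw [siteParam]; ring
  rw [e1, e2]
  constructor
  · intro hpo
    obtain ⟨h1, h2⟩ := h _ _ _ _ hpo
    have h3 : Nat.pair (a p) (e p) = Nat.pair (a o) (e o) := by omega
    exact ⟨h2, Nat.pair_eq_pair.mp h3⟩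
  · rintro ⟨h1, h2, h3⟩
    rw [h1, h2, h3, show k - (o + 1) + Nat.pair (a o) (e o) + 1 = k - o + Nat.pair (a o) (e o) by
      omega]

/-- The matrix coefficient of the leading word in the raising generators does not vanish. -/
theorem pathSum_pos_ne_zero (h : MulIndep r s) (ha : ∀ p, a p < e p)
    (hs : ∀ p q, p < q → SegGE (a p, e p) (a q, e q)) :
    pathSum (fun m p => coef (siteParam r s a e) r s (m p) m p) e
      (siteWord e a (List.finRange k)) a ≠ 0 := by
  have hz := siteParam_injective (a := a) (e := e) h
  refine pathSum_siteWord_ne_zero ha hs ?_ ?_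
  · intro j t hat hte
    simp only [Function.update_self]
    refine Finset.prod_ne_zero_iff.mpr fun o ho => ?_
    have hoj := Finset.ne_of_mem_erase ho
    split_ifs with hot
    · refine div_ne_zero (fun h0 => ?_) (sub_ne_zero.mpr (hz.ne hoj.symm))
      obtain ⟨h1, h2, h3⟩ := (siteParam_resonance h).mp (sub_eq_zero.mp h0)
      rw [Function.update_of_ne hoj, arrived, if_pos (by omega)] at hot
      omega
    · exact one_ne_zero
  · -- the preceding site has the same interval and is still in the same place
    intro j p hjp hap hep w
    have hjp' : (j : ℕ) < p := hjp
    have hp := p.isLt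
    set o : Fin k := ⟨p - 1, by omega⟩ with ho
    have hov : (o : ℕ) = p - 1 := rfl
    have hseg : a o = a p ∧ e o = e p := by
      rcases eq_or_ne o j with hoj | hoj
      · rw [hoj, hap, hep]; exact ⟨rfl, rfl⟩
      · have hoj' : (o : ℕ) ≠ j := fun h => hoj (Fin.ext h)
        have h1 := hs j o (Fin.lt_def.mpr (by omega))
        have h2 := hs o p (Fin.lt_def.mpr (by omega))
        unfold SegGE at h1 h2
        simp only at h1 h2
        omega
    have hop : o ≠ p := fun h => by have := congrArg Fin.val h; omega
    have hk : kap (siteParam r s a e) r s p o = 0 := by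
      rw [kap, (siteParam_resonance h).mpr ⟨by omega, hseg.1.symm, hseg.2.symm⟩, sub_self, zero_div]
    have hc : coef (siteParam r s a e) r s (arrived a e j p) (arrived a e j) p = 0 := by
      refine Finset.prod_eq_zero (Finset.mem_erase.mpr ⟨hop, Finset.mem_univ o⟩) ?_
      rw [if_pos, hk]
      rw [arrived, arrived, if_neg (by omega), if_neg (by omega), hseg.1]
    rw [hc, zero_mul]

/-- The matrix coefficient of the leading word in the lowering generators does not vanish. -/
theorem pathSum_neg_ne_zero (h : MulIndep r s) (ha : ∀ p, a p < e p)
    (hs : ∀ p q, p < q → SegGE (a p, e p) (a q, e q)) :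
    pathSum (fun m p => coef (siteParam r s a e) s r (m p + 1) m p) e
      (siteWord e a (List.finRange k)) a ≠ 0 := by
  have hz := siteParam_injective (a := a) (e := e) h
  -- Of two consecutive sites with the same interval, the first one cannot catch up once it is behind.
  have stuck : ∀ (w : List ℕ) (m : Fin k → ℕ) (o p : Fin k), (p : ℕ) = o + 1 → a p = a o →
      e p = e o → m o < m p →
      pathSum (fun m p => coef (siteParam r s a e) s r (m p + 1) m p) e w m = 0 := by
    intro w
    induction w with
    | nil =>
      intro m o p _ _ he hm
      rw [pathSum, if_neg]
      rintro rfl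
      omega
    | cons i w ih =>
      intro m o p hpo hap he hm
      have hne : o ≠ p := fun h => by have := congrArg Fin.val h; omega
      rw [pathSum]
      refine Finset.sum_eq_zero fun q _ => ?_
      split_ifs with hq
      · by_cases hqo : q = o
        · subst hqo
          by_cases hlt : i + 1 < m p
          · rw [ih _ q p hpo hap he (by
              rw [Function.update_self, Function.update_of_ne hne.symm]; exact hlt), mul_zero]
          · have hk : kap (siteParam r s a e) s r q p = 0 := by
              rw [kap, ← (siteParam_resonance h).mpr ⟨hpo, hap, he⟩, sub_self, zero_div]
            have hc : coef (siteParam r s a e) s r (m q + 1) m q = 0 := by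
              refine Finset.prod_eq_zero (Finset.mem_erase.mpr ⟨hne.symm, Finset.mem_univ p⟩) ?_
              rw [if_pos (by omega), hk]
            rw [hc, zero_mul]
        · rw [ih _ o p hpo hap he, mul_zero]
          rw [Function.update_of_ne (Ne.symm hqo)]
          by_cases hqp : q = p
          · subst hqp
            rw [Function.update_self]; omega
          · rwa [Function.update_of_ne (Ne.symm hqp)]
      · rfl
  refine pathSum_siteWord_ne_zero ha hs ?_ ?_
  · intro j t hat hte
    simp only [Function.update_self]
    refine Finset.prod_ne_zero_iff.mpr fun o ho => ?_
    have hoj := Finset.ne_of_mem_erase ho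
    split_ifs with hot
    · refine div_ne_zero (fun h0 => ?_) (sub_ne_zero.mpr (hz.ne hoj.symm))
      obtain ⟨h1, h2, h3⟩ := (siteParam_resonance h).mp (sub_eq_zero.mp h0).symm
      rw [Function.update_of_ne hoj, arrived, if_neg (by omega)] at hot
      omega
    · exact one_ne_zero
  · intro j p hjp hap hep w
    have hjp' : (j : ℕ) < p := hjp
    have hp := p.isLt
    set o : Fin k := ⟨p - 1, by omega⟩ with ho
    have hov : (o : ℕ) = p - 1 := rfl
    have hseg : a o = a p ∧ e o = e p := by
      rcases eq_or_ne o j with hoj | hoj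
      · rw [hoj, hap, hep]; exact ⟨rfl, rfl⟩
      · have hoj' : (o : ℕ) ≠ j := fun h => hoj (Fin.ext h)
        have h1 := hs j o (Fin.lt_def.mpr (by omega))
        have h2 := hs o p (Fin.lt_def.mpr (by omega))
        unfold SegGE at h1 h2
        simp only at h1 h2
        omega
    have hop : o ≠ p := fun h => by have := congrArg Fin.val h; omega
    rw [stuck w _ o p (by omega) hseg.1.symm hseg.2.symm, mul_zero]
    rw [Function.update_self, Function.update_of_ne hop, arrived, if_neg (by omega), hseg.1]
    exact Nat.lt_succ_self _

/-- All words with a nonzero matrix coefficient are at most the decreasing concatenation of the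
intervals. -/
theorem le_siteWord_of_pathSum_start {c : (Fin k → ℕ) → Fin k → F} (ha : ∀ p, a p < e p)
    (hs : ∀ p q, p < q → SegGE (a p, e p) (a q, e q)) {w : List ℕ} (hw : pathSum c e w a ≠ 0) :
    w ≤ siteWord e a (List.finRange k) :=
  le_siteWord_of_pathSum_ne_zero hw (List.nodup_finRange k) (by simp [ha])
    ((List.pairwise_lt_finRange k).imp fun h => hs _ _ h)

end Parameters

/-! ### Linear independence of the ordered monomials -/

section Independence

variable {K : Type*} [Field K] {n : ℕ} {rh sh : K}

theorem concatWord_eq_siteWord (S : List (ℕ × ℕ)) :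
    concatWord S = siteWord (fun p : Fin S.length => (S.get p).2) (fun p => (S.get p).1)
      (List.finRange S.length) := by
  conv_lhs => rw [← List.map_get_finRange S, concatWord, List.flatMap_map]
  rfl

theorem MulIndep.ne {r s : K} (h : MulIndep r s) : r ≠ s := by
  rintro rfl
  have := (h 1 0 0 1 (by simp)).1
  omega

theorem MulIndep.left_ne_zero {r s : K} (h : MulIndep r s) : r ≠ 0 := by
  rintro rfl
  have := (h 1 0 2 0 (by simp)).1
  omega

theorem MulIndep.right_ne_zero {r s : K} (h : MulIndep r s) : s ≠ 0 := by
  rintro rfl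
  have := (h 0 1 0 2 (by simp)).2
  omega

theorem MulIndep.map {r s : K} (h : MulIndep r s) {F : Type*} [Field F] (φ : K →+* F) :
    MulIndep (φ r) (φ s) := by
  intro x y x' y' he
  refine h x y x' y' (φ.injective ?_)
  simpa using he

/-- Matrix coefficients of operators, as linear forms over the ground field. -/
def matrixCoeff (K : Type*) {F S : Type*} [Field K] [Field F] [Algebra K F] (f : S → F) (m : S) :
    Module.End F (ℤ → S → F) →ₗ[K] F where
  toFun T := T (fun _ => f) 0 m
  map_add' _ _ := rfl
  map_smul' _ _ := rfl

theorem lift_zero_prod_apply {F S : Type*} [Field F] (l : List (Module.End F (S → F))) (f : S → F) :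
    (l.map fun T => lift T 0).prod (fun _ => f) = fun _ => l.prod f := by
  induction l with
  | nil => rfl
  | cons T l ih =>
    rw [List.map_cons, List.prod_cons, Module.End.mul_apply, ih]
    rfl

/-- The linear forms that detect the leading words. The site `p` starts at the lower end of the
`p`-th interval and has to end at its upper end. The algebraic closure provides the square root of
`(r s)^{1/2}` by which `γ^{1/2} = γ'^{1/2}` acts. -/
theorem exists_detecting_forms [CharZero K] (hind : MulIndep (rh ^ 2) (sh ^ 2))
    {L : List (ℕ × ℕ)} (hL : ∀ u ∈ L, IsSeg (n - 1) u) (hp : L.Pairwise SegGE) :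
    (∃ φ : Uaff n (rh ^ 2) (sh ^ 2) rh sh →ₗ[K] AlgebraicClosure K,
      (∀ w, φ (wordProd (extZero (xgen n (rh ^ 2) (sh ^ 2) rh sh PM.pos 0)) w) ≠ 0 →
        w ≤ concatWord L) ∧
      φ (wordProd (extZero (xgen n (rh ^ 2) (sh ^ 2) rh sh PM.pos 0)) (concatWord L)) ≠ 0) ∧
    (∃ φ : (Uaff n (rh ^ 2) (sh ^ 2) rh sh)ᵐᵒᵖ →ₗ[K] AlgebraicClosure K,
      (∀ w, φ (wordProd (extZero fun i =>
          MulOpposite.op (xgen n (rh ^ 2) (sh ^ 2) rh sh PM.neg 0 i)) w) ≠ 0 →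
        w ≤ concatWord L) ∧
      φ (wordProd (extZero fun i =>
          MulOpposite.op (xgen n (rh ^ 2) (sh ^ 2) rh sh PM.neg 0 i)) (concatWord L)) ≠ 0) := by
  set F := AlgebraicClosure K
  set r := algebraMap K F rh ^ 2 with hr
  set s := algebraMap K F sh ^ 2 with hs
  have hind' : MulIndep r s := by
    have := hind.map (algebraMap K F)
    rwa [map_pow, map_pow] at this
  set a : Fin L.length → ℕ := fun p => (L.get p).1 with ha
  set e : Fin L.length → ℕ := fun p => (L.get p).2 with he
  have hae : ∀ p, a p < e p := fun p => (hL _ (L.get_mem p)).1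
  have hsort : ∀ p q, p < q → SegGE (a p, e p) (a q, e q) := fun p q hpq =>
    List.pairwise_iff_get.mp hp p q hpq
  set z := siteParam r s a e with hz
  have hrh : rh ≠ 0 := fun h => hind.left_ne_zero (by rw [h]; simp)
  have hsh : sh ≠ 0 := fun h => hind.right_ne_zero (by rw [h]; simp)
  obtain ⟨h, hh⟩ := IsAlgClosed.exists_pow_nat_eq (algebraMap K F (rh * sh)) two_pos
  obtain ⟨ρ, hρ⟩ := exists_rep (z := z) (h := h) n (siteParam_injective hind')
    (siteParam_ne_zero hind'.left_ne_zero hind'.right_ne_zero) hrh hsh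
    (sub_ne_zero.mpr hind.ne) hh
  have hlt : ∀ i ∈ concatWord L, i < n - 1 := mem_concatWord_lt hL
  refine ⟨⟨(matrixCoeff K (Pi.single e 1) a).comp ρ.toLinearMap, ?_⟩,
    ⟨((matrixCoeff K (Pi.single a 1) e).comp ρ.toLinearMap).comp
      (MulOpposite.opLinearEquiv K).symm.toLinearMap, ?_⟩⟩
  · have key : ∀ w : List ℕ, (∀ i ∈ w, i < n - 1) →
        ((matrixCoeff K (Pi.single e 1) a).comp ρ.toLinearMap)
          (wordProd (extZero (xgen n (rh ^ 2) (sh ^ 2) rh sh PM.pos 0)) w)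
        = pathSum (fun m p => coef z r s (m p) m p) e w a := by
      intro w hw
      obtain ⟨v, rfl⟩ := exists_map_val hw
      rw [wordProd_extZero, LinearMap.comp_apply, AlgHom.toLinearMap_apply, map_list_prod,
        List.map_map]
      have e1 : v.map (ρ ∘ xgen n (rh ^ 2) (sh ^ 2) rh sh PM.pos 0)
          = ((v.map Fin.val).map fun i => ∑ p, siteOp z (algebraMap K F rh) (algebraMap K F sh)
            PM.pos i p).map fun T => lift T 0 := by
        rw [List.map_map, List.map_map]
        exact List.map_congr_left fun i _ => hρ PM.pos i
      rw [e1, matrixCoeff, LinearMap.coe_mk, AddHom.coe_mk, lift_zero_prod_apply]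
      exact pos_word_single e a _
    constructor
    · intro w hw
      by_cases hb : ∀ i ∈ w, i < n - 1
      · rw [key w hb] at hw
        rw [concatWord_eq_siteWord]
        exact le_siteWord_of_pathSum_start hae hsort hw
      · rw [wordProd_extZero_eq_zero _ hb, map_zero] at hw
        exact absurd rfl hw
    · rw [key _ hlt, concatWord_eq_siteWord]
      exact pathSum_pos_ne_zero hind' hae hsort
  · have key : ∀ w : List ℕ, (∀ i ∈ w, i < n - 1) →
        (((matrixCoeff K (Pi.single a 1) e).comp ρ.toLinearMap).comp
          (MulOpposite.opLinearEquiv K).symm.toLinearMap)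
          (wordProd (extZero fun i =>
            MulOpposite.op (xgen n (rh ^ 2) (sh ^ 2) rh sh PM.neg 0 i)) w)
        = pathSum (fun m p => coef z s r (m p + 1) m p) e w a := by
      intro w hw
      obtain ⟨v, rfl⟩ := exists_map_val hw
      rw [wordProd_extZero, LinearMap.comp_apply, LinearMap.comp_apply, AlgHom.toLinearMap_apply]
      have e0 : (MulOpposite.opLinearEquiv K).symm.toLinearMap
          (v.map fun i => MulOpposite.op (xgen n (rh ^ 2) (sh ^ 2) rh sh PM.neg 0 i)).prod
          = (v.map (xgen n (rh ^ 2) (sh ^ 2) rh sh PM.neg 0)).reverse.prod := by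
        have eu : ∀ y : (Uaff n (rh ^ 2) (sh ^ 2) rh sh)ᵐᵒᵖ,
            (MulOpposite.opLinearEquiv K).symm.toLinearMap y = MulOpposite.unop y := fun _ => rfl
        rw [eu, MulOpposite.unop_list_prod, List.map_map]
        rfl
      rw [e0, map_list_prod, List.map_reverse, List.map_map]
      have e1 : v.map (ρ ∘ xgen n (rh ^ 2) (sh ^ 2) rh sh PM.neg 0)
          = ((v.map Fin.val).map fun i => ∑ p, siteOp z (algebraMap K F rh) (algebraMap K F sh)
            PM.neg i p).map fun T => lift T 0 := by
        rw [List.map_map, List.map_map]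
        exact List.map_congr_left fun i _ => hρ PM.neg i
      rw [e1, ← List.map_reverse, matrixCoeff, LinearMap.coe_mk, AddHom.coe_mk,
        lift_zero_prod_apply]
      exact neg_word_single e a _
    constructor
    · intro w hw
      by_cases hb : ∀ i ∈ w, i < n - 1
      · rw [key w hb] at hw
        rw [concatWord_eq_siteWord]
        exact le_siteWord_of_pathSum_start hae hsort hw
      · rw [wordProd_extZero_eq_zero _ hb, map_zero] at hw
        exact absurd rfl hw
    · rw [key _ hlt, concatWord_eq_siteWord]
      exact pathSum_neg_ne_zero hind' hae hsort

end Independence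

/-! ### The Serre relations of the Drinfeld generators -/

section Serre

variable {K : Type*} [Field K] {n : ℕ} {r s rh sh : K}

theorem mkAlgHom_serreTerm (e : PM) (f : ℤ) (i j : Fin (n - 1)) :
    RingQuot.mkAlgHom K (DrinfeldRel K (n := n) r s rh sh) (serreTerm K r s e f i j 0 0 0) =
      xgen n r s rh sh e 0 i * xgen n r s rh sh e 0 i * xgen n r s rh sh e 0 j
      - (r ^ f + s ^ f) •
        (xgen n r s rh sh e 0 i * xgen n r s rh sh e 0 j * xgen n r s rh sh e 0 i)
      + ((r * s) ^ f) •
        (xgen n r s rh sh e 0 j * xgen n r s rh sh e 0 i * xgen n r s rh sh e 0 i) := by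
  simp only [serreTerm, map_add, map_sub, map_smul, map_mul, xgen]

theorem xgen_serre [CharZero K] (e : PM) {f : ℤ} {i j : Fin (n - 1)}
    (hf : (i : ℕ) + 1 = j ∧ f = e.sgn ∨ (j : ℕ) + 1 = i ∧ f = -e.sgn) :
    xgen n r s rh sh e 0 i * xgen n r s rh sh e 0 i * xgen n r s rh sh e 0 j
      - (r ^ f + s ^ f) •
        (xgen n r s rh sh e 0 i * xgen n r s rh sh e 0 j * xgen n r s rh sh e 0 i)
      + ((r * s) ^ f) •
        (xgen n r s rh sh e 0 j * xgen n r s rh sh e 0 i * xgen n r s rh sh e 0 i) = 0 := by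
  rw [← mkAlgHom_serreTerm]
  -- For `m₁ = m₂ = 0` the symmetrized relation is twice the one wanted.
  have h : RingQuot.mkAlgHom K (DrinfeldRel K (n := n) r s rh sh)
      (serreTerm K r s e f i j 0 0 0 + serreTerm K r s e f i j 0 0 0) = 0 := by
    rw [← map_zero (RingQuot.mkAlgHom K (DrinfeldRel K (n := n) r s rh sh))]
    rcases hf with ⟨hij, rfl⟩ | ⟨hij, rfl⟩
    · exact RingQuot.mkAlgHom_rel K (DrinfeldRel.serre_lt e i j 0 0 0 (cartan_near (Or.inl hij))
        (Fin.lt_def.mpr (by omega)))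
    · exact RingQuot.mkAlgHom_rel K (DrinfeldRel.serre_gt e i j 0 0 0 (cartan_near (Or.inr hij))
        (Fin.lt_def.mpr (by omega)))
  rw [map_add, ← two_smul K] at h
  exact (smul_eq_zero.mp h).resolve_left two_ne_zero

theorem xgen_comm (e : PM) {i j : Fin (n - 1)} (hA : CartanMatrix.A (n - 1) i j = 0) :
    xgen n r s rh sh e 0 i * xgen n r s rh sh e 0 j
      = xgen n r s rh sh e 0 j * xgen n r s rh sh e 0 i := by
  simp only [xgen, ← map_mul]
  exact RingQuot.mkAlgHom_rel K (DrinfeldRel.serre_comm e i j 0 0 hA)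

theorem satisfiesSerre_pos [CharZero K] (hr : r ≠ 0) (hs : s ≠ 0) :
    SatisfiesSerre r s (xgen n r s rh sh PM.pos 0) := by
  intro i j hij
  have hij' : (i : ℕ) ≠ j := fun h => hij (Fin.ext h)
  by_cases hn : (i : ℕ) + 1 = j ∨ (j : ℕ) + 1 = i
  · rw [cartan_near hn, show (1 - -1 : ℤ).toNat = 2 from rfl, lift_adPow_two]
    rcases hn with hn | hn
    · have := xgen_serre (r := r) (s := s) (rh := rh) (sh := sh) PM.pos (Or.inl ⟨hn, rfl⟩)
      rw [← this, pairing_eq r s j i, if_neg hij.symm, if_neg (by omega), if_pos hn, pairing_eq,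
        if_pos rfl]
      simp only [PM.sgn, zpow_one]
      match_scalars <;> field_simp <;> ring
    · have := xgen_serre (r := r) (s := s) (rh := rh) (sh := sh) PM.pos (Or.inr ⟨hn, rfl⟩)
      rw [← this, pairing_eq r s j i, if_neg hij.symm, if_pos hn, pairing_eq, if_pos rfl]
      simp only [PM.sgn, zpow_neg, zpow_one]
      match_scalars <;> field_simp
  · have hA : CartanMatrix.A (n - 1) i j = 0 := cartan_far (by omega)
    rw [hA, show (1 - 0 : ℤ).toNat = 1 from rfl, lift_adPow_one, pairing_eq, if_neg hij.symm,
      if_neg (by omega), if_neg (by omega), one_smul, xgen_comm PM.pos hA, sub_self]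

/-- In the opposite algebra, the `x_i^-(0)` satisfy the Serre relations with `r` and `s`
exchanged. -/
theorem satisfiesSerre_neg [CharZero K] (hr : r ≠ 0) (hs : s ≠ 0) :
    SatisfiesSerre s r fun i => MulOpposite.op (xgen n r s rh sh PM.neg 0 i) := by
  intro i j hij
  have hij' : (i : ℕ) ≠ j := fun h => hij (Fin.ext h)
  by_cases hn : (i : ℕ) + 1 = j ∨ (j : ℕ) + 1 = i
  · rw [cartan_near hn, show (1 - -1 : ℤ).toNat = 2 from rfl, lift_adPow_two]
    simp only [← MulOpposite.op_mul, ← MulOpposite.op_smul, ← MulOpposite.op_sub,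
      ← MulOpposite.op_add, MulOpposite.op_eq_zero_iff, ← mul_assoc]
    rcases hn with hn | hn
    · have := xgen_serre (r := r) (s := s) (rh := rh) (sh := sh) PM.neg (Or.inl ⟨hn, rfl⟩)
      have h2 := congrArg (fun y => (r * s) • y) this
      simp only [smul_zero] at h2
      rw [← h2, pairing_eq s r j i, if_neg hij.symm, if_neg (by omega), if_pos hn, pairing_eq,
        if_pos rfl]
      simp only [PM.sgn, zpow_neg, zpow_one]
      match_scalars <;> field_simp <;> ring
    · have := xgen_serre (r := r) (s := s) (rh := rh) (sh := sh) PM.neg (Or.inr ⟨hn, rfl⟩)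
      have h2 := congrArg (fun y => (r * s)⁻¹ • y) this
      simp only [smul_zero] at h2
      rw [← h2, pairing_eq s r j i, if_neg hij.symm, if_pos hn, pairing_eq, if_pos rfl]
      simp only [PM.sgn, neg_neg, zpow_one]
      match_scalars <;> field_simp
  · have hA : CartanMatrix.A (n - 1) i j = 0 := cartan_far (by omega)
    rw [hA, show (1 - 0 : ℤ).toNat = 1 from rfl, lift_adPow_one, pairing_eq, if_neg hij.symm,
      if_neg (by omega), if_neg (by omega), one_smul, ← MulOpposite.op_mul, ← MulOpposite.op_mul,
      xgen_comm PM.neg hA, sub_self]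

end Serre

section Mirror

variable {K A : Type*} [Field K] [Ring A] [Algebra K A]

theorem op_rightBracket (q : K) (l : List A) :
    MulOpposite.op (rightBracket q l) = leftBracket q (l.map MulOpposite.op) := by
  cases l with
  | nil => rfl
  | cons a l =>
    simp only [rightBracket, leftBracket, List.map_cons]
    induction l generalizing a with
    | nil => rfl
    | cons b l ih =>
      rw [List.foldl_cons, List.map_cons, List.foldl_cons, ih]
      rfl

/-- A family is a basis of a subalgebra if the opposite family is a basis of the opposite
subalgebra. -/
theorem isBasisOf_of_op {ι I : Type*} {b : ι → A} {x : I → A}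
    (hli : LinearIndependent K fun i => MulOpposite.op (b i))
    (hsp : Submodule.span K (Set.range fun i => MulOpposite.op (b i)) =
      Subalgebra.toSubmodule (Algebra.adjoin K (Set.range fun i => MulOpposite.op (x i)))) :
    IsBasisOf b (Algebra.adjoin K (Set.range x)) := by
  set f := (MulOpposite.opLinearEquiv K (M := A)).toLinearMap with hf
  refine ⟨LinearIndependent.of_comp f hli, ?_⟩
  have hinj : Function.Injective (Submodule.map f) :=
    Submodule.map_injective_of_injective (MulOpposite.opLinearEquiv K (M := A)).injective
  refine hinj ?_
  rw [Submodule.map_span, ← Set.range_comp]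
  refine hsp.trans ?_
  have h1 : (Set.range fun i => MulOpposite.op (x i)) = MulOpposite.unop ⁻¹' Set.range x := by
    ext y
    constructor
    · rintro ⟨i, rfl⟩; exact ⟨i, rfl⟩
    · rintro ⟨i, hi⟩; exact ⟨i, congrArg MulOpposite.op hi⟩
  rw [h1, ← Subalgebra.op_adjoin]
  ext y
  constructor
  · intro hy; exact ⟨MulOpposite.unop y, hy, rfl⟩
  · rintro ⟨y, hy, rfl⟩; exact hy

end Mirror

theorem mulIndep_of_algebraicIndependent {K : Type*} [Field K] [Algebra ℚ K] {r s : K}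
    (h : AlgebraicIndependent ℚ ![r, s]) : MulIndep r s := by
  intro x y x' y' he
  have e1 : ∀ x y : ℕ, MvPolynomial.aeval ![r, s]
      (MvPolynomial.X (R := ℚ) (0 : Fin 2) ^ x * MvPolynomial.X 1 ^ y) = r ^ x * s ^ y := by
    intro x y; simp
  rw [← e1, ← e1] at he
  have h1 := h he
  have e2 : ∀ x y : ℕ, (MvPolynomial.X (R := ℚ) (0 : Fin 2) ^ x * MvPolynomial.X 1 ^ y)
      = MvPolynomial.monomial (Finsupp.single 0 x + Finsupp.single 1 y) 1 := by
    intro x y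
    rw [MvPolynomial.X_pow_eq_monomial, MvPolynomial.X_pow_eq_monomial, MvPolynomial.monomial_mul,
      one_mul]
  rw [e2, e2] at h1
  have h2 := MvPolynomial.monomial_left_injective one_ne_zero h1
  have h3 := DFunLike.congr_fun h2 0
  have h4 := DFunLike.congr_fun h2 1
  simp at h3 h4
  exact ⟨h3, h4⟩

end QAff

end

theorem theorem3p8 {K : Type*} [Field K] [CharZero K] (n : ℕ) (hn : 2 < n) (r s rh sh : K)
    (hrs : AlgebraicIndependent ℚ ![r, s]) (hr : rh ^ 2 = r) (hs : sh ^ 2 = s) :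
    QAff.IsLyndonBasis r s (QAff.xgen n r s rh sh QAff.PM.pos 0)
        (QAff.Ufin n r s rh sh QAff.PM.pos) (QAff.monomialPos n r s rh sh) ∧
      QAff.IsLyndonBasisOp r s (QAff.xgen n r s rh sh QAff.PM.neg 0)
        (QAff.Ufin n r s rh sh QAff.PM.neg) (QAff.monomialNeg n r s rh sh) := by
  have hind := QAff.mulIndep_of_algebraicIndependent hrs
  have hr0 := hind.left_ne_zero
  have hs0 := hind.right_ne_zero
  have hne : r + s ≠ 0 := by
    intro h
    have h1 : s = -r := by linear_combination h
    have := (hind 0 2 2 0 (by rw [h1]; ring)).1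
    omega
  subst hr hs
  have hpos : QAff.monomialPos n (rh ^ 2) (sh ^ 2) rh sh = fun ℓ =>
      QAff.rootProd (rh ^ 2) (QAff.extZero (QAff.xgen n (rh ^ 2) (sh ^ 2) rh sh QAff.PM.pos 0))
        (QAff.segList ℓ) :=
    funext fun ℓ => QAff.monomial_eq_rootProd _ ℓ
  have hneg : (fun ℓ => MulOpposite.op (QAff.monomialNeg n (rh ^ 2) (sh ^ 2) rh sh ℓ)) = fun ℓ =>
      QAff.rootProd (sh ^ 2) (QAff.extZero fun i =>
        MulOpposite.op (QAff.xgen n (rh ^ 2) (sh ^ 2) rh sh QAff.PM.neg 0 i)) (QAff.segList ℓ) := by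
    funext ℓ
    rw [← QAff.monomial_eq_rootProd, QAff.monomialNeg, MulOpposite.op_list_prod, List.map_map,
      ← List.map_reverse]
    congr 1
    refine List.map_congr_left fun α _ => ?_
    rw [Function.comp_apply, MulOpposite.op_pow, QAff.rootVecNeg, QAff.op_rightBracket,
      List.map_map]
    rfl
  refine ⟨⟨⟨?_, ?_⟩, ?_⟩, ⟨QAff.isBasisOf_of_op ?_ ?_, ?_⟩⟩
  · rw [hpos]
    exact QAff.linearIndependent_rootProd fun L hL hp =>
      (QAff.exists_detecting_forms hind hL hp).1
  · rw [hpos]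
    exact QAff.span_rootProd (QAff.satisfiesSerre_pos hr0 hs0) hr0 hs0 hne
  · rw [hpos]
    exact QAff.isLyndonFamily_rootProd hr0 hs0 hne
  · rw [hneg]
    exact QAff.linearIndependent_rootProd fun L hL hp =>
      (QAff.exists_detecting_forms hind hL hp).2
  · rw [hneg]
    exact QAff.span_rootProd (QAff.satisfiesSerre_neg hr0 hs0) hs0 hr0 (by rwa [add_comm])
  · rw [hneg]
    exact QAff.isLyndonFamily_rootProd hs0 hr0 (by rwa [add_comm])
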